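/- Let $R\in\mathbb{R}^{n\times n}$ be a density matrix, i.e. symmetric positive semidefinite with $\operatorname{tr}R=1$. Let $p_1\ge p_2\ge\dots\ge p_n\ge 0$ be its eigenvalues, at most $k$ of which are nonzero, let $\mathcal{H}(R)=-\sum_{p_i>0}p_i\ln p_i$ be its von Neumann entropy, $\mathrm{nnz}(R)$ its number of nonzero entries, and let $0<\epsilon<1/2$. For a (random) matrix $\Pi\in\mathbb{R}^{n\times s}$ let $\tilde p_1\ge\tilde p_2\ge\dots\ge 0$ be the singular values of $R\Pi$ (sequences are continued by zeros) and $\widehat{\mathcal{H}}(R)=\sum_{i=1}^k\tilde p_i\ln(1/\tilde p_i)$, with $0\ln(1/0)=0$. The random-projection algorithm draws $\Pi$ and returns $\tilde p_1,\dots,\tilde p_k$ and $\widehat{\mathcal{H}}(R)$. Two distributions of $\Pi$ are considered. * *Input-sparsity transform*: $\Pi=DS$, where $D\in\mathbb{R}^{n\times n}$ is diagonal with independent uniform signs $\pm1$ and each row of $S\in\mathbb{R}^{n\times s}$ is, independently, a uniformly random canonical row vector $e_j^T$, $1\le j\le s$. * *Subsampled randomized Hadamard transform*: let $N$ be the least power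 of two with $N\ge n$, $H$ the normalized Walsh–Hadamard matrix of order $N$, $D\in\mathbb{R}^{N\times N}$ diagonal with independent uniform signs, and $S\in\mathbb{R}^{N\times s}$ with independent columns, each uniform among the canonical vectors of $\mathbb{R}^N$. Then $\Pi$ consists of the first $n$ rows of $\sqrt{N/s}\,DHS$ (so $R$ is padded by zero columns if $n$ is not a power of two). **Theorem.** There are universal constants $c_1,c_2>0$ such that, for all $n,k,R,\epsilon$ as above: 1. If $\Pi$ is the input-sparsity transform with $s\ge c_1k^2/\epsilon^2$ columns, or the subsampled randomized Hadamard transform with $s\ge c_2\,(k+\ln n)\ln(k+1)/\epsilon^2$ columns, then with probability at least $0.9$ both $$|p_i^2-\tilde p_i^2|\le\epsilon\,p_i^2\quad\text{for all } i,\qquad\text{and}\qquad \bigl|\mathcal{H}(R)-\widehat{\mathcal{H}}(R)\bigr|\le\sqrt{\epsilon}\,\mathcal{H}(R)+\sqrt{\tfrac32}\,\epsilon .$$ 2. With the input-sparsity transform and $s=\lceil c_1k^2/\epsilon^2\rceil$, the algorithm runs in time $\mathcal{O}\bigl(\mathrm{nnz}(R)+nk^4/\epsilon^4\bigr)$: there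 are a single program for a real random access machine and a constant $C$ such that for all $n,k,R,\epsilon$ as above and for every outcome of the random choices, the program, given $n,k,s$, the list of the nonzero entries of $R$ with their positions (in any order) and the outcomes of the random choices, computes exactly $\tilde p_1,\dots,\tilde p_k$ and $\widehat{\mathcal{H}}(R)$ in at most $C\,(\mathrm{nnz}(R)+nk^4/\epsilon^4)$ steps. Here every memory access (including every access to a random choice), integer addition or subtraction, operation $+,-,\times,/,\sqrt{\ },\ln$ on reals, comparison, assignment and loop iteration costs one step, and extracting one real root of a monic real polynomial of degree $d$ costs $d$ further steps. -/

import Mathlib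

open scoped Matrix

noncomputable section

namespace RandProj

/-! ### Density matrices, their probabilities and their entropy -/

/-- A (real) density matrix: symmetric positive semidefinite with unit trace. -/
structure IsDensity {n : ℕ} (R : Matrix (Fin n) (Fin n) ℝ) : Prop where
  posSemidef : R.PosSemidef
  trace_eq_one : R.trace = 1

theorem IsDensity.isHermitian {n : ℕ} {R : Matrix (Fin n) (Fin n) ℝ} (hR : IsDensity R) :
    R.IsHermitian := hR.posSemidef.isHermitian

/-- The probabilities `p₀ ≥ p₁ ≥ …` of a density matrix: its eigenvalues with multiplicity in
decreasing order, followed by zeros. -/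
def probs {n : ℕ} {R : Matrix (Fin n) (Fin n) ℝ} (hR : IsDensity R) (i : ℕ) : ℝ :=
  if h : i < Fintype.card (Fin n) then hR.isHermitian.eigenvalues₀ ⟨i, h⟩ else 0

/-- At most `k` of the probabilities (eigenvalues with multiplicity) are nonzero. -/
def AtMostNonzero {n : ℕ} {R : Matrix (Fin n) (Fin n) ℝ} (hR : IsDensity R) (k : ℕ) : Prop :=
  {i : Fin n | hR.isHermitian.eigenvalues i ≠ 0}.ncard ≤ k

/-- The von Neumann entropy `-∑ pᵢ ln pᵢ` (with `0 ln 0 = 0`). -/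
def entropy {n : ℕ} {R : Matrix (Fin n) (Fin n) ℝ} (hR : IsDensity R) : ℝ :=
  ∑ i : Fin n, Real.negMulLog (hR.isHermitian.eigenvalues i)

/-- The number of nonzero entries. -/
def nnz {n : ℕ} (R : Matrix (Fin n) (Fin n) ℝ) : ℕ :=
  {e : Fin n × Fin n | R e.1 e.2 ≠ 0}.ncard

/-! ### The output of the random-projection algorithm -/

/-- The approximate probabilities `p̃₀ ≥ p̃₁ ≥ …`: the singular values of `R * Π` in decreasing
order, followed by zeros. -/
def approxProbs {n s : ℕ} (R : Matrix (Fin n) (Fin n) ℝ) (Pi : Matrix (Fin n) (Fin s) ℝ)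
    (i : ℕ) : ℝ :=
  (Matrix.toEuclideanLin (R * Pi)).singularValues i

/-- The approximate entropy `∑_{i < k} p̃ᵢ ln (1 / p̃ᵢ)` (with `0 ln (1 / 0) = 0`). -/
def approxEntropy {n s : ℕ} (R : Matrix (Fin n) (Fin n) ℝ) (k : ℕ)
    (Pi : Matrix (Fin n) (Fin s) ℝ) : ℝ :=
  ∑ i ∈ Finset.range k, approxProbs R Pi i * Real.log (1 / approxProbs R Pi i)

/-- Both error bounds hold for the sketching matrix `Π`. -/
def Accurate {n s : ℕ} {R : Matrix (Fin n) (Fin n) ℝ} (hR : IsDensity R) (k : ℕ) (ε : ℝ)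
    (Pi : Matrix (Fin n) (Fin s) ℝ) : Prop :=
  (∀ i : ℕ, |probs hR i ^ 2 - approxProbs R Pi i ^ 2| ≤ ε * probs hR i ^ 2) ∧
    |entropy hR - approxEntropy R k Pi| ≤ √ε * entropy hR + √(3 / 2) * ε

/-! ### The two random sketching matrices

The random choices are uniformly distributed on a finite product, that is, all the
coordinates are independent and uniform. -/

/-- The sign `±1` encoded by a bit. -/
def sgn (b : Bool) : ℝ := if b then 1 else -1

/-- The random choices of the input-sparsity transform: a bucket and a sign for every row. -/
abbrev SparseChoice (n s : ℕ) : Type := (Fin n → Fin s) × (Fin n → Bool)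

/-- The input-sparsity transform `Π = D S`: row `t` of `S` is the canonical row vector of the
bucket of `t`, and `D` is the diagonal matrix of the signs. -/
def sparseSketch {n s : ℕ} (ω : SparseChoice n s) : Matrix (Fin n) (Fin s) ℝ :=
  Matrix.diagonal (fun t => sgn (ω.2 t)) *
    Matrix.of fun (t : Fin n) (c : Fin s) => if ω.1 t = c then (1 : ℝ) else 0

/-- The normalized Walsh-Hadamard matrix of order `2 ^ m`: the entry `(i, j)` is
`(-1) ^ ⟨i, j⟩ / √(2 ^ m)`, where `⟨i, j⟩` is the number of common binary digits `1`. -/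
def hadamard (m : ℕ) : Matrix (Fin (2 ^ m)) (Fin (2 ^ m)) ℝ :=
  Matrix.of fun i j =>
    (∏ b ∈ Finset.range m, if (i : ℕ).testBit b && (j : ℕ).testBit b then (-1 : ℝ) else 1) /
      √(2 ^ m)

/-- The order of the Hadamard matrix: the least power of two that is at least `n`. -/
abbrev padDim (n : ℕ) : ℕ := 2 ^ Nat.clog 2 n

/-- The random choices of the subsampled randomized Hadamard transform: `s` samples with
replacement, and a sign for every coordinate. -/
abbrev HadamardChoice (n s : ℕ) : Type := (Fin s → Fin (padDim n)) × (Fin (padDim n) → Bool)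

/-- The rescaled subsampled randomized Hadamard transform `Π = √(N / s) D H S`, of order
`N = padDim n`; multiplying `R` by its first `n` rows amounts to padding `R` with zero columns.
When `n` is a power of two, `N = n` and there is no padding. -/
def hadamardSketch {n s : ℕ} (ω : HadamardChoice n s) : Matrix (Fin n) (Fin s) ℝ :=
  (√((padDim n : ℝ) / s) •
    (Matrix.diagonal (fun t => sgn (ω.2 t)) * hadamard (Nat.clog 2 n) *
      Matrix.of fun (i : Fin (padDim n)) (t : Fin s) => if i = ω.1 t then (1 : ℝ) else 0)).submatrix
    (Fin.castLE (Nat.le_pow_clog one_lt_two n)) id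

/-! ### A real random access machine with for-loops

The memory has integer variables, one-dimensional integer arrays and two-dimensional real
arrays. Every operation on integers or reals, every memory access, test, assignment and loop
iteration costs one step. Exact singular values cannot be obtained by arithmetic operations and
radicals alone; as the one further operation the machine can extract a root of a monic
real polynomial, at a cost equal to the degree. -/

/-- Memory contents. -/
structure Mem where
  ivar : ℕ → ℕ
  iarr : ℕ → ℕ → ℕ
  rarr : ℕ → ℕ → ℕ → ℝ

/-- Write an integer variable. -/
def Mem.putVar (σ : Mem) (x v : ℕ) : Mem :=
  { σ with ivar := Function.update σ.ivar x v }

/-- Write a cell of an integer array. -/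
def Mem.putInt (σ : Mem) (a i v : ℕ) : Mem :=
  { σ with iarr := Function.update σ.iarr a (Function.update (σ.iarr a) i v) }

/-- Write a cell of a real array. -/
def Mem.putReal (σ : Mem) (a i j : ℕ) (v : ℝ) : Mem :=
  { σ with rarr := fun a' i' j' => if a' = a ∧ i' = i ∧ j' = j then v else σ.rarr a' i' j' }

/-- Integer expressions (`sub` is truncated). -/
inductive IExp : Type where
  | lit (m : ℕ)
  | var (x : ℕ)
  | get (a : ℕ) (i : IExp)
  | add (e f : IExp)
  | sub (e f : IExp)

/-- Value of an integer expression. -/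
def IExp.eval (σ : Mem) : IExp → ℕ
  | .lit m => m
  | .var x => σ.ivar x
  | .get a i => σ.iarr a (i.eval σ)
  | .add e f => e.eval σ + f.eval σ
  | .sub e f => e.eval σ - f.eval σ

/-- Number of steps of the evaluation of an integer expression. -/
def IExp.cost : IExp → ℕ
  | .lit _ => 1
  | .var _ => 1
  | .get _ i => i.cost + 1
  | .add e f => e.cost + f.cost + 1
  | .sub e f => e.cost + f.cost + 1

/-- Real expressions. `root a d j` is the `j`-th largest real root (counted from `0`, with
multiplicity) of `X ^ d + ∑_{i < d} A[i, 0] X ^ i`, where `A` is the real array named `a`. -/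
inductive RExp : Type where
  | lit (q : ℚ)
  | get (a : ℕ) (i j : IExp)
  | add (e f : RExp)
  | sub (e f : RExp)
  | mul (e f : RExp)
  | div (e f : RExp)
  | sqrt (e : RExp)
  | log (e : RExp)
  | root (a : ℕ) (d j : IExp)

/-- The monic real polynomial of degree `d` with lower coefficients `v 0, …, v (d - 1)`. -/
def monicPoly (v : ℕ → ℝ) (d : ℕ) : Polynomial ℝ :=
  Polynomial.X ^ d + ∑ i ∈ Finset.range d, Polynomial.C (v i) * Polynomial.X ^ i

/-- Value of a real expression. -/
def RExp.eval (σ : Mem) : RExp → ℝ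
  | .lit q => q
  | .get a i j => σ.rarr a (i.eval σ) (j.eval σ)
  | .add e f => e.eval σ + f.eval σ
  | .sub e f => e.eval σ - f.eval σ
  | .mul e f => e.eval σ * f.eval σ
  | .div e f => e.eval σ / f.eval σ
  | .sqrt e => √(e.eval σ)
  | .log e => Real.log (e.eval σ)
  | .root a d j =>
      ((monicPoly (fun i => σ.rarr a i 0) (d.eval σ)).roots.sort (· ≥ ·)).getD (j.eval σ) 0

/-- Number of steps of the evaluation of a real expression. -/
def RExp.cost (σ : Mem) : RExp → ℕ
  | .lit _ => 1
  | .get _ i j => i.cost + j.cost + 1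
  | .add e f => e.cost σ + f.cost σ + 1
  | .sub e f => e.cost σ + f.cost σ + 1
  | .mul e f => e.cost σ + f.cost σ + 1
  | .div e f => e.cost σ + f.cost σ + 1
  | .sqrt e => e.cost σ + 1
  | .log e => e.cost σ + 1
  | .root _ d j => d.cost + j.cost + d.eval σ + 1

/-- Tests: strict comparison of integers or of reals. -/
inductive BExp : Type where
  | ilt (e f : IExp)
  | rlt (e f : RExp)

/-- Truth of a test. -/
def BExp.Holds (σ : Mem) : BExp → Prop
  | .ilt e f => e.eval σ < f.eval σ
  | .rlt e f => e.eval σ < f.eval σ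

/-- Number of steps of a test. -/
def BExp.cost (σ : Mem) : BExp → ℕ
  | .ilt e f => e.cost + f.cost + 1
  | .rlt e f => e.cost σ + f.cost σ + 1

/-- Programs: assignments to an integer variable, to an integer array cell and to a real array
cell; sequences; conditionals; and loops `for x = 0, …, e - 1`, with the bound `e` evaluated once
on entry. -/
inductive Prog : Type where
  | skip
  | setVar (x : ℕ) (e : IExp)
  | setInt (a : ℕ) (i e : IExp)
  | setReal (a : ℕ) (i j : IExp) (e : RExp)
  | seq (P Q : Prog)
  | cond (b : BExp) (P Q : Prog)
  | loop (x : ℕ) (e : IExp) (P : Prog)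

open Classical in
/-- Execution of a program: the final memory and the number of steps. -/
def Prog.exec : Prog → Mem → Mem × ℕ
  | .skip, σ => (σ, 1)
  | .setVar x e, σ => (σ.putVar x (e.eval σ), e.cost + 1)
  | .setInt a i e, σ => (σ.putInt a (i.eval σ) (e.eval σ), i.cost + e.cost + 1)
  | .setReal a i j e, σ =>
      (σ.putReal a (i.eval σ) (j.eval σ) (e.eval σ), i.cost + j.cost + e.cost σ + 1)
  | .seq P Q, σ =>
      ((Q.exec (P.exec σ).1).1, (P.exec σ).2 + (Q.exec (P.exec σ).1).2)
  | .cond b P Q, σ =>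
      if b.Holds σ then ((P.exec σ).1, b.cost σ + (P.exec σ).2)
      else ((Q.exec σ).1, b.cost σ + (Q.exec σ).2)
  | .loop x e P, σ =>
      (List.range (e.eval σ)).foldl
        (fun acc t =>
          ((P.exec (acc.1.putVar x t)).1, acc.2 + (P.exec (acc.1.putVar x t)).2 + 1))
        (σ, e.cost + 1)

/-- `L` lists the positions of the nonzero entries of `R`, each once, in any order. -/
def ListsSupport {n : ℕ} (R : Matrix (Fin n) (Fin n) ℝ) (L : List (Fin n × Fin n)) : Prop :=
  L.Nodup ∧ ∀ e : Fin n × Fin n, e ∈ L ↔ R e.1 e.2 ≠ 0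

/-- The memory at the start. Integer variables `0, 1, 2, 3` hold `n`, `k`, `s` and the number of
nonzero entries of `R`. The matrix is in coordinate format: integer arrays `0`, `1` hold the row
and column indices of the nonzero entries and real array `0` (in column `0`) holds their values.
The outcomes of the random choices are in integer array `2` (buckets) and in column `0` of real
array `1` (signs), where every use of one costs a step. All other cells are zero. -/
def initMem {n s : ℕ} (k : ℕ) (R : Matrix (Fin n) (Fin n) ℝ) (L : List (Fin n × Fin n))
    (ω : SparseChoice n s) : Mem where
  ivar x := if x = 0 then n else if x = 1 then k else if x = 2 then s
    else if x = 3 then L.length else 0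
  iarr a i :=
    if a = 0 then (if h : i < L.length then (L[i].1 : ℕ) else 0)
    else if a = 1 then (if h : i < L.length then (L[i].2 : ℕ) else 0)
    else if a = 2 then (if h : i < n then (ω.1 ⟨i, h⟩ : ℕ) else 0)
    else 0
  rarr a i j :=
    if a = 0 ∧ j = 0 then (if h : i < L.length then R L[i].1 L[i].2 else 0)
    else if a = 1 ∧ j = 0 then (if h : i < n then sgn (ω.2 ⟨i, h⟩) else 0)
    else 0

/-- The final memory holds the output of the algorithm: `p̃₀, …, p̃_{k-1}` in column `0` of real
array `2`, and the approximate entropy in cell `(0, 0)` of real array `3`. -/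
def HoldsOutput {n s : ℕ} (k : ℕ) (R : Matrix (Fin n) (Fin n) ℝ)
    (Pi : Matrix (Fin n) (Fin s) ℝ) (σ : Mem) : Prop :=
  (∀ i < k, σ.rarr 2 i 0 = approxProbs R Pi i) ∧ σ.rarr 3 0 0 = approxEntropy R k Pi

end RandProj

end

/-! Accuracy is a deterministic consequence of a near isometry. Write `R = U V`, where the columns
of `U`, at most `k` in number, are orthonormal eigenvectors for the nonzero eigenvalues. As `R` is
symmetric, `(R Π)(R Π)ᵀ = Vᵀ (Uᵀ Π Πᵀ U) V`, whereas `R² = Vᵀ V`. If `Uᵀ Π Πᵀ U` is within `ε` of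
the identity as a quadratic form (`NearIsometry`), the min-max principle (`le_mul_of_forall_sum_le`)
bounds the change of every squared eigenvalue. A scalar estimate (`abs_negMulLog_sub_le`), summed
using `∑ pᵢ = 1`, then bounds the entropy.

For the input-sparsity transform, the entries of `Uᵀ Π Πᵀ U - 1` are off-diagonal quadratic forms in
random signs, supported on colliding pairs of rows. Their second moment is computed by
`sum_sq_chaos_le`, two rows collide with probability at most `1 / s`, and Markov's inequality for
the squared Frobenius norm gives `s ≥ 20 k² / ε²`.

For the Hadamard transform of order `N`, the random signs flatten `U`: with high probability all
rows of `√N H D U` have squared length at most `24 (k + ln n)` (`card_not_isFlat_le`, from an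
exponential moment obtained by Gaussian linearization). Sampling such rows preserves the form by a
matrix Chernoff bound (`card_not_isBalancedSample_le`), which rests on the Golden-Thompson
inequality (`trace_exp_add_le`).

The program forms `B = R Π` in `O(nnz R)` steps and `G = Bᵀ B` in `O(n s²)` steps. Pivoted Cholesky
gives `G = L Lᵀ` with only `r = min k n` columns, because the rank of `G` is at most `r`. The small
matrix `K = Lᵀ L` has the same nonzero eigenvalues as `G`. Its characteristic polynomial comes from
traces of powers by Newton's identities, and the square roots of its roots are the singular values.
All costs after the first phase are `O(n s²)`, because `r ≤ n` and `r² ≤ s`; with `s` of order `k² /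
ε²` this is `O(n k⁴ / ε⁴)`. -/

namespace RandProj

/-! ### Sorted roots -/

/-- The `i`-th largest element of a multiset of reals, continued by zeros. -/
noncomputable def sortedAt (m : Multiset ℝ) (i : ℕ) : ℝ := (m.sort (· ≥ ·)).getD i 0

/-- Among nonnegative numbers extra zeros are sorted to the end, where the default value `0` of
`getD` already stood. -/
theorem sortedAt_add_replicate_zero (m : Multiset ℝ) (hm : ∀ x ∈ m, 0 ≤ x) (z i : ℕ) :
    sortedAt (m + Multiset.replicate z 0) i = sortedAt m i := by
  have key : (m + Multiset.replicate z 0).sort (· ≥ ·) =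
      m.sort (· ≥ ·) ++ List.replicate z 0 := by
    apply List.Perm.eq_of_pairwise (le := (· ≥ ·)) (fun a b _ _ h h' => le_antisymm h' h)
      (Multiset.pairwise_sort _ _)
    · rw [List.pairwise_append]
      refine ⟨Multiset.pairwise_sort _ _, ?_, ?_⟩
      · rw [List.pairwise_replicate]; right; exact le_refl _
      · intro a ha b hb
        rw [List.eq_of_mem_replicate hb]
        exact hm a (by simpa using ha)
    · rw [← Multiset.coe_eq_coe, Multiset.sort_eq, ← Multiset.coe_add, Multiset.sort_eq,
        Multiset.coe_replicate]
  unfold sortedAt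
  rw [key]
  by_cases h : i < (m.sort (· ≥ ·)).length
  · rw [List.getD_append _ _ _ _ h]
  · rw [List.getD_append_right _ _ _ _ (by omega),
      List.getD_eq_default (m.sort (· ≥ ·)) _ (by omega)]
    by_cases h' : i - (m.sort (· ≥ ·)).length < z
    · rw [List.getD_replicate _ h']
    · rw [List.getD_eq_default]; simpa using h'

/-- The two characteristic polynomials agree up to powers of `X`, which only add zero roots.
Nonnegativity keeps these zeros behind the other roots, so matrices of different sizes can be
compared. -/
theorem sortedAt_charpoly_mul_comm {m n : Type*} [Fintype m] [Fintype n] [DecidableEq m]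
    [DecidableEq n] (A : Matrix m n ℝ) (B : Matrix n m ℝ)
    (h : ∀ x ∈ (A * B).charpoly.roots, 0 ≤ x) (i : ℕ) :
    sortedAt (A * B).charpoly.roots i = sortedAt (B * A).charpoly.roots i := by
  have key := congrArg Polynomial.roots (Matrix.charpoly_mul_comm' A B)
  have hX : ∀ z : ℕ, (Polynomial.X ^ z : Polynomial ℝ) ≠ 0 :=
    fun z => pow_ne_zero _ Polynomial.X_ne_zero
  rw [Polynomial.roots_mul (mul_ne_zero (hX _) (Matrix.charpoly_monic _).ne_zero),
    Polynomial.roots_mul (mul_ne_zero (hX _) (Matrix.charpoly_monic _).ne_zero),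
    Polynomial.roots_X_pow, Polynomial.roots_X_pow, Multiset.nsmul_singleton,
    Multiset.nsmul_singleton, add_comm, add_comm (Multiset.replicate _ _)] at key
  rw [← sortedAt_add_replicate_zero _ h (Fintype.card n), key, sortedAt_add_replicate_zero]
  intro x hx
  have : x ∈ (A * B).charpoly.roots + Multiset.replicate (Fintype.card n) 0 := by
    rw [key]; exact Multiset.mem_add.2 (Or.inl hx)
  rcases Multiset.mem_add.1 this with h' | h'
  · exact h x h'
  · rw [Multiset.eq_of_mem_replicate h']

theorem sortedAt_charpoly_roots {n : Type*} [Fintype n] [DecidableEq n] {A : Matrix n n ℝ}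
    (hA : A.IsHermitian) (i : ℕ) :
    sortedAt A.charpoly.roots i =
      if h : i < Fintype.card n then hA.eigenvalues₀ ⟨i, h⟩ else 0 := by
  have := hA.sort_roots_charpoly_eq_eigenvalues₀
  have h2 : Multiset.map (⇑(RCLike.re : ℝ →+ ℝ)) A.charpoly.roots = A.charpoly.roots := by
    exact (Multiset.map_congr rfl fun _ _ => rfl).trans (Multiset.map_id _)
  rw [h2] at this
  unfold sortedAt
  rw [this]
  split_ifs with h
  · rw [List.getD_eq_getElem _ _ (by simpa using h)]; simp
  · rw [List.getD_eq_default]; simpa using h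

theorem nonneg_of_mem_roots_charpoly {n : Type*} [Fintype n] [DecidableEq n] {A : Matrix n n ℝ}
    (hA : A.PosSemidef) {x : ℝ} (hx : x ∈ A.charpoly.roots) : 0 ≤ x := by
  rw [hA.isHermitian.roots_charpoly_eq_eigenvalues] at hx
  obtain ⟨i, -, rfl⟩ := Multiset.mem_map.1 hx
  exact hA.eigenvalues_nonneg i

/-- `eigenvalues` depends on a proof of symmetry, so equal operators are exchanged by substitution
instead of by rewriting. -/
theorem eigenvalues_congr {E : Type*} [NormedAddCommGroup E] [InnerProductSpace ℝ E]
    [FiniteDimensional ℝ E] {T T' : E →ₗ[ℝ] E} (h : T = T') (hT : T.IsSymmetric)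
    (hT' : T'.IsSymmetric) {n : ℕ} (hn : Module.finrank ℝ E = n) :
    hT.eigenvalues hn = hT'.eigenvalues hn := by
  subst h; rfl

theorem sq_approxProbs {n s : ℕ} (R : Matrix (Fin n) (Fin n) ℝ) (Pi : Matrix (Fin n) (Fin s) ℝ)
    (i : ℕ) : approxProbs R Pi i ^ 2 = sortedAt ((R * Pi)ᵀ * (R * Pi)).charpoly.roots i := by
  set B := R * Pi with hB
  have hcomp : LinearMap.adjoint (Matrix.toEuclideanLin B) ∘ₗ Matrix.toEuclideanLin B =
      Matrix.toEuclideanLin (Bᵀ * B) := by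
    rw [← Matrix.toEuclideanLin_conjTranspose_eq_adjoint]
    ext x j
    simp [Matrix.toLpLin_apply, Matrix.mulVec_mulVec]
  have hH : (Bᵀ * B).IsHermitian := Matrix.isHermitian_conjTranspose_mul_self B
  rw [sortedAt_charpoly_roots hH]
  unfold approxProbs
  rw [← hB]
  split_ifs with h
  · have hfin : Module.finrank ℝ (EuclideanSpace ℝ (Fin s)) = Fintype.card (Fin s) :=
      finrank_euclideanSpace
    rw [LinearMap.sq_singularValues_of_lt (Matrix.toEuclideanLin B) hfin h]
    exact congrFun (eigenvalues_congr hcomp _ _ hfin) _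
  · rw [LinearMap.singularValues_of_finrank_le]
    · simp
    · simpa using h

/-- The `n × n` Gram matrix is the one to compare with `R²`; the `s × s` one is what the program
computes. -/
theorem sq_approxProbs' {n s : ℕ} (R : Matrix (Fin n) (Fin n) ℝ) (Pi : Matrix (Fin n) (Fin s) ℝ)
    (i : ℕ) : approxProbs R Pi i ^ 2 = sortedAt ((R * Pi) * (R * Pi)ᵀ).charpoly.roots i := by
  rw [sq_approxProbs, sortedAt_charpoly_mul_comm]
  intro x hx
  exact nonneg_of_mem_roots_charpoly (Matrix.posSemidef_conjTranspose_mul_self (R * Pi)) hx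

theorem approxProbs_nonneg {n s : ℕ} (R : Matrix (Fin n) (Fin n) ℝ)
    (Pi : Matrix (Fin n) (Fin s) ℝ) (i : ℕ) : 0 ≤ approxProbs R Pi i :=
  LinearMap.singularValues_nonneg _ _

/-! ### Comparison of eigenvalues of comparable quadratic forms -/

/-- This is the Courant-Fischer argument. The span of the first `i + 1` vectors of `b` meets the
span of the last `n - i` vectors of `b'` in some nonzero `x`. On `x` the left form is at least `μ i
* ‖x‖ ^ 2` and the right one at most `c * μ' i * ‖x‖ ^ 2`. -/
theorem le_mul_of_forall_sum_le {n : ℕ} {E : Type*} [NormedAddCommGroup E]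
    [InnerProductSpace ℝ E] (b b' : OrthonormalBasis (Fin n) ℝ E)
    {μ μ' : Fin n → ℝ} (hμ : Antitone μ) (hμ' : Antitone μ') {c : ℝ} (hc : 0 ≤ c)
    (h : ∀ x, ∑ j, μ j * inner ℝ (b j) x ^ 2 ≤ c * ∑ j, μ' j * inner ℝ (b' j) x ^ 2)
    (i : Fin n) : μ i ≤ c * μ' i := by
  have : FiniteDimensional ℝ E := b.toBasis.finiteDimensional_of_finite
  have hfr : Module.finrank ℝ E = n := by
    rw [Module.finrank_eq_card_basis b.toBasis, Fintype.card_fin]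
  let V : Submodule ℝ E := Submodule.span ℝ (Set.range fun j : {j : Fin n // j ≤ i} => b j)
  let W : Submodule ℝ E := Submodule.span ℝ (Set.range fun j : {j : Fin n // i ≤ j} => b' j)
  have hV : Module.finrank ℝ V = i + 1 := by
    rw [finrank_span_eq_card]
    · rw [Fintype.card_subtype]
      have : (Finset.univ.filter fun j : Fin n => j ≤ i) = Finset.Iic i := by ext; simp
      rw [this, Fin.card_Iic]
    · exact b.orthonormal.linearIndependent.comp _ Subtype.val_injective
  have hW : Module.finrank ℝ W = n - i := by
    rw [finrank_span_eq_card]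
    · rw [Fintype.card_subtype]
      have : (Finset.univ.filter fun j : Fin n => i ≤ j) = Finset.Ici i := by ext; simp
      rw [this, Fin.card_Ici]
    · exact b'.orthonormal.linearIndependent.comp _ Subtype.val_injective
  -- The dimensions `i + 1` and `n - i` add up to `n + 1`.
  have hinf : V ⊓ W ≠ ⊥ := by
    intro hbot
    have h1 := Submodule.finrank_sup_add_finrank_inf_eq V W
    have h2 := Submodule.finrank_le (V ⊔ W)
    rw [hbot, finrank_bot, hV, hW] at h1
    have := i.2
    omega
  obtain ⟨x, hx, hx0⟩ := Submodule.exists_mem_ne_zero_of_ne_bot hinf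
  have hVx : ∀ j, i < j → inner ℝ (b j) x = 0 := by
    intro j hj
    have : V ≤ (ℝ ∙ b j)ᗮ := by
      refine Submodule.span_le.2 ?_
      rintro _ ⟨l, rfl⟩
      rw [SetLike.mem_coe, Submodule.mem_orthogonal_singleton_iff_inner_right]
      exact b.orthonormal.2 (by rintro rfl; exact absurd l.2 (not_le.2 hj))
    exact Submodule.mem_orthogonal_singleton_iff_inner_right.1 (this hx.1)
  have hWx : ∀ j, j < i → inner ℝ (b' j) x = 0 := by
    intro j hj
    have : W ≤ (ℝ ∙ b' j)ᗮ := by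
      refine Submodule.span_le.2 ?_
      rintro _ ⟨l, rfl⟩
      rw [SetLike.mem_coe, Submodule.mem_orthogonal_singleton_iff_inner_right]
      exact b'.orthonormal.2 (by rintro rfl; exact absurd l.2 (not_le.2 hj))
    exact Submodule.mem_orthogonal_singleton_iff_inner_right.1 (this hx.2)
  have hn : ∀ b : OrthonormalBasis (Fin n) ℝ E, ∑ j, inner ℝ (b j) x ^ 2 = ‖x‖ ^ 2 := by
    intro b
    rw [← b.sum_sq_norm_inner_right x]
    simp
  have h1 : μ i * ‖x‖ ^ 2 ≤ ∑ j, μ j * inner ℝ (b j) x ^ 2 := by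
    rw [← hn b, Finset.mul_sum]
    refine Finset.sum_le_sum fun j _ => ?_
    rcases le_or_gt j i with hj | hj
    · exact mul_le_mul_of_nonneg_right (hμ hj) (sq_nonneg _)
    · rw [hVx j hj]; simp
  have h2 : ∑ j, μ' j * inner ℝ (b' j) x ^ 2 ≤ μ' i * ‖x‖ ^ 2 := by
    rw [← hn b', Finset.mul_sum]
    refine Finset.sum_le_sum fun j _ => ?_
    rcases le_or_gt i j with hj | hj
    · exact mul_le_mul_of_nonneg_right (hμ' hj) (sq_nonneg _)
    · rw [hWx j hj]; simp
  have hx2 : 0 < ‖x‖ ^ 2 := by positivity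
  have h3 : μ i * ‖x‖ ^ 2 ≤ (c * μ' i) * ‖x‖ ^ 2 := by
    calc _ ≤ _ := h1
      _ ≤ _ := h x
      _ ≤ c * (μ' i * ‖x‖ ^ 2) := mul_le_mul_of_nonneg_left h2 hc
      _ = _ := by ring
  exact le_of_mul_le_mul_right h3 hx2

/-! ### From a near isometry to the two error bounds -/

/-- `Πᵀ` preserves squared lengths on the range of `U` up to a relative error `ε`
(if `U` has orthonormal columns). -/
def NearIsometry {n s : ℕ} {I : Type*} [Fintype I] (U : Matrix (Fin n) I ℝ) (ε : ℝ)
    (Pi : Matrix (Fin n) (Fin s) ℝ) : Prop :=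
  ∀ a : I → ℝ, |a ⬝ᵥ ((Uᵀ * (Pi * Piᵀ) * U) *ᵥ a) - a ⬝ᵥ a| ≤ ε * (a ⬝ᵥ a)

/-! ### Spectral data of a density matrix -/

theorem exists_eigenbasis {n : ℕ} {A : Matrix (Fin n) (Fin n) ℝ} (hA : A.IsHermitian) :
    ∃ b : OrthonormalBasis (Fin (Fintype.card (Fin n))) ℝ (EuclideanSpace ℝ (Fin n)),
      ∀ (j : Fin (Fintype.card (Fin n))) (x : EuclideanSpace ℝ (Fin n)),
        inner ℝ (b j) (Matrix.toEuclideanLin A x) = hA.eigenvalues₀ j * inner ℝ (b j) x := by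
  have hT := Matrix.isSymmetric_toEuclideanLin_iff.2 hA
  have hfin : Module.finrank ℝ (EuclideanSpace ℝ (Fin n)) = Fintype.card (Fin n) :=
    finrank_euclideanSpace
  refine ⟨hT.eigenvectorBasis hfin, fun j x => ?_⟩
  have := hT.eigenvectorBasis_apply_self_apply hfin x j
  simp only [OrthonormalBasis.repr_apply_apply, RCLike.ofReal_real_eq_id, id] at this
  exact this

theorem probs_of_lt {n : ℕ} {R : Matrix (Fin n) (Fin n) ℝ} (hR : IsDensity R) {i : ℕ}
    (h : i < Fintype.card (Fin n)) : probs hR i = hR.isHermitian.eigenvalues₀ ⟨i, h⟩ :=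
  dif_pos h

theorem probs_of_not_lt {n : ℕ} {R : Matrix (Fin n) (Fin n) ℝ} (hR : IsDensity R) {i : ℕ}
    (h : ¬ i < Fintype.card (Fin n)) : probs hR i = 0 :=
  dif_neg h

theorem probs_nonneg {n : ℕ} {R : Matrix (Fin n) (Fin n) ℝ} (hR : IsDensity R) (i : ℕ) :
    0 ≤ probs hR i := by
  unfold probs
  split_ifs with h
  · have := hR.posSemidef.eigenvalues_nonneg
      ((Fintype.equivOfCardEq (Fintype.card_fin (Fintype.card (Fin n)))) ⟨i, h⟩)
    simpa [Matrix.IsHermitian.eigenvalues] using this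
  · exact le_refl _

theorem probs_antitone {n : ℕ} {R : Matrix (Fin n) (Fin n) ℝ} (hR : IsDensity R) :
    Antitone (probs hR) := by
  intro i j hij
  by_cases h : j < Fintype.card (Fin n)
  · have h' : i < Fintype.card (Fin n) := by omega
    simp only [probs, h, h', dif_pos]
    exact hR.isHermitian.eigenvalues₀_antitone hij
  · simp only [probs, h, dif_neg, not_false_eq_true]
    exact probs_nonneg hR i

theorem sum_eigenvalues_eq {n : ℕ} {R : Matrix (Fin n) (Fin n) ℝ} (hR : IsDensity R)
    (f : ℝ → ℝ) :
    ∑ i, f (hR.isHermitian.eigenvalues i) = ∑ i ∈ Finset.range n, f (probs hR i) := by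
  have h1 : ∀ i, hR.isHermitian.eigenvalues i = probs hR
      ((Fintype.equivOfCardEq (Fintype.card_fin (Fintype.card (Fin n)))).symm i : Fin _) := by
    intro i
    rw [probs_of_lt hR (Fin.is_lt _)]; rfl
  simp_rw [h1]
  rw [Equiv.sum_comp (Fintype.equivOfCardEq (Fintype.card_fin (Fintype.card (Fin n)))).symm
    (fun j : Fin (Fintype.card (Fin n)) => f (probs hR j)), Fin.sum_univ_eq_sum_range
    (fun j => f (probs hR j)), Fintype.card_fin]

/-- A nonzero value at a position `i ≥ k` would, by monotonicity, make the `i + 1 > k` largest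
eigenvalues nonzero. -/
theorem probs_eq_zero {n k : ℕ} {R : Matrix (Fin n) (Fin n) ℝ} {hR : IsDensity R}
    (hk : AtMostNonzero hR k) {i : ℕ} (hi : k ≤ i) : probs hR i = 0 := by
  by_contra hne
  have hin : i < n := by
    by_contra hin
    exact hne (by simp [probs, hin])
  have hpos : ∀ j ≤ i, probs hR j ≠ 0 := fun j hj =>
    (lt_of_lt_of_le (lt_of_le_of_ne (probs_nonneg hR i) (Ne.symm hne)) (probs_antitone hR hj)).ne'
  let f : Fin (i + 1) → Fin n := fun j =>
    Fintype.equivOfCardEq (Fintype.card_fin (Fintype.card (Fin n))) ⟨j, by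
      have := j.2; rw [Fintype.card_fin]; omega⟩
  have hf : Function.Injective f := by
    intro a b hab
    have := (Fintype.equivOfCardEq (Fintype.card_fin (Fintype.card (Fin n)))).injective hab
    exact Fin.ext (by simpa using congrArg Fin.val this)
  have hmem : Set.range f ⊆ {i : Fin n | hR.isHermitian.eigenvalues i ≠ 0} := by
    rintro _ ⟨j, rfl⟩
    have := hpos j (by have := j.2; omega)
    have hj : (j : ℕ) < n := by have := j.2; omega
    simpa [probs, hj, f, Matrix.IsHermitian.eigenvalues] using this
  have h1 : (Set.range f).ncard = i + 1 := by
    rw [← Set.image_univ, Set.ncard_image_of_injective _ hf, Set.ncard_univ]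
    simp
  have h2 := Set.ncard_le_ncard hmem (Set.toFinite _)
  unfold AtMostNonzero at hk
  omega

theorem sum_eigenvalues_eq' {n k : ℕ} {R : Matrix (Fin n) (Fin n) ℝ} {hR : IsDensity R}
    (hk : AtMostNonzero hR k) (f : ℝ → ℝ) (hf : f 0 = 0) :
    ∑ i, f (hR.isHermitian.eigenvalues i) = ∑ i ∈ Finset.range k, f (probs hR i) := by
  rw [sum_eigenvalues_eq hR]
  -- Neither of `n` and `k` need bound the other, so both sums are extended by vanishing terms to
  -- `max n k`.
  have h1 : ∑ i ∈ Finset.range n, f (probs hR i) = ∑ i ∈ Finset.range (max n k), f (probs hR i) := by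
    refine Finset.sum_subset (Finset.range_mono (le_max_left _ _)) fun i _ hi => ?_
    rw [Finset.mem_range, not_lt] at hi
    have : ¬ i < Fintype.card (Fin n) := by simpa using hi
    rw [probs_of_not_lt hR this, hf]
  have h2 : ∑ i ∈ Finset.range k, f (probs hR i) = ∑ i ∈ Finset.range (max n k), f (probs hR i) := by
    refine Finset.sum_subset (Finset.range_mono (le_max_right _ _)) fun i _ hi => ?_
    rw [Finset.mem_range, not_lt] at hi
    rw [probs_eq_zero hk hi, hf]
  rw [h1, h2]

/-- A density matrix factors through the span of the eigenvectors with nonzero eigenvalue. -/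
theorem exists_factorization {n : ℕ} {R : Matrix (Fin n) (Fin n) ℝ} (hR : IsDensity R) :
    ∃ (U : Matrix (Fin n) {i : Fin n // hR.isHermitian.eigenvalues i ≠ 0} ℝ)
      (V : Matrix {i : Fin n // hR.isHermitian.eigenvalues i ≠ 0} (Fin n) ℝ),
      Uᵀ * U = 1 ∧ R = U * V := by
  classical
  set W : Matrix (Fin n) (Fin n) ℝ := ↑hR.isHermitian.eigenvectorUnitary with hW
  have hWW : Wᵀ * W = 1 := by
    have := Unitary.coe_star_mul_self hR.isHermitian.eigenvectorUnitary
    simpa [Matrix.star_eq_conjTranspose] using this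
  refine ⟨W.submatrix id Subtype.val,
    Matrix.of fun i t => hR.isHermitian.eigenvalues i * W t i, ?_, ?_⟩
  · ext i j
    have := congrFun (congrFun hWW i) j
    simp only [Matrix.mul_apply, Matrix.transpose_apply, Matrix.submatrix_apply, id,
      Matrix.one_apply] at this ⊢
    rw [this]
    simp [Subtype.ext_iff]
  · have hs : R = W * Matrix.diagonal hR.isHermitian.eigenvalues * Wᵀ := by
      have := hR.isHermitian.spectral_theorem
      rw [Unitary.conjStarAlgAut_apply] at this
      exact this
    ext t t'
    conv_lhs => rw [hs]
    rw [Matrix.mul_apply, Matrix.mul_apply]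
    simp only [Matrix.mul_diagonal, Matrix.submatrix_apply, id, Matrix.of_apply,
      Matrix.transpose_apply]
    rw [← Finset.sum_subtype (p := fun i => hR.isHermitian.eigenvalues i ≠ 0)
      (Finset.univ.filter fun i => hR.isHermitian.eigenvalues i ≠ 0) (by simp)
      (fun i => W t i * (hR.isHermitian.eigenvalues i * W t' i)), Finset.sum_filter]
    refine Finset.sum_congr rfl fun i _ => ?_
    split_ifs with h
    · ring
    · rw [not_not] at h
      simp [h]

theorem card_nonzero_eigenvalues_le {n k : ℕ} {R : Matrix (Fin n) (Fin n) ℝ} {hR : IsDensity R}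
    (hk : AtMostNonzero hR k) :
    Fintype.card {i : Fin n // hR.isHermitian.eigenvalues i ≠ 0} ≤ k := by
  unfold AtMostNonzero at hk
  rw [← Nat.card_eq_fintype_card]
  exact hk

theorem inner_euclidean {n : ℕ} (x y : EuclideanSpace ℝ (Fin n)) :
    inner ℝ x y = x.ofLp ⬝ᵥ y.ofLp := by
  rw [EuclideanSpace.inner_eq_star_dotProduct, dotProduct_comm]
  simp

/-- At a vector `x`, with `a = V x`, the form of `R²` is `a ⬝ᵥ a` and that of `B Bᵀ` is `a ⬝ᵥ (Uᵀ Π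
Πᵀ U) a`. The near isometry makes them comparable within factors `1 ± ε`, and min-max transfers this
to the sorted eigenvalues. -/
theorem NearIsometry.abs_sq_sub_sq_le {n s : ℕ} {R : Matrix (Fin n) (Fin n) ℝ}
    (hR : IsDensity R) {I : Type*} [Fintype I] [DecidableEq I] {U : Matrix (Fin n) I ℝ}
    {V : Matrix I (Fin n) ℝ} (hU : Uᵀ * U = 1) (hUV : R = U * V) {ε : ℝ} (h0 : 0 < ε)
    (h1 : ε < 1) {Pi : Matrix (Fin n) (Fin s) ℝ} (h : NearIsometry U ε Pi) (i : ℕ) :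
    |probs hR i ^ 2 - approxProbs R Pi i ^ 2| ≤ ε * probs hR i ^ 2 := by
  set B := R * Pi with hB
  have hH : (B * Bᵀ).IsHermitian := Matrix.isHermitian_mul_conjTranspose_self B
  have hps : (B * Bᵀ).PosSemidef := Matrix.posSemidef_self_mul_conjTranspose B
  rw [sq_approxProbs', ← hB, sortedAt_charpoly_roots hH]
  by_cases hi : i < Fintype.card (Fin n)
  swap
  · rw [probs_of_not_lt hR hi, dif_neg hi]; simp
  rw [probs_of_lt hR hi, dif_pos hi]
  obtain ⟨b, hb⟩ := exists_eigenbasis hR.isHermitian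
  obtain ⟨b', hb'⟩ := exists_eigenbasis hH
  have hq : ∀ x, ∑ j, hR.isHermitian.eigenvalues₀ j ^ 2 * inner ℝ (b j) x ^ 2 =
      (V *ᵥ x.ofLp) ⬝ᵥ (V *ᵥ x.ofLp) := by
    intro x
    have e1 := b.sum_inner_mul_inner (Matrix.toEuclideanLin R x) (Matrix.toEuclideanLin R x)
    have e2 : inner ℝ (Matrix.toEuclideanLin R x) (Matrix.toEuclideanLin R x) =
        (V *ᵥ x.ofLp) ⬝ᵥ (V *ᵥ x.ofLp) := by
      rw [inner_euclidean]
      simp only [Matrix.toLpLin_apply]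
      rw [hUV, ← Matrix.mulVec_mulVec, Matrix.dotProduct_mulVec, Matrix.vecMul_mulVec, hU,
        Matrix.vecMul_one]
    rw [← e2, ← e1]
    refine Finset.sum_congr rfl fun j _ => ?_
    rw [real_inner_comm (b j), hb]
    ring
  have hq' : ∀ x, ∑ j, hH.eigenvalues₀ j * inner ℝ (b' j) x ^ 2 =
      (V *ᵥ x.ofLp) ⬝ᵥ ((Uᵀ * (Pi * Piᵀ) * U) *ᵥ (V *ᵥ x.ofLp)) := by
    intro x
    have e1 := b'.sum_inner_mul_inner x (Matrix.toEuclideanLin (B * Bᵀ) x)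
    have hRt : Rᵀ = R := by
      have := hR.isHermitian; simpa [Matrix.IsHermitian] using this
    have e2 : inner ℝ x (Matrix.toEuclideanLin (B * Bᵀ) x) =
        (V *ᵥ x.ofLp) ⬝ᵥ ((Uᵀ * (Pi * Piᵀ) * U) *ᵥ (V *ᵥ x.ofLp)) := by
      rw [inner_euclidean]
      simp only [Matrix.toLpLin_apply]
      have : B * Bᵀ = Vᵀ * ((Uᵀ * (Pi * Piᵀ) * U) * V) := by
        calc B * Bᵀ = Rᵀ * (Pi * Piᵀ) * R := by
              rw [hB, Matrix.transpose_mul, hRt]; simp only [Matrix.mul_assoc]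
          _ = _ := by rw [hUV, Matrix.transpose_mul]; simp only [Matrix.mul_assoc]
      rw [this, ← Matrix.mulVec_mulVec, ← Matrix.mulVec_mulVec, Matrix.dotProduct_mulVec,
        Matrix.vecMul_transpose]
    rw [← e2, ← e1]
    refine Finset.sum_congr rfl fun j _ => ?_
    rw [hb', real_inner_comm (b' j)]
    ring
  -- Squaring preserves the order because the eigenvalues are nonnegative.
  have hanti : Antitone fun j => hR.isHermitian.eigenvalues₀ j ^ 2 := by
    intro a c hac
    have hc : 0 ≤ hR.isHermitian.eigenvalues₀ c := by
      have := probs_nonneg hR c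
      simpa [probs, show (c : ℕ) < n by simpa using c.2] using this
    exact pow_le_pow_left₀ hc (hR.isHermitian.eigenvalues₀_antitone hac) 2
  have up := le_mul_of_forall_sum_le b' b (c := 1 + ε) hH.eigenvalues₀_antitone hanti
    (by linarith) (fun x => by
      rw [hq, hq']
      have := (abs_le.1 (h (V *ᵥ x.ofLp))).2
      linarith) ⟨i, hi⟩
  -- The lower bound is the same comparison with the roles exchanged, hence the factor `1 / (1 -
  -- ε)`.
  have lo := le_mul_of_forall_sum_le b b' (c := 1 / (1 - ε)) hanti hH.eigenvalues₀_antitone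
    (by have : 0 < 1 - ε := by linarith
        positivity) (fun x => by
      rw [hq, hq', div_mul_eq_mul_div, one_mul, le_div_iff₀ (by linarith)]
      have := (abs_le.1 (h (V *ᵥ x.ofLp))).1
      linarith) ⟨i, hi⟩
  rw [div_mul_eq_mul_div, one_mul, le_div_iff₀ (by linarith)] at lo
  rw [abs_le]
  constructor <;> nlinarith

/-! ### The entropy bound -/

/-- Put `q = p x`, so that `x ^ 2` lies within `ε` of `1`. Then `q log (1 / q) = x (-p log p) - p (x
log x)`, and the error splits into `|1 - x|` times the entropy term and `p |x log x|`. -/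
theorem abs_negMulLog_sub_le {p q ε : ℝ} (hp : 0 ≤ p) (hp1 : p ≤ 1) (hq : 0 ≤ q) (h0 : 0 < ε)
    (h1 : ε < 1 / 2) (h : |p ^ 2 - q ^ 2| ≤ ε * p ^ 2) :
    |Real.negMulLog p - q * Real.log (1 / q)| ≤ √ε * Real.negMulLog p + √(3 / 2) * ε * p := by
  -- If `p = 0`, the relative bound forces `q = 0`, and both sides vanish.
  rcases hp.eq_or_lt with rfl | hp
  · have : q = 0 := by
      have : |0 ^ 2 - q ^ 2| = q ^ 2 := by simp
      have h2 : q ^ 2 ≤ 0 := by rw [this] at h; simpa using h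
      nlinarith
    simp [this]
  obtain ⟨h2, h3⟩ := abs_le.1 h
  have hqpos : 0 < q := by
    rcases hq.eq_or_lt with rfl | hq
    · nlinarith [pow_pos hp 2]
    · exact hq
  obtain ⟨x, hx⟩ : ∃ x, q = p * x := ⟨q / p, by field_simp⟩
  have hx0 : 0 < x := by
    rw [hx] at hqpos; exact (pos_iff_pos_of_mul_pos hqpos).1 hp
  have hp2 := pow_pos hp 2
  have hxl : 1 - ε ≤ x ^ 2 := by
    refine le_of_mul_le_mul_left ?_ hp2
    rw [hx] at h3; nlinarith
  have hxu : x ^ 2 ≤ 1 + ε := by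
    refine le_of_mul_le_mul_left ?_ hp2
    rw [hx] at h2; nlinarith
  have hlog : q * Real.log (1 / q) = x * Real.negMulLog p - p * (x * Real.log x) := by
    rw [hx, one_div, Real.log_inv, Real.log_mul hp.ne' hx0.ne', Real.negMulLog]
    ring
  have hH : 0 ≤ Real.negMulLog p := Real.negMulLog_nonneg hp.le hp1
  have hsε : ε ≤ √ε := by
    rw [Real.le_sqrt h0.le h0.le]; nlinarith
  -- In fact `|1 - x| ≤ ε`, because `|x ^ 2 - 1| = |x - 1| (x + 1)` and `x + 1 ≥ 1`.
  have hx1 : |1 - x| ≤ √ε := by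
    refine le_trans ?_ hsε
    rw [abs_le]; constructor <;> nlinarith
  have hs32 : 1 ≤ √(3 / 2 : ℝ) := by
    rw [Real.le_sqrt] <;> norm_num
  -- From above, `2 log x ≤ x ^ 2 - 1 ≤ ε`, and `x ≤ √(3 / 2)` because `ε < 1 / 2`. From below, `x
  -- log x ≥ x - 1 ≥ -ε`.
  have hxlog : |x * Real.log x| ≤ √(3 / 2) * ε := by
    have hl : Real.log (x ^ 2) = 2 * Real.log x := by
      rw [Real.log_pow]; norm_num
    have hu : Real.log x ≤ ε / 2 := by
      have := Real.log_le_sub_one_of_pos (pow_pos hx0 2)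
      linarith
    have hxs : x ≤ √(3 / 2) := by
      apply Real.le_sqrt_of_sq_le; linarith
    have hlow : x - 1 ≤ x * Real.log x := by
      have := Real.one_sub_inv_le_log_of_pos hx0
      have h4 := mul_le_mul_of_nonneg_left this hx0.le
      rwa [mul_sub, mul_one, mul_inv_cancel₀ hx0.ne'] at h4
    rw [abs_le]
    constructor
    · have : 1 - ε ≤ x := by nlinarith
      have : ε ≤ √(3 / 2) * ε := le_mul_of_one_le_left h0.le hs32
      linarith
    · have : x * Real.log x ≤ x * (ε / 2) := mul_le_mul_of_nonneg_left hu hx0.le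
      nlinarith
  rw [hlog]
  calc |Real.negMulLog p - (x * Real.negMulLog p - p * (x * Real.log x))|
      = |(1 - x) * Real.negMulLog p + p * (x * Real.log x)| := by ring_nf
    _ ≤ |(1 - x) * Real.negMulLog p| + |p * (x * Real.log x)| := abs_add_le _ _
    _ = |1 - x| * Real.negMulLog p + p * |x * Real.log x| := by
        rw [abs_mul, abs_mul, abs_of_nonneg hH, abs_of_pos hp]
    _ ≤ √ε * Real.negMulLog p + p * (√(3 / 2) * ε) := by gcongr
    _ = _ := by ring

theorem sum_probs_eq_one {n k : ℕ} {R : Matrix (Fin n) (Fin n) ℝ} {hR : IsDensity R}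
    (hk : AtMostNonzero hR k) : ∑ i ∈ Finset.range k, probs hR i = 1 := by
  rw [← sum_eigenvalues_eq' hk (fun x => x) rfl, ← hR.trace_eq_one,
    hR.isHermitian.trace_eq_sum_eigenvalues]
  rfl

theorem NearIsometry.accurate {n s k : ℕ} {R : Matrix (Fin n) (Fin n) ℝ}
    {hR : IsDensity R} (hk : AtMostNonzero hR k) {I : Type*} [Fintype I] [DecidableEq I]
    {U : Matrix (Fin n) I ℝ}
    {V : Matrix I (Fin n) ℝ} (hU : Uᵀ * U = 1) (hUV : R = U * V) {ε : ℝ} (h0 : 0 < ε)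
    (h1 : ε < 1 / 2) {Pi : Matrix (Fin n) (Fin s) ℝ} (h : NearIsometry U ε Pi) :
    Accurate hR k ε Pi := by
  have hp := h.abs_sq_sub_sq_le hR hU hUV h0 (by linarith)
  refine ⟨hp, ?_⟩
  unfold entropy approxEntropy
  rw [sum_eigenvalues_eq' hk _ Real.negMulLog_zero, ← Finset.sum_sub_distrib]
  have hsum := sum_probs_eq_one hk
  calc |∑ i ∈ Finset.range k, (Real.negMulLog (probs hR i) -
        approxProbs R Pi i * Real.log (1 / approxProbs R Pi i))|
      ≤ ∑ i ∈ Finset.range k, |Real.negMulLog (probs hR i) -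
        approxProbs R Pi i * Real.log (1 / approxProbs R Pi i)| := Finset.abs_sum_le_sum_abs _ _
    _ ≤ ∑ i ∈ Finset.range k,
        (√ε * Real.negMulLog (probs hR i) + √(3 / 2) * ε * probs hR i) := by
        refine Finset.sum_le_sum fun i hi => ?_
        refine abs_negMulLog_sub_le (probs_nonneg hR i) ?_ (approxProbs_nonneg _ _ _) h0 h1 (hp i)
        rw [← hsum]
        exact Finset.single_le_sum (fun j _ => probs_nonneg hR j) hi
    _ = _ := by
        rw [Finset.sum_add_distrib, ← Finset.mul_sum, ← Finset.mul_sum, hsum, mul_one]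

/-! ### Counting and the uniform distribution -/

-- Probabilities are estimated by counting bad outcomes; this is the passage back to the uniform
-- measure.
open Classical in
theorem one_sub_le_uniformOn_real {Ω : Type*} [Fintype Ω] [Nonempty Ω] [MeasurableSpace Ω]
    [MeasurableSingletonClass Ω] (S : Set Ω) {δ : ℝ}
    (h : ((Finset.univ.filter fun ω => ω ∉ S).card : ℝ) ≤ δ * Fintype.card Ω) :
    1 - δ ≤ (ProbabilityTheory.uniformOn (Set.univ : Set Ω)).real S := by
  have hc : (0 : ℝ) < Fintype.card Ω := by exact_mod_cast Fintype.card_pos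
  have h1 : (ProbabilityTheory.uniformOn (Set.univ : Set Ω)).real S =
      ((Finset.univ.filter fun ω => ω ∈ S).card : ℝ) / Fintype.card Ω := by
    rw [MeasureTheory.measureReal_def, ProbabilityTheory.uniformOn_univ,
      MeasureTheory.Measure.count_apply_finite S (Set.toFinite S), ENNReal.toReal_div]
    congr 1
    simp only [ENNReal.toReal_natCast]
    congr 2
    ext; simp
  have h2 : ((Finset.univ.filter fun ω => ω ∈ S).card : ℝ) +
      ((Finset.univ.filter fun ω => ω ∉ S).card : ℝ) = Fintype.card Ω := by
    exact_mod_cast Finset.card_filter_add_card_filter_not (s := (Finset.univ : Finset Ω))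
      (fun ω => ω ∈ S)
  rw [h1, le_div_iff₀ hc]
  linarith

-- Markov's inequality in counting form.
open Classical in
theorem card_filter_not_le_of_sum_le {Ω : Type*} [Fintype Ω] {f : Ω → ℝ} (hf : ∀ ω, 0 ≤ f ω)
    {S : Set Ω} {θ c : ℝ} (hθ : 0 < θ) (hS : ∀ ω, ω ∉ S → θ ≤ f ω) (h : ∑ ω, f ω ≤ c * θ) :
    ((Finset.univ.filter fun ω => ω ∉ S).card : ℝ) ≤ c := by
  have : ((Finset.univ.filter fun ω => ω ∉ S).card : ℝ) * θ ≤ ∑ ω, f ω := by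
    rw [← nsmul_eq_mul]
    refine le_trans (Finset.card_nsmul_le_sum _ f θ fun ω hω => hS ω (Finset.mem_filter.1 hω).2) ?_
    exact Finset.sum_le_sum_of_subset_of_nonneg (Finset.filter_subset _ _) fun ω _ _ => hf ω
  exact le_of_mul_le_mul_right (this.trans h) hθ

/-- Overwriting the value at `t` of a colliding assignment by an arbitrary bucket loses nothing,
since the old value is still present at `t'`. Hence two given rows collide with probability at most
`1 / s`. -/
theorem card_filter_apply_eq_mul_le {n s : ℕ} {t t' : Fin n} (h : t ≠ t') :
    (Finset.univ.filter fun b : Fin n → Fin s => b t = b t').card * s ≤ s ^ n := by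
  have h1 : (Finset.univ.filter fun b : Fin n → Fin s => b t = b t').card * s =
      ((Finset.univ.filter fun b : Fin n → Fin s => b t = b t') ×ˢ
        (Finset.univ : Finset (Fin s))).card := by
    rw [Finset.card_product, Finset.card_univ, Fintype.card_fin]
  have h2 : s ^ n = (Finset.univ : Finset (Fin n → Fin s)).card := by simp
  rw [h1, h2]
  refine Finset.card_le_card_of_injOn (fun x => Function.update x.1 t x.2) (by simp) ?_
  rintro ⟨b, c⟩ hb ⟨b', c'⟩ hb' heq
  simp only [Finset.coe_product, Set.mem_prod, Finset.mem_coe, Finset.mem_filter,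
    Finset.mem_univ, true_and, and_true] at hb hb'
  have e : ∀ u, Function.update b t c u = Function.update b' t c' u := fun u => congrFun heq u
  have hoff : ∀ u, u ≠ t → b u = b' u := by
    intro u hu
    simpa [hu] using e u
  have hc : c = c' := by simpa using e t
  have hb2 : b = b' := by
    funext u
    by_cases hu : u = t
    · subst hu
      rw [hb, hb', hoff _ h.symm]
    · exact hoff u hu
  rw [hc, hb2]

/-! ### Random signs -/

theorem sgn_mul_self (b : Bool) : sgn b * sgn b = 1 := by cases b <;> simp [sgn]

theorem sgn_not (b : Bool) : sgn (!b) = - sgn b := by cases b <;> simp [sgn]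

/-- A function of random signs that changes sign with one of the signs has mean zero. -/
theorem sum_sign_eq_zero {ι : Type*} [Fintype ι] [DecidableEq ι] (f : (ι → Bool) → ℝ) (x : ι)
    (h : ∀ σ, f (Function.update σ x (!σ x)) = - f σ) : ∑ σ, f σ = 0 := by
  have hinv : Function.Involutive fun σ : ι → Bool => Function.update σ x (!σ x) := by
    intro σ; simp
  have h1 : ∑ σ, f σ = ∑ σ, f (Function.update σ x (!σ x)) :=
    (Equiv.sum_comp hinv.toPerm f).symm
  simp_rw [h, Finset.sum_neg_distrib] at h1
  linarith

/-- If the unordered pairs differ, some index of `q` is not in `p`. Its sign occurs exactly once in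
the product, and flipping it negates the product. -/
theorem sum_sign_pairs_eq_zero {ι : Type*} [Fintype ι] [DecidableEq ι] {p q : ι × ι}
    (hp : p.1 ≠ p.2) (hq : q.1 ≠ q.2) (h1 : q ≠ p) (h2 : q ≠ p.swap) :
    ∑ σ : ι → Bool, sgn (σ p.1) * sgn (σ p.2) * (sgn (σ q.1) * sgn (σ q.2)) = 0 := by
  obtain ⟨p1, p2⟩ := p
  obtain ⟨q1, q2⟩ := q
  simp only [ne_eq, Prod.mk.injEq, Prod.swap_prod_mk, not_and] at *
  have : (q1 ≠ p1 ∧ q1 ≠ p2) ∨ (q2 ≠ p1 ∧ q2 ≠ p2) := by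
    by_contra hc
    rw [not_or] at hc
    obtain ⟨ha, hb⟩ := hc
    by_cases e1 : q1 = p1
    · have := h1 e1
      by_cases e2 : q2 = p1
      · exact hq (e1.trans e2.symm)
      · exact hb ⟨e2, this⟩
    · have e2 : q1 = p2 := by
        by_contra e2; exact ha ⟨e1, e2⟩
      have e3 := h2 e2
      exact hb ⟨e3, fun e4 => hq (e2.trans e4.symm)⟩
  rcases this with ⟨ha, hb⟩ | ⟨ha, hb⟩
  · refine sum_sign_eq_zero _ q1 fun σ => ?_
    simp [Function.update_of_ne (Ne.symm ha), Function.update_of_ne (Ne.symm hb),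
      Function.update_of_ne (Ne.symm hq), sgn_not]
  · refine sum_sign_eq_zero _ q2 fun σ => ?_
    simp [Function.update_of_ne (Ne.symm ha), Function.update_of_ne (Ne.symm hb),
      Function.update_of_ne hq, sgn_not]

/-- Second moment of an off-diagonal chaos of order two in random signs. -/
theorem sum_sq_chaos_le {ι : Type*} [Fintype ι] [DecidableEq ι] (a : ι × ι → ℝ)
    (ha : ∀ t, a (t, t) = 0) :
    ∑ σ : ι → Bool, (∑ p : ι × ι, a p * (sgn (σ p.1) * sgn (σ p.2))) ^ 2 ≤
      2 * Fintype.card (ι → Bool) * ∑ p, a p ^ 2 := by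
  set N : ℝ := (Fintype.card (ι → Bool) : ℝ) with hN
  have hdiag : ∀ p : ι × ι, p.1 = p.2 → a p = 0 := by
    rintro ⟨t, t'⟩ h; obtain rfl : t = t' := h; exact ha t
  -- After expanding the square, only `q = p` and `q = p.swap` have nonzero mean, and there the
  -- signs multiply to `1`.
  have key : ∑ σ : ι → Bool, (∑ p : ι × ι, a p * (sgn (σ p.1) * sgn (σ p.2))) ^ 2 =
      ∑ p, N * (a p * (a p + a p.swap)) := by
    calc _ = ∑ σ : ι → Bool, ∑ p, ∑ q, a p * a q *
          (sgn (σ p.1) * sgn (σ p.2) * (sgn (σ q.1) * sgn (σ q.2))) := by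
          refine Finset.sum_congr rfl fun σ _ => ?_
          rw [sq, Finset.sum_mul_sum]
          refine Finset.sum_congr rfl fun p _ => Finset.sum_congr rfl fun q _ => ?_
          ring
      _ = ∑ p, ∑ q, a p * a q * ∑ σ : ι → Bool,
          (sgn (σ p.1) * sgn (σ p.2) * (sgn (σ q.1) * sgn (σ q.2))) := by
          rw [Finset.sum_comm]
          refine Finset.sum_congr rfl fun p _ => ?_
          rw [Finset.sum_comm]
          simp_rw [Finset.mul_sum]
      _ = _ := by
          refine Finset.sum_congr rfl fun p _ => ?_
          by_cases hp : p.1 = p.2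
          · simp [hdiag p hp]
          have hne : p ≠ p.swap := fun h => hp (congrArg Prod.fst h)
          rw [Finset.sum_eq_add p p.swap hne]
          · have e1 : ∀ σ : ι → Bool,
                sgn (σ p.1) * sgn (σ p.2) * (sgn (σ p.1) * sgn (σ p.2)) = 1 := by
              intro σ
              rw [mul_mul_mul_comm, sgn_mul_self, sgn_mul_self, one_mul]
            have e2 : ∀ σ : ι → Bool,
                sgn (σ p.1) * sgn (σ p.2) * (sgn (σ p.swap.1) * sgn (σ p.swap.2)) = 1 := by
              intro σ
              rw [← e1 σ, Prod.fst_swap, Prod.snd_swap]; ring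
            simp_rw [e1, e2, Finset.sum_const, Finset.card_univ, nsmul_eq_mul, mul_one, ← hN]
            ring
          · intro q _ hq
            by_cases hq' : q.1 = q.2
            · simp [hdiag q hq']
            · rw [sum_sign_pairs_eq_zero hp hq' hq.1 hq.2, mul_zero]
          · simp
          · simp
  have hswap : ∑ p : ι × ι, a p.swap ^ 2 = ∑ p, a p ^ 2 :=
    Equiv.sum_comp (Equiv.prodComm ι ι) fun p => a p ^ 2
  have hN0 : 0 ≤ N := Nat.cast_nonneg _
  calc _ = _ := key
    -- The mixed term is split by `2 a b ≤ a ^ 2 + b ^ 2`; the invariance of the sum under swapping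
    -- then gives the factor `3 / 2 + 1 / 2 = 2`.
    _ ≤ ∑ p, N * (3 / 2 * a p ^ 2 + 1 / 2 * a p.swap ^ 2) := by
        refine Finset.sum_le_sum fun p _ => mul_le_mul_of_nonneg_left ?_ hN0
        nlinarith [sq_nonneg (a p - a p.swap)]
    _ = _ := by
        rw [← Finset.mul_sum, Finset.sum_add_distrib, ← Finset.mul_sum, ← Finset.mul_sum, hswap]
        ring

/-! ### The input-sparsity transform -/

/-- The deviation of the Gram matrix of the sketched columns of `U` from the identity. -/
def gramError {n s : ℕ} {I : Type*} [DecidableEq I] (U : Matrix (Fin n) I ℝ)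
    (Pi : Matrix (Fin n) (Fin s) ℝ) : Matrix I I ℝ :=
  Uᵀ * (Pi * Piᵀ) * U - 1

/-- By Cauchy-Schwarz the Frobenius norm dominates the quadratic form. -/
theorem nearIsometry_of_sum_sq_le {n s : ℕ} {I : Type*} [Fintype I] [DecidableEq I]
    {U : Matrix (Fin n) I ℝ} {ε : ℝ} (hε : 0 ≤ ε) {Pi : Matrix (Fin n) (Fin s) ℝ}
    (h : ∑ e : I × I, gramError U Pi e.1 e.2 ^ 2 ≤ ε ^ 2) : NearIsometry U ε Pi := by
  intro a
  set E := gramError U Pi with hE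
  have h1 : a ⬝ᵥ ((Uᵀ * (Pi * Piᵀ) * U) *ᵥ a) - a ⬝ᵥ a =
      ∑ e : I × I, (a e.1 * a e.2) * E e.1 e.2 := by
    have : a ⬝ᵥ ((Uᵀ * (Pi * Piᵀ) * U) *ᵥ a) - a ⬝ᵥ a = a ⬝ᵥ (E *ᵥ a) := by
      rw [hE, gramError, Matrix.sub_mulVec, Matrix.one_mulVec, dotProduct_sub]
    rw [this, Fintype.sum_prod_type]
    simp only [dotProduct, Matrix.mulVec, Finset.mul_sum]
    refine Finset.sum_congr rfl fun i _ => Finset.sum_congr rfl fun j _ => ?_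
    ring
  have h2 : ∑ e : I × I, (a e.1 * a e.2) ^ 2 = (a ⬝ᵥ a) ^ 2 := by
    rw [Fintype.sum_prod_type, sq (a ⬝ᵥ a)]
    simp only [dotProduct, Finset.sum_mul_sum]
    refine Finset.sum_congr rfl fun i _ => Finset.sum_congr rfl fun j _ => ?_
    ring
  have h3 : 0 ≤ a ⬝ᵥ a := Finset.sum_nonneg fun i _ => mul_self_nonneg _
  rw [h1]
  refine abs_le_of_sq_le_sq ?_ (by positivity)
  calc _ ≤ (∑ e : I × I, (a e.1 * a e.2) ^ 2) * ∑ e : I × I, E e.1 e.2 ^ 2 :=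
        Finset.sum_mul_sq_le_sq_mul_sq _ _ _
    _ ≤ (a ⬝ᵥ a) ^ 2 * ε ^ 2 := by
        rw [h2]; exact mul_le_mul_of_nonneg_left h (sq_nonneg _)
    _ = _ := by ring

theorem sparseSketch_apply {n s : ℕ} (ω : SparseChoice n s) (t : Fin n) (c : Fin s) :
    sparseSketch ω t c = sgn (ω.2 t) * if ω.1 t = c then 1 else 0 := by
  simp [sparseSketch, Matrix.diagonal_mul]

/-- The error of the input-sparsity transform is an off-diagonal chaos. -/
theorem sparse_error_eq {n s : ℕ} {I : Type*} [Fintype I] [DecidableEq I]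
    {U : Matrix (Fin n) I ℝ} (hU : Uᵀ * U = 1) (ω : SparseChoice n s) (i j : I) :
    gramError U (sparseSketch ω) i j =
      ∑ p : Fin n × Fin n, (if p.1 ≠ p.2 ∧ ω.1 p.1 = ω.1 p.2 then U p.1 i * U p.2 j else 0) *
        (sgn (ω.2 p.1) * sgn (ω.2 p.2)) := by
  have hG : ∀ t t', ∑ c, sparseSketch ω t c * sparseSketch ω t' c =
      sgn (ω.2 t) * sgn (ω.2 t') * if ω.1 t = ω.1 t' then 1 else 0 := by
    intro t t'
    simp only [sparseSketch_apply]
    rw [Finset.sum_eq_single (ω.1 t)]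
    · by_cases h : ω.1 t = ω.1 t'
      · simp [h]
      · simp [h, Ne.symm h]
    · intro c _ hc
      simp [Ne.symm hc]
    · simp
  -- The identity is exactly the diagonal part of the double sum, since squared signs are `1`;
  -- subtracting it leaves the colliding pairs `p.1 ≠ p.2`.
  have hI : (1 : Matrix I I ℝ) i j = ∑ p : Fin n × Fin n, if p.1 = p.2 then U p.1 i * U p.2 j
      else 0 := by
    rw [← hU, Fintype.sum_prod_type]
    simp [Matrix.mul_apply]
  rw [gramError, Matrix.sub_apply, hI, Matrix.mul_apply]
  simp_rw [Matrix.mul_apply, Matrix.transpose_apply, Finset.sum_mul]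
  rw [Finset.sum_comm, Fintype.sum_prod_type, Fintype.sum_prod_type, ← Finset.sum_sub_distrib]
  refine Finset.sum_congr rfl fun t _ => ?_
  rw [← Finset.sum_sub_distrib]
  refine Finset.sum_congr rfl fun t' _ => ?_
  rw [hG]
  by_cases h1 : t = t'
  · subst h1; simp [sgn_mul_self]
  · by_cases h2 : ω.1 t = ω.1 t' <;> simp [h1, h2]
    ring

/-- With the buckets fixed, averaging over the signs costs the chaos factor `2`; averaging over the
buckets then gives the collision probability `1 / s`. The columns of `U` have unit length, so each
entry of the error contributes at most `2 / s` to the mean. -/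
theorem sum_sparse_error_le {n s : ℕ} (hs : 0 < s) {I : Type*} [Fintype I] [DecidableEq I]
    {U : Matrix (Fin n) I ℝ} (hU : Uᵀ * U = 1) :
    ∑ ω : SparseChoice n s, ∑ e : I × I,
      gramError U (sparseSketch ω) e.1 e.2 ^ 2 ≤
      2 * (Fintype.card I : ℝ) ^ 2 / s * Fintype.card (SparseChoice n s) := by
  have hs' : (0 : ℝ) < s := by exact_mod_cast hs
  have hcol : ∀ i, ∑ t, U t i ^ 2 = 1 := by
    intro i
    have := congrFun (congrFun hU i) i
    simp only [Matrix.mul_apply, Matrix.transpose_apply, Matrix.one_apply_eq] at this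
    simpa [sq] using this
  set N : ℝ := (Fintype.card (Fin n → Bool) : ℝ) with hN
  have hN0 : 0 ≤ N := Nat.cast_nonneg _
  have hent : ∀ e : I × I, ∑ ω : SparseChoice n s,
      gramError U (sparseSketch ω) e.1 e.2 ^ 2 ≤
      2 * N * ((s : ℝ) ^ n / s) := by
    intro e
    rw [Fintype.sum_prod_type]
    calc _ ≤ ∑ b : Fin n → Fin s, 2 * N * ∑ p : Fin n × Fin n,
          (if p.1 ≠ p.2 ∧ b p.1 = b p.2 then U p.1 e.1 * U p.2 e.2 else 0) ^ 2 := by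
          refine Finset.sum_le_sum fun b _ => ?_
          simp_rw [sparse_error_eq hU]
          exact sum_sq_chaos_le (fun p : Fin n × Fin n =>
            if p.1 ≠ p.2 ∧ b p.1 = b p.2 then U p.1 e.1 * U p.2 e.2 else 0) (by simp)
      _ = 2 * N * ∑ p : Fin n × Fin n, ∑ b : Fin n → Fin s,
          (if p.1 ≠ p.2 ∧ b p.1 = b p.2 then U p.1 e.1 * U p.2 e.2 else 0) ^ 2 := by
          rw [← Finset.mul_sum, Finset.sum_comm]
      _ ≤ 2 * N * ∑ p : Fin n × Fin n, (s : ℝ) ^ n / s * (U p.1 e.1 ^ 2 * U p.2 e.2 ^ 2) := by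
          refine mul_le_mul_of_nonneg_left (Finset.sum_le_sum fun p _ => ?_) (by positivity)
          by_cases hp : p.1 = p.2
          · simp only [hp, ne_eq, not_true, false_and, if_false]
            rw [Finset.sum_eq_zero (by simp)]
            positivity
          · simp only [ne_eq, hp, not_false_eq_true, true_and, ite_pow, mul_pow,
              OfNat.ofNat_ne_zero, zero_pow]
            rw [← Finset.sum_filter, Finset.sum_const, nsmul_eq_mul]
            refine mul_le_mul_of_nonneg_right ?_ (by positivity)
            rw [le_div_iff₀ hs']
            exact_mod_cast card_filter_apply_eq_mul_le hp
      _ = 2 * N * ((s : ℝ) ^ n / s) := by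
          rw [← Finset.mul_sum, Fintype.sum_prod_type]
          simp_rw [← Finset.mul_sum, hcol, mul_one, hcol]
          ring
  rw [Finset.sum_comm]
  calc _ ≤ ∑ e : I × I, 2 * N * ((s : ℝ) ^ n / s) := Finset.sum_le_sum fun e _ => hent e
    _ = _ := by
        rw [Finset.sum_const, Finset.card_univ, nsmul_eq_mul, Fintype.card_prod,
          Fintype.card_prod, hN]
        push_cast
        simp only [Fintype.card_pi, Fintype.card_fin, Finset.prod_const, Finset.card_univ]
        push_cast
        ring

/-! ### Failure probability of the input-sparsity transform -/

theorem pos_of_atMostNonzero {n k : ℕ} {R : Matrix (Fin n) (Fin n) ℝ} {hR : IsDensity R}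
    (hk : AtMostNonzero hR k) : 0 < k := by
  rcases Nat.eq_zero_or_pos k with rfl | h
  · have := sum_probs_eq_one hk
    simp at this
  · exact h

theorem IsDensity.pos_dim {n : ℕ} {R : Matrix (Fin n) (Fin n) ℝ} (hR : IsDensity R) : 0 < n := by
  rcases Nat.eq_zero_or_pos n with rfl | h
  · have := hR.trace_eq_one
    simp [Matrix.trace] at this
  · exact h

/-- Markov's inequality at the threshold `ε ^ 2` bounds the failure probability by `2 k² / (s ε²)`,
which is at most `1 / 10` once `s ≥ 20 k² / ε²`. -/
theorem sparse_accurate {n k : ℕ} {ε : ℝ} {R : Matrix (Fin n) (Fin n) ℝ} (hR : IsDensity R)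
    (hk : AtMostNonzero hR k) (h0 : 0 < ε) (h1 : ε < 1 / 2) {s : ℕ}
    (hs : 20 * (k : ℝ) ^ 2 / ε ^ 2 ≤ s) :
    9 / 10 ≤ (ProbabilityTheory.uniformOn (Set.univ : Set (SparseChoice n s))).real
      {ω | Accurate hR k ε (sparseSketch ω)} := by
  classical
  have hk0 : (0 : ℝ) < k := by exact_mod_cast pos_of_atMostNonzero hk
  have hsr : (0 : ℝ) < s := lt_of_lt_of_le (by positivity) hs
  have hs0 : 0 < s := by exact_mod_cast hsr
  have : Nonempty (Fin s) := ⟨⟨0, hs0⟩⟩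
  obtain ⟨U, V, hU, hUV⟩ := exists_factorization hR
  have hcard : (Fintype.card {i : Fin n // hR.isHermitian.eigenvalues i ≠ 0} : ℝ) ≤ k := by
    exact_mod_cast card_nonzero_eigenvalues_le hk
  have := one_sub_le_uniformOn_real {ω | Accurate hR k ε (sparseSketch ω)} (δ := 1 / 10)
    (card_filter_not_le_of_sum_le (fun ω => Finset.sum_nonneg fun e _ => sq_nonneg _)
      (pow_pos h0 2) (fun ω hω => ?_) (le_trans (sum_sparse_error_le hs0 hU) ?_))
  · linarith
  · by_contra hlt
    exact hω ((nearIsometry_of_sum_sq_le h0.le (not_le.1 hlt).le).accurate hk hU hUV h0 h1)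
  · rw [mul_right_comm]
    refine mul_le_mul_of_nonneg_right ?_ (Nat.cast_nonneg _)
    rw [div_le_iff₀ (pow_pos h0 2)] at hs
    rw [div_le_iff₀ hsr]
    have : (Fintype.card {i : Fin n // hR.isHermitian.eigenvalues i ≠ 0} : ℝ) ^ 2 ≤ (k : ℝ) ^ 2 :=
      pow_le_pow_left₀ (Nat.cast_nonneg _) hcard 2
    linarith

/-! ### Trace inequalities -/

section Trace

theorem sq_trace_mul_le {I : Type*} [Fintype I] (A B : Matrix I I ℝ) :
    (A * B).trace ^ 2 ≤ (A * Aᵀ).trace * (B * Bᵀ).trace := by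
  have h1 : (A * B).trace = ∑ e : I × I, A e.1 e.2 * B e.2 e.1 := by
    rw [Fintype.sum_prod_type]; simp [Matrix.trace, Matrix.mul_apply]
  have h2 : (A * Aᵀ).trace = ∑ e : I × I, A e.1 e.2 ^ 2 := by
    rw [Fintype.sum_prod_type]; simp [Matrix.trace, Matrix.mul_apply, sq]
  have h3 : (B * Bᵀ).trace = ∑ e : I × I, B e.2 e.1 ^ 2 := by
    rw [Fintype.sum_prod_type, Finset.sum_comm]; simp [Matrix.trace, Matrix.mul_apply, sq]
  rw [h1, h2, h3]
  exact Finset.sum_mul_sq_le_sq_mul_sq _ _ _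

theorem trace_mul_transpose_nonneg {I : Type*} [Fintype I] (A : Matrix I I ℝ) : 0 ≤ (A * Aᵀ).trace := by
  simp only [Matrix.trace, Matrix.mul_apply, Matrix.diag_apply, Matrix.transpose_apply]
  exact Finset.sum_nonneg fun i _ => Finset.sum_nonneg fun j _ => mul_self_nonneg _

variable {I : Type*} [Fintype I] [DecidableEq I]

theorem trace_mul_pow_comm (X Y : Matrix I I ℝ) {m : ℕ} (hm : m ≠ 0) :
    ((X * Y) ^ m).trace = ((Y * X) ^ m).trace := by
  obtain ⟨l, rfl⟩ := Nat.exists_eq_succ_of_ne_zero hm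
  have h : SemiconjBy X (Y * X) (X * Y) := by
    simp only [SemiconjBy, mul_assoc]
  have h' := (h.pow_right l).eq
  calc ((X * Y) ^ (l + 1)).trace = ((X * Y) ^ l * X * Y).trace := by rw [pow_succ, mul_assoc]
    _ = (Y * ((X * Y) ^ l * X)).trace := Matrix.trace_mul_comm _ _
    _ = (Y * (X * (Y * X) ^ l)).trace := by rw [h']
    _ = ((Y * X) ^ (l + 1)).trace := by rw [pow_succ', mul_assoc]

/-- The two inequalities feed each other. The first for `j + 1` follows from the case `j` applied to
`X ^ 2`, then from the second for `Xᵀ X` and `X Xᵀ`, and finally from Cauchy-Schwarz, as powers of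
these two matrices have equal traces. The second for `j + 1` follows from the first applied to `A
B`, and then from the second for `A ^ 2` and `B ^ 2`. -/
theorem abs_trace_pow_le_and_trace_mul_pow_le (j : ℕ) :
    (∀ X : Matrix I I ℝ, |(X ^ 2 ^ (j + 1)).trace| ≤ ((X * Xᵀ) ^ 2 ^ j).trace) ∧
    (∀ A B : Matrix I I ℝ, Aᵀ = A → Bᵀ = B →
      ((A * B) ^ 2 ^ j).trace ≤ (A ^ 2 ^ j * B ^ 2 ^ j).trace) := by
  induction j with
  | zero =>
    refine ⟨fun X => ?_, fun A B _ _ => by simp⟩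
    have h := sq_trace_mul_le X X
    rw [← sq (X * Xᵀ).trace] at h
    simpa [sq X] using abs_le_of_sq_le_sq h (trace_mul_transpose_nonneg X)
  | succ j ih =>
    obtain ⟨hK, hL⟩ := ih
    have h2 : (2 : ℕ) ^ j ≠ 0 := by positivity
    refine ⟨fun X => ?_, fun A B hA hB => ?_⟩
    · set P := Xᵀ * X with hP
      set Q := X * Xᵀ with hQ
      have hPt : Pᵀ = P := by simp [hP]
      have hQt : Qᵀ = Q := by simp [hQ]
      have hPQ : (P ^ 2 ^ (j + 1)).trace = (Q ^ 2 ^ (j + 1)).trace :=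
        trace_mul_pow_comm _ _ (by positivity)
      have e1 : ((X ^ 2 * (X ^ 2)ᵀ) ^ 2 ^ j).trace = ((P * Q) ^ 2 ^ j).trace := by
        have : X ^ 2 * (X ^ 2)ᵀ = X * (X * Xᵀ * Xᵀ) := by
          rw [sq, Matrix.transpose_mul]; simp only [mul_assoc]
        rw [this, trace_mul_pow_comm _ _ h2]
        have : X * Xᵀ * Xᵀ * X = Q * P := by rw [hP, hQ]; simp only [mul_assoc]
        rw [this, trace_mul_pow_comm _ _ h2]
      have e2 := sq_trace_mul_le (P ^ 2 ^ j) (Q ^ 2 ^ j)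
      have e3 : ∀ Y : Matrix I I ℝ, Yᵀ = Y → Y ^ 2 ^ j * (Y ^ 2 ^ j)ᵀ = Y ^ 2 ^ (j + 1) := by
        intro Y hY
        rw [Matrix.transpose_pow, hY, ← pow_add, ← two_mul, pow_succ']
      rw [e3 P hPt, e3 Q hQt, hPQ, ← sq] at e2
      have e4 : 0 ≤ (Q ^ 2 ^ (j + 1)).trace := by
        rw [← e3 Q hQt]; exact trace_mul_transpose_nonneg _
      calc |(X ^ 2 ^ (j + 1 + 1)).trace| = |((X ^ 2) ^ 2 ^ (j + 1)).trace| := by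
            rw [← pow_mul, ← pow_succ']
        _ ≤ ((X ^ 2 * (X ^ 2)ᵀ) ^ 2 ^ j).trace := hK _
        _ ≤ (P ^ 2 ^ j * Q ^ 2 ^ j).trace := by rw [e1]; exact hL P Q hPt hQt
        _ ≤ (Q ^ 2 ^ (j + 1)).trace := le_trans (le_abs_self _) (abs_le_of_sq_le_sq e2 e4)
    · calc ((A * B) ^ 2 ^ (j + 1)).trace ≤ ((A * B * (A * B)ᵀ) ^ 2 ^ j).trace :=
            le_trans (le_abs_self _) (hK _)
        _ = ((A ^ 2 * B ^ 2) ^ 2 ^ j).trace := by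
            have : A * B * (A * B)ᵀ = A * (B * B * A) := by
              rw [Matrix.transpose_mul, hA, hB]; simp only [mul_assoc]
            rw [this, trace_mul_pow_comm _ _ h2]
            have : B * B * A * A = B ^ 2 * A ^ 2 := by rw [sq, sq]; simp only [mul_assoc]
            rw [this, trace_mul_pow_comm _ _ h2]
        _ ≤ ((A ^ 2) ^ 2 ^ j * (B ^ 2) ^ 2 ^ j).trace :=
            hL _ _ (by rw [Matrix.transpose_pow, hA]) (by rw [Matrix.transpose_pow, hB])
        _ = _ := by rw [← pow_mul, ← pow_mul, ← pow_succ']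

end Trace

/-! ### The Lie product formula -/

section LieProduct

open Filter Topology NormedSpace

variable {𝔸 : Type*} [NormedRing 𝔸] [NormOneClass 𝔸] [NormedAlgebra ℝ 𝔸]

/-- The difference of powers telescopes. The additional factor `r` on the left avoids the exponent
`m - 1`. -/
theorem norm_pow_sub_pow_le {𝔸 : Type*} [NormedRing 𝔸] [NormOneClass 𝔸] (x y : 𝔸) {r : ℝ} (hx : ‖x‖ ≤ r) (hy : ‖y‖ ≤ r) (m : ℕ) :
    r * ‖x ^ m - y ^ m‖ ≤ m * r ^ m * ‖x - y‖ := by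
  have hr : 0 ≤ r := (norm_nonneg x).trans hx
  induction m with
  | zero => simp
  | succ m ih =>
    have e : x ^ (m + 1) - y ^ (m + 1) = x * (x ^ m - y ^ m) + (x - y) * y ^ m := by
      rw [pow_succ', pow_succ']; noncomm_ring
    calc r * ‖x ^ (m + 1) - y ^ (m + 1)‖
        ≤ r * (‖x‖ * ‖x ^ m - y ^ m‖ + ‖x - y‖ * ‖y‖ ^ m) := by
          rw [e]
          refine mul_le_mul_of_nonneg_left ((norm_add_le _ _).trans ?_) hr
          refine add_le_add (norm_mul_le _ _) ((norm_mul_le _ _).trans ?_)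
          exact mul_le_mul_of_nonneg_left (norm_pow_le _ _) (norm_nonneg _)
      _ ≤ r * (r * ‖x ^ m - y ^ m‖ + ‖x - y‖ * r ^ m) := by gcongr
      _ = r * (r * ‖x ^ m - y ^ m‖) + r ^ (m + 1) * ‖x - y‖ := by ring
      _ ≤ r * (m * r ^ m * ‖x - y‖) + r ^ (m + 1) * ‖x - y‖ := by gcongr
      _ = _ := by push_cast; ring

theorem norm_exp_le (x : 𝔸) : ‖exp x‖ ≤ Real.exp ‖x‖ := by
  rw [exp_eq_tsum ℝ]
  have h := expSeries_div_hasSum_exp ‖x‖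
  rw [← Real.exp_eq_exp_ℝ] at h
  refine tsum_of_norm_bounded h fun n => ?_
  rw [norm_smul, norm_inv, Real.norm_natCast, div_eq_inv_mul]
  exact mul_le_mul_of_nonneg_left (norm_pow_le _ _) (by positivity)

/-- The difference `g h` between `exp (h a) exp (h b)` and `exp (h (a + b))` vanishes at `0`
together with its derivative, so `m ‖g (1 / m)‖` tends to `0`. The telescoping bound says that
taking `m`-th powers multiplies the error by at most `m exp (‖a‖ + ‖b‖)`. -/
theorem tendsto_exp_mul_exp_pow [CompleteSpace 𝔸] (a b : 𝔸) :
    Tendsto (fun m : ℕ => (exp ((m : ℝ)⁻¹ • a) * exp ((m : ℝ)⁻¹ • b)) ^ m) atTop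
      (𝓝 (exp (a + b))) := by
  let _ : NormedAlgebra ℚ 𝔸 := NormedAlgebra.restrictScalars ℚ ℝ 𝔸
  let g : ℝ → 𝔸 := fun h => exp (h • a) * exp (h • b) - exp (h • (a + b))
  have hd : ∀ c : 𝔸, HasDerivAt (fun h : ℝ => exp (h • c)) c 0 := by
    intro c
    have := hasDerivAt_exp_smul_const (𝕂 := ℝ) c (0 : ℝ)
    simpa using this
  have hg : HasDerivAt g 0 0 := by
    exact (((hd a).mul (hd b)).sub (hd (a + b))).congr_deriv (by simp)
  have hg0 : g 0 = 0 := by simp [g]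
  set c := ‖a‖ + ‖b‖ with hc
  have hinv : Tendsto (fun m : ℕ => ((m : ℝ))⁻¹) atTop (𝓝 0) := tendsto_inv_atTop_nhds_zero_nat
  have hlim : Tendsto (fun m : ℕ => (m : ℝ) * ‖g ((m : ℝ)⁻¹)‖) atTop (𝓝 0) := by
    have h1 := (hasDerivAt_iff_isLittleO.1 hg).comp_tendsto hinv
    have h2 := h1.norm_left.tendsto_div_nhds_zero
    refine h2.congr fun m => ?_
    simp [hg0]
    ring
  have hexp : Tendsto (fun m : ℕ => Real.exp c * ((m : ℝ) * ‖g ((m : ℝ)⁻¹)‖)) atTop (𝓝 0) := by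
    simpa using hlim.const_mul (Real.exp c)
  rw [tendsto_iff_norm_sub_tendsto_zero]
  refine squeeze_zero' (Eventually.of_forall fun _ => norm_nonneg _) ?_ hexp
  filter_upwards [eventually_gt_atTop 0] with m hm
  have hm' : (0 : ℝ) < m := by exact_mod_cast hm
  have hn : ∀ x : 𝔸, ‖(m : ℝ)⁻¹ • x‖ = (m : ℝ)⁻¹ * ‖x‖ := by
    intro x; rw [norm_smul, Real.norm_of_nonneg (by positivity)]
  set r := Real.exp ((m : ℝ)⁻¹ * c) with hr
  have hx : ‖exp ((m : ℝ)⁻¹ • a) * exp ((m : ℝ)⁻¹ • b)‖ ≤ r := by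
    refine (norm_mul_le _ _).trans ?_
    rw [hr, hc, mul_add, Real.exp_add, ← hn a, ← hn b]
    exact mul_le_mul (norm_exp_le _) (norm_exp_le _) (norm_nonneg _) (Real.exp_pos _).le
  have hy : ‖exp ((m : ℝ)⁻¹ • (a + b))‖ ≤ r := by
    refine (norm_exp_le _).trans (Real.exp_le_exp.2 ?_)
    rw [hn]
    exact mul_le_mul_of_nonneg_left (norm_add_le _ _) (by positivity)
  have hpow : exp ((m : ℝ)⁻¹ • (a + b)) ^ m = exp (a + b) := by
    rw [← exp_nsmul, ← Nat.cast_smul_eq_nsmul ℝ, smul_smul, mul_inv_cancel₀ hm'.ne', one_smul]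
  have hrm : r ^ m = Real.exp c := by
    rw [hr, ← Real.exp_nat_mul, ← mul_assoc, mul_inv_cancel₀ hm'.ne', one_mul]
  have h1r : 1 ≤ r := Real.one_le_exp (by positivity)
  have := norm_pow_sub_pow_le _ _ hx hy m
  rw [hpow, hrm] at this
  calc _ ≤ r * _ := le_mul_of_one_le_left (norm_nonneg _) h1r
    _ ≤ _ := this
    _ = _ := by ring

end LieProduct

/-! ### Exponentials of symmetric matrices -/

section Exponential

open Filter Topology NormedSpace

variable {I : Type*} [Fintype I] [DecidableEq I]

theorem exp_inv_smul_pow (X : Matrix I I ℝ) {m : ℕ} (hm : 0 < m) :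
    exp ((m : ℝ)⁻¹ • X) ^ m = exp X := by
  rw [← Matrix.exp_nsmul, ← Nat.cast_smul_eq_nsmul ℝ, smul_smul,
    mul_inv_cancel₀ (by positivity), one_smul]

/-- The **Golden-Thompson inequality** for real symmetric matrices. -/
theorem trace_exp_add_le {A B : Matrix I I ℝ} (hA : Aᵀ = A) (hB : Bᵀ = B) :
    (exp (A + B)).trace ≤ (exp A * exp B).trace := by
  rcases isEmpty_or_nonempty I with hI | hI
  · simp [Matrix.trace]
  -- An auxiliary submultiplicative norm, used only to take the limit in the Lie product formula.
  let _ : NormedRing (Matrix I I ℝ) := Matrix.linftyOpNormedRing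
  let _ : NormedAlgebra ℝ (Matrix I I ℝ) := Matrix.linftyOpNormedAlgebra
  let _ : NormedAlgebra ℚ (Matrix I I ℝ) := NormedAlgebra.restrictScalars ℚ ℝ (Matrix I I ℝ)
  have : NormOneClass (Matrix I I ℝ) := Matrix.linfty_opNormOneClass
  -- The trace inequality is available for powers of two only, which suffices for the limit.
  have h2 : Tendsto (fun j : ℕ => 2 ^ j) atTop (atTop : Filter ℕ) :=
    tendsto_pow_atTop_atTop_of_one_lt one_lt_two
  have hlim := (tendsto_exp_mul_exp_pow A B).comp h2
  have htr : Continuous (fun X : Matrix I I ℝ => X.trace) := continuous_id.matrix_trace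
  have hlim' := (htr.tendsto _).comp hlim
  refine le_of_tendsto hlim' (Eventually.of_forall fun j => ?_)
  have hsym : ∀ X : Matrix I I ℝ, Xᵀ = X →
      (exp (((2 ^ j : ℕ) : ℝ)⁻¹ • X))ᵀ = exp (((2 ^ j : ℕ) : ℝ)⁻¹ • X) := by
    intro X hX
    rw [← Matrix.exp_transpose, Matrix.transpose_smul, hX]
  have := (abs_trace_pow_le_and_trace_mul_pow_le j).2 _ _ (hsym A hA) (hsym B hB)
  rw [exp_inv_smul_pow _ (by positivity), exp_inv_smul_pow _ (by positivity)] at this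
  exact this

theorem exists_orthogonal_diagonalization {A : Matrix I I ℝ} (hA : Aᵀ = A) :
    ∃ (W : Matrix I I ℝ) (μ : I → ℝ), Wᵀ * W = 1 ∧ W * Wᵀ = 1 ∧ A = W * Matrix.diagonal μ * Wᵀ ∧
      exp A = W * Matrix.diagonal (fun i => Real.exp (μ i)) * Wᵀ := by
  have hH : A.IsHermitian := by simpa [Matrix.IsHermitian] using hA
  let W : Matrix I I ℝ := ↑hH.eigenvectorUnitary
  have h1 : Wᵀ * W = 1 := by
    have := Unitary.coe_star_mul_self hH.eigenvectorUnitary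
    simpa [Matrix.star_eq_conjTranspose] using this
  have h2 : W * Wᵀ = 1 := mul_eq_one_comm.1 h1
  have h3 : A = W * Matrix.diagonal hH.eigenvalues * Wᵀ := by
    have := hH.spectral_theorem
    rw [Unitary.conjStarAlgAut_apply] at this
    exact this
  refine ⟨W, hH.eigenvalues, h1, h2, h3, ?_⟩
  have hinv : W⁻¹ = Wᵀ := Matrix.inv_eq_left_inv h1
  have hunit : IsUnit W := ⟨⟨W, Wᵀ, h2, h1⟩, rfl⟩
  conv_lhs => rw [h3]
  rw [← hinv, Matrix.exp_conj _ _ hunit, Matrix.exp_diagonal]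
  congr 3
  funext i
  rw [Real.exp_eq_exp_ℝ]
  exact congrFun (Pi.exp_def hH.eigenvalues) i

theorem dotProduct_conj_diagonal (W : Matrix I I ℝ) (μ : I → ℝ) (a : I → ℝ) :
    a ⬝ᵥ ((W * Matrix.diagonal μ * Wᵀ) *ᵥ a) = ∑ i, μ i * (Wᵀ *ᵥ a) i ^ 2 := by
  rw [← Matrix.mulVec_mulVec, ← Matrix.mulVec_mulVec, Matrix.dotProduct_mulVec,
    ← Matrix.mulVec_transpose]
  simp only [dotProduct, Matrix.mulVec_diagonal]
  refine Finset.sum_congr rfl fun i _ => ?_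
  ring

theorem dotProduct_self_eq_sum {W : Matrix I I ℝ} (hW : W * Wᵀ = 1) (a : I → ℝ) :
    a ⬝ᵥ a = ∑ i, (Wᵀ *ᵥ a) i ^ 2 := by
  have := dotProduct_conj_diagonal W (fun _ => 1) a
  simpa [Matrix.diagonal_one, hW] using this

/-- `exp A ≤ 1 + A + A ^ 2` for a symmetric contraction `A`. -/
theorem dotProduct_exp_le {A : Matrix I I ℝ} (hA : Aᵀ = A)
    (h : ∀ a : I → ℝ, |a ⬝ᵥ (A *ᵥ a)| ≤ a ⬝ᵥ a) (a : I → ℝ) :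
    a ⬝ᵥ (exp A *ᵥ a) ≤ a ⬝ᵥ a + a ⬝ᵥ (A *ᵥ a) + (A *ᵥ a) ⬝ᵥ (A *ᵥ a) := by
  obtain ⟨W, μ, h1, h2, h3, h4⟩ := exists_orthogonal_diagonalization hA
  -- The hypothesis is tested on the `i`-th eigenvector; afterwards everything is the scalar
  -- inequality on `[-1, 1]`.
  have hμ : ∀ i, |μ i| ≤ 1 := by
    intro i
    have hi := h (W *ᵥ Pi.single i 1)
    have e : Wᵀ *ᵥ (W *ᵥ Pi.single i 1) = Pi.single i 1 := by
      rw [Matrix.mulVec_mulVec, h1, Matrix.one_mulVec]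
    rw [dotProduct_self_eq_sum h2, h3, dotProduct_conj_diagonal, e] at hi
    simpa [Pi.single_apply] using hi
  have hsq : A * A = W * Matrix.diagonal (fun i => μ i * μ i) * Wᵀ := by
    rw [← Matrix.diagonal_mul_diagonal, h3]
    calc W * Matrix.diagonal μ * Wᵀ * (W * Matrix.diagonal μ * Wᵀ)
        = W * Matrix.diagonal μ * (Wᵀ * W) * Matrix.diagonal μ * Wᵀ := by
          simp only [Matrix.mul_assoc]
      _ = _ := by rw [h1, Matrix.mul_one]; simp only [Matrix.mul_assoc]
  have hAA : (A *ᵥ a) ⬝ᵥ (A *ᵥ a) = a ⬝ᵥ ((A * A) *ᵥ a) := by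
    rw [← Matrix.mulVec_mulVec, Matrix.dotProduct_mulVec a, ← Matrix.mulVec_transpose, hA]
  rw [hAA, hsq, h4, dotProduct_self_eq_sum h2]
  conv_rhs => rw [h3]
  simp only [dotProduct_conj_diagonal]
  rw [← Finset.sum_add_distrib, ← Finset.sum_add_distrib]
  refine Finset.sum_le_sum fun i _ => ?_
  have hb := (abs_le.1 (Real.abs_exp_sub_one_sub_id_le (hμ i))).2
  calc Real.exp (μ i) * (Wᵀ *ᵥ a) i ^ 2 ≤ (1 + μ i + μ i * μ i) * (Wᵀ *ᵥ a) i ^ 2 :=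
        mul_le_mul_of_nonneg_right (by nlinarith) (sq_nonneg _)
    _ = _ := by ring

/-- Some eigenvalue is at least `x`, and the trace of the exponential is a sum of positive terms,
one of them the exponential of that eigenvalue. The strict inequality excludes `a = 0`. -/
theorem exp_le_trace_exp {A : Matrix I I ℝ} (hA : Aᵀ = A) {x : ℝ} {a : I → ℝ}
    (h : x * (a ⬝ᵥ a) < a ⬝ᵥ (A *ᵥ a)) : Real.exp x ≤ (exp A).trace := by
  obtain ⟨W, μ, h1, h2, h3, h4⟩ := exists_orthogonal_diagonalization hA
  rw [dotProduct_self_eq_sum h2, h3, dotProduct_conj_diagonal, Finset.mul_sum] at h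
  obtain ⟨i, -, hi⟩ := Finset.exists_lt_of_sum_lt h
  have hx : x ≤ μ i := by
    by_contra hc
    exact absurd hi (not_lt.2 (mul_le_mul_of_nonneg_right (not_le.1 hc).le (sq_nonneg _)))
  rw [h4, Matrix.trace_mul_comm, ← Matrix.mul_assoc, h1, Matrix.one_mul, Matrix.trace_diagonal]
  exact (Real.exp_le_exp.2 hx).trans
    (Finset.single_le_sum (f := fun i => Real.exp (μ i)) (fun j _ => (Real.exp_pos _).le)
      (Finset.mem_univ i))

/-- Writing `exp A = L L` with `L = exp (A / 2)` symmetric turns the trace into a sum of values of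
the form of `Q` at the columns of `L`. -/
theorem trace_exp_mul_le {A Q : Matrix I I ℝ} (hA : Aᵀ = A) {c : ℝ}
    (hQ : ∀ a : I → ℝ, a ⬝ᵥ (Q *ᵥ a) ≤ c * (a ⬝ᵥ a)) :
    (exp A * Q).trace ≤ c * (exp A).trace := by
  set L := exp ((2 : ℝ)⁻¹ • A) with hL
  have hLt : Lᵀ = L := by rw [hL, ← Matrix.exp_transpose, Matrix.transpose_smul, hA]
  have hLL : exp A = L * L := by
    rw [hL, ← Matrix.exp_add_of_commute _ _ (Commute.refl _), ← add_smul]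
    norm_num
  have e : ∀ Y : Matrix I I ℝ, (L * Y * L).trace = ∑ i, (fun t => L t i) ⬝ᵥ (Y *ᵥ fun t => L t i) := by
    intro Y
    simp only [Matrix.trace, Matrix.diag_apply]
    refine Finset.sum_congr rfl fun i _ => ?_
    rw [Matrix.mul_assoc, Matrix.mul_apply]
    simp only [dotProduct]
    refine Finset.sum_congr rfl fun t _ => ?_
    rw [← congrFun (congrFun hLt i) t]
    rfl
  have e1 : (exp A * Q).trace = (L * Q * L).trace := by
    rw [hLL, Matrix.mul_assoc, Matrix.trace_mul_comm]
  have e2 : (exp A).trace = (L * 1 * L).trace := by rw [hLL, Matrix.mul_one]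
  rw [e1, e2, e, e, Finset.mul_sum]
  refine Finset.sum_le_sum fun i _ => ?_
  rw [Matrix.one_mulVec]
  exact hQ _

end Exponential

/-! ### A matrix Chernoff bound for sampling with replacement -/

section Chernoff

open NormedSpace

variable {I : Type*} [Fintype I] [DecidableEq I] {ι : Type*} [Fintype ι]

/-- This is the Ahlswede-Winter induction: one sample is peeled off, Golden-Thompson separates its
exponential, and summing over its values replaces that exponential by the scalar `c`. -/
theorem sum_trace_exp_sum_le {X : ι → Matrix I I ℝ} (hX : ∀ j, (X j)ᵀ = X j) {c : ℝ} (hc : 0 ≤ c)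
    (h : ∀ a : I → ℝ, ∑ j, a ⬝ᵥ (exp (X j) *ᵥ a) ≤ c * (a ⬝ᵥ a)) (s : ℕ) :
    ∑ ω : Fin s → ι, (exp (∑ q, X (ω q))).trace ≤ Fintype.card I * c ^ s := by
  induction s with
  | zero => simp
  | succ s ih =>
    have hsym : ∀ ω : Fin s → ι, (∑ q, X (ω q))ᵀ = ∑ q, X (ω q) := by
      intro ω; simp [Matrix.transpose_sum, hX]
    rw [← (Fin.consEquiv (fun _ : Fin (s + 1) => ι)).sum_comp, Fintype.sum_prod_type,
      Finset.sum_comm]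
    calc _ ≤ ∑ ω : Fin s → ι, ∑ j, (exp (∑ q, X (ω q)) * exp (X j)).trace := by
          refine Finset.sum_le_sum fun ω _ => Finset.sum_le_sum fun j _ => ?_
          simp only [Fin.consEquiv_apply, Fin.sum_univ_succ, Fin.cons_zero, Fin.cons_succ]
          rw [add_comm]
          exact trace_exp_add_le (hsym ω) (hX j)
      _ = ∑ ω : Fin s → ι, (exp (∑ q, X (ω q)) * ∑ j, exp (X j)).trace := by
          refine Finset.sum_congr rfl fun ω _ => ?_
          rw [Matrix.mul_sum, Matrix.trace_sum]
      _ ≤ ∑ ω : Fin s → ι, c * (exp (∑ q, X (ω q))).trace := by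
          refine Finset.sum_le_sum fun ω _ => trace_exp_mul_le (hsym ω) fun a => ?_
          rw [Matrix.sum_mulVec, dotProduct_sum]
          exact h a
      _ ≤ c * (Fintype.card I * c ^ s) := by
          rw [← Finset.mul_sum]
          exact mul_le_mul_of_nonneg_left ih hc
      _ = _ := by ring

/-- The average of `(y_{ω q} ⬝ᵥ a) ^ 2` over the samples `ω q` is within `ε` of `a ⬝ᵥ a`. -/
def IsBalancedSample (y : ι → I → ℝ) {s : ℕ} (ε : ℝ) (ω : Fin s → ι) : Prop :=
  ∀ a : I → ℝ, |(∑ q, (y (ω q) ⬝ᵥ a) ^ 2) / s - a ⬝ᵥ a| ≤ ε * (a ⬝ᵥ a)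

/-- Scaled centred rank-one matrices. -/
def centered (y : ι → I → ℝ) (θ : ℝ) (j : ι) : Matrix I I ℝ :=
  θ • (Matrix.vecMulVec (y j) (y j) - 1)

theorem centered_transpose (y : ι → I → ℝ) (θ : ℝ) (j : ι) :
    (centered y θ j)ᵀ = centered y θ j := by
  simp [centered, Matrix.transpose_smul, Matrix.transpose_sub, Matrix.transpose_vecMulVec]

theorem centered_mulVec (y : ι → I → ℝ) (θ : ℝ) (j : ι) (a : I → ℝ) :
    centered y θ j *ᵥ a = θ • ((y j ⬝ᵥ a) • y j - a) := by
  rw [centered, Matrix.smul_mulVec, Matrix.sub_mulVec, Matrix.one_mulVec,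
    Matrix.vecMulVec_mulVec]
  simp

theorem dotProduct_centered_mulVec (y : ι → I → ℝ) (θ : ℝ) (j : ι) (a : I → ℝ) :
    a ⬝ᵥ (centered y θ j *ᵥ a) = θ * ((y j ⬝ᵥ a) ^ 2 - a ⬝ᵥ a) := by
  rw [centered_mulVec, dotProduct_smul, dotProduct_sub, dotProduct_smul, dotProduct_comm a (y j)]
  simp only [smul_eq_mul]
  ring

theorem dotProduct_self_nonneg_real (a : I → ℝ) : 0 ≤ a ⬝ᵥ a :=
  Finset.sum_nonneg fun _ _ => mul_self_nonneg _

theorem sq_dotProduct_le (a b : I → ℝ) : (a ⬝ᵥ b) ^ 2 ≤ (a ⬝ᵥ a) * (b ⬝ᵥ b) := by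
  have := Finset.sum_mul_sq_le_sq_mul_sq Finset.univ a b
  simpa [dotProduct, sq] using this

/-- The condition on `θ` makes each `X = centered y θ j` a contraction, so `exp X ≤ 1 + X + X ^ 2`.
The linear terms cancel on average by `havg`, and the average of `X ^ 2` is at most `θ ^ 2 (M - 1)`,
because `X ^ 2 = θ ^ 2 ((y ⬝ᵥ y - 2) y yᵀ + 1)`. -/
theorem sum_trace_exp_centered_le {y : ι → I → ℝ} {M θ : ℝ} (hM : 1 ≤ M)
    (hy : ∀ j, y j ⬝ᵥ y j ≤ M)
    (havg : ∀ a : I → ℝ, ∑ j, (y j ⬝ᵥ a) ^ 2 = Fintype.card ι * (a ⬝ᵥ a))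
    (hθ : |θ| * M ≤ 1) (s : ℕ) :
    ∑ ω : Fin s → ι, (exp (∑ q, centered y θ (ω q))).trace ≤
      Fintype.card I * (Fintype.card ι * (1 + θ ^ 2 * M)) ^ s := by
  refine sum_trace_exp_sum_le (centered_transpose y θ) (by positivity) (fun a => ?_) s
  have haa := dotProduct_self_nonneg_real a
  have hbd : ∀ j (b : I → ℝ), |b ⬝ᵥ (centered y θ j *ᵥ b)| ≤ b ⬝ᵥ b := by
    intro j b
    have hb := dotProduct_self_nonneg_real b
    have h1 := sq_dotProduct_le (y j) b
    have h2 : (y j ⬝ᵥ y j) * (b ⬝ᵥ b) ≤ M * (b ⬝ᵥ b) := mul_le_mul_of_nonneg_right (hy j) hb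
    rw [dotProduct_centered_mulVec, abs_mul]
    have h3 : |(y j ⬝ᵥ b) ^ 2 - b ⬝ᵥ b| ≤ M * (b ⬝ᵥ b) := by
      rw [abs_le]; constructor <;> nlinarith [sq_nonneg (y j ⬝ᵥ b)]
    calc |θ| * |(y j ⬝ᵥ b) ^ 2 - b ⬝ᵥ b| ≤ |θ| * (M * (b ⬝ᵥ b)) :=
          mul_le_mul_of_nonneg_left h3 (abs_nonneg _)
      _ = |θ| * M * (b ⬝ᵥ b) := by ring
      _ ≤ 1 * (b ⬝ᵥ b) := mul_le_mul_of_nonneg_right hθ hb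
      _ = _ := one_mul _
  have hterm : ∀ j, a ⬝ᵥ (exp (centered y θ j) *ᵥ a) ≤
      a ⬝ᵥ a + θ * ((y j ⬝ᵥ a) ^ 2 - a ⬝ᵥ a) +
        θ ^ 2 * ((M - 2) * (y j ⬝ᵥ a) ^ 2 + a ⬝ᵥ a) := by
    intro j
    refine (dotProduct_exp_le (centered_transpose y θ j) (hbd j) a).trans ?_
    rw [dotProduct_centered_mulVec, centered_mulVec]
    refine add_le_add le_rfl ?_
    have : (θ • ((y j ⬝ᵥ a) • y j - a)) ⬝ᵥ (θ • ((y j ⬝ᵥ a) • y j - a)) =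
        θ ^ 2 * ((y j ⬝ᵥ y j - 2) * (y j ⬝ᵥ a) ^ 2 + a ⬝ᵥ a) := by
      simp only [dotProduct_smul, smul_dotProduct, dotProduct_sub, sub_dotProduct, smul_eq_mul,
        dotProduct_comm a (y j)]
      ring
    rw [this]
    refine mul_le_mul_of_nonneg_left ?_ (sq_nonneg _)
    have := mul_le_mul_of_nonneg_right (hy j) (sq_nonneg (y j ⬝ᵥ a))
    linarith
  refine (Finset.sum_le_sum fun j _ => hterm j).trans ?_
  simp only [Finset.sum_add_distrib, ← Finset.mul_sum, Finset.sum_sub_distrib, havg,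
    Finset.sum_const, Finset.card_univ, nsmul_eq_mul]
  have : 0 ≤ θ ^ 2 * ((Fintype.card ι : ℝ) * (a ⬝ᵥ a)) := by positivity
  nlinarith

-- An unbalanced sample makes the trace of the exponential at least `exp (θ ε s)` for the parameter
-- `θ` or `-θ`, whence the factor `2`. The mean grows at most like `exp (s θ ^ 2 M)`, and `θ = ε /
-- (2 M)` makes the difference of the exponents the largest possible, `s ε ^ 2 / (4 M)`.
open Classical in
theorem card_not_isBalancedSample_le {y : ι → I → ℝ} {M ε : ℝ} (hM : 1 ≤ M)
    (hy : ∀ j, y j ⬝ᵥ y j ≤ M)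
    (havg : ∀ a : I → ℝ, ∑ j, (y j ⬝ᵥ a) ^ 2 = Fintype.card ι * (a ⬝ᵥ a))
    (h0 : 0 < ε) (h1 : ε ≤ 1) {s : ℕ} (hs : 0 < s) :
    ((Finset.univ.filter fun ω : Fin s → ι => ¬ IsBalancedSample y ε ω).card : ℝ) ≤
      2 * Fintype.card I * Real.exp (-(s * ε ^ 2 / (4 * M))) * (Fintype.card ι : ℝ) ^ s := by
  have hs' : (0 : ℝ) < s := by exact_mod_cast hs
  set θ := ε / (2 * M) with hθ
  have hθ0 : 0 < θ := by positivity
  have hθM : θ * M ≤ 1 := by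
    rw [hθ, div_mul_eq_mul_div, div_le_one (by positivity)]; nlinarith
  let F : ℝ → (Fin s → ι) → ℝ := fun θ ω => (exp (∑ q, centered y θ (ω q))).trace
  have hquad : ∀ (ϑ : ℝ) (ω : Fin s → ι) (a : I → ℝ),
      a ⬝ᵥ ((∑ q, centered y ϑ (ω q)) *ᵥ a) =
        ϑ * ((∑ q, (y (ω q) ⬝ᵥ a) ^ 2) - s * (a ⬝ᵥ a)) := by
    intro ϑ ω a
    rw [Matrix.sum_mulVec, dotProduct_sum]
    simp_rw [dotProduct_centered_mulVec]
    rw [← Finset.mul_sum, Finset.sum_sub_distrib]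
    simp
  have hsym : ∀ (ϑ : ℝ) (ω : Fin s → ι),
      (∑ q, centered y ϑ (ω q))ᵀ = ∑ q, centered y ϑ (ω q) := by
    intro ϑ ω; simp [Matrix.transpose_sum, centered_transpose]
  have hpos : ∀ ϑ ω, 0 ≤ F ϑ ω := by
    intro ϑ ω
    obtain ⟨W, μ, g1, g2, g3, g4⟩ := exists_orthogonal_diagonalization (hsym ϑ ω)
    show 0 ≤ Matrix.trace _
    rw [g4, Matrix.trace_mul_comm, ← Matrix.mul_assoc, g1, Matrix.one_mul, Matrix.trace_diagonal]
    exact Finset.sum_nonneg fun i _ => (Real.exp_pos _).le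
  have hbad : ∀ ω : Fin s → ι, ¬ IsBalancedSample y ε ω →
      Real.exp (θ * ε * s) ≤ F θ ω + F (-θ) ω := by
    intro ω hω
    simp only [IsBalancedSample, not_forall, not_le] at hω
    obtain ⟨a, ha⟩ := hω
    have key : ε * (a ⬝ᵥ a) * s < |∑ q, (y (ω q) ⬝ᵥ a) ^ 2 - s * (a ⬝ᵥ a)| := by
      have : ∑ q, (y (ω q) ⬝ᵥ a) ^ 2 - s * (a ⬝ᵥ a) =
          ((∑ q, (y (ω q) ⬝ᵥ a) ^ 2) / s - a ⬝ᵥ a) * s := by field_simp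
      rw [this, abs_mul, abs_of_pos hs']
      exact mul_lt_mul_of_pos_right ha hs'
    rcases lt_abs.1 key with hk | hk
    · have : Real.exp (θ * ε * s) ≤ F θ ω := by
        refine exp_le_trace_exp (hsym θ ω) (a := a) ?_
        rw [hquad]
        have := mul_lt_mul_of_pos_left hk hθ0
        linarith
      linarith [hpos (-θ) ω]
    · have : Real.exp (θ * ε * s) ≤ F (-θ) ω := by
        refine exp_le_trace_exp (hsym (-θ) ω) (a := a) ?_
        rw [hquad]
        have := mul_lt_mul_of_pos_left hk hθ0
        linarith
      linarith [hpos θ ω]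
  have hsum : ∑ ω, (F θ ω + F (-θ) ω) ≤
      2 * Fintype.card I * (Fintype.card ι * (1 + θ ^ 2 * M)) ^ s := by
    rw [Finset.sum_add_distrib]
    have e1 := sum_trace_exp_centered_le hM hy havg (θ := θ) (by rwa [abs_of_pos hθ0]) s
    have e2 := sum_trace_exp_centered_le hM hy havg (θ := -θ)
      (by rwa [abs_neg, abs_of_pos hθ0]) s
    rw [neg_sq] at e2
    linarith
  refine card_filter_not_le_of_sum_le (S := {ω | IsBalancedSample y ε ω})
    (fun ω => add_nonneg (hpos θ ω) (hpos (-θ) ω)) (Real.exp_pos (θ * ε * s)) hbad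
    (hsum.trans ?_)
  have hexp : (1 + θ ^ 2 * M) ^ s ≤ Real.exp (-(s * ε ^ 2 / (4 * M))) * Real.exp (θ * ε * s) := by
    calc (1 + θ ^ 2 * M) ^ s ≤ Real.exp (θ ^ 2 * M) ^ s := by
          refine pow_le_pow_left₀ (by positivity) ?_ s
          rw [add_comm]; exact Real.add_one_le_exp _
      _ = _ := by
          rw [← Real.exp_nat_mul, ← Real.exp_add]
          congr 1
          rw [hθ]; field_simp; ring
  calc _ = 2 * Fintype.card I * (Fintype.card ι : ℝ) ^ s * (1 + θ ^ 2 * M) ^ s := by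
        rw [mul_pow]; ring
    _ ≤ 2 * Fintype.card I * (Fintype.card ι : ℝ) ^ s *
        (Real.exp (-(s * ε ^ 2 / (4 * M))) * Real.exp (θ * ε * s)) :=
        mul_le_mul_of_nonneg_left hexp (by positivity)
    _ = _ := by ring

end Chernoff

/-! ### An exponential moment of the length of a random signed sum -/

section Gaussian

open MeasureTheory ProbabilityTheory

theorem integral_exp_mul_gaussian (t : ℝ) :
    ∫ x, Real.exp (t * x) ∂(gaussianReal 0 1) = Real.exp (t ^ 2 / 2) := by
  have h := mgf_gaussianReal (p := gaussianReal 0 1) (μ := 0) (v := 1) (X := id)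
    (by rw [Measure.map_id]) t
  simpa [mgf] using h

theorem integral_exp_sq_gaussian :
    ∫ x, Real.exp (x ^ 2 / 4) ∂(gaussianReal 0 1) = √2 := by
  rw [integral_gaussianReal_eq_integral_smul one_ne_zero]
  have h1 : ∀ x : ℝ, gaussianPDFReal 0 1 x • Real.exp (x ^ 2 / 4) =
      (√(2 * Real.pi))⁻¹ * Real.exp (-(1 / 4) * x ^ 2) := by
    intro x
    simp only [gaussianPDFReal, NNReal.coe_one, mul_one, sub_zero, smul_eq_mul]
    rw [mul_assoc, ← Real.exp_add]
    congr 2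
    ring
  simp_rw [h1]
  rw [integral_const_mul, integral_gaussian, ← Real.sqrt_inv, ← Real.sqrt_mul (by positivity)]
  congr 1
  field_simp
  norm_num

/-- A non-integrable function would have integral `0` by convention, contradicting the value `√2`.
-/
theorem integrable_exp_sq_gaussian :
    Integrable (fun x => Real.exp (x ^ 2 / 4)) (gaussianReal 0 1) := by
  by_contra h
  have := integral_undef h
  rw [integral_exp_sq_gaussian] at this
  exact absurd this (by positivity)

/-- The sum factors over the coordinates into terms `2 cosh (x t)`, and `cosh x ≤ exp (x ^ 2 / 2)`.
-/
theorem sum_prod_exp_sgn_le {T : Type*} [Fintype T] [DecidableEq T] (x : T → ℝ) :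
    ∑ σ : T → Bool, Real.exp (∑ t, sgn (σ t) * x t) ≤
      Fintype.card (T → Bool) * Real.exp (∑ t, x t ^ 2 / 2) := by
  have h1 : ∑ σ : T → Bool, Real.exp (∑ t, sgn (σ t) * x t) = ∏ t, (2 * Real.cosh (x t)) := by
    have := Fintype.prod_sum (fun (t : T) (b : Bool) => Real.exp (sgn b * x t))
    simp_rw [Real.exp_sum]
    rw [← this]
    refine Finset.prod_congr rfl fun t _ => ?_
    rw [Fintype.sum_bool, Real.cosh_eq]
    simp only [sgn, if_true, Bool.false_eq_true, if_false, one_mul, neg_one_mul]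
    ring
  rw [h1, Finset.prod_mul_distrib, Real.exp_sum]
  have h2 : (Fintype.card (T → Bool) : ℝ) = ∏ _t : T, (2 : ℝ) := by simp
  rw [h2]
  refine mul_le_mul_of_nonneg_left ?_ (by positivity)
  exact Finset.prod_le_prod (fun t _ => (Real.cosh_pos _).le) fun t _ => Real.cosh_le_exp_half_sq _

/-- Gaussian linearization: for the signed sum `z`, `exp (‖z‖ ^ 2 / 4)` is the mean of `exp (z ⬝ᵥ g
/ √2)` over a standard Gaussian `g`. With `g` fixed, the exponent is linear in the signs, and by
`hv` their average is at most `exp (‖g‖ ^ 2 / 4)`, whose Gaussian mean is `√2` per coordinate. -/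
theorem sum_exp_sq_signed_sum_le {T I : Type*} [Fintype T] [DecidableEq T] [Fintype I]
    {v : T → I → ℝ} (hv : ∀ g : I → ℝ, ∑ t, (v t ⬝ᵥ g) ^ 2 = g ⬝ᵥ g) :
    ∑ σ : T → Bool, Real.exp ((∑ i, (∑ t, sgn (σ t) * v t i) ^ 2) / 4) ≤
      Fintype.card (T → Bool) * √2 ^ Fintype.card I := by
  set γ : Measure (I → ℝ) := Measure.pi fun _ => gaussianReal 0 1 with hγ
  let z : (T → Bool) → I → ℝ := fun σ i => ∑ t, sgn (σ t) * v t i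
  have hlin : ∀ σ, (∫ g, ∏ i, Real.exp (z σ i / √2 * g i) ∂γ) =
      Real.exp ((∑ i, z σ i ^ 2) / 4) := by
    intro σ
    rw [hγ, integral_fintype_prod_eq_prod (fun i x => Real.exp (z σ i / √2 * x))]
    simp_rw [integral_exp_mul_gaussian]
    rw [← Real.exp_sum, Finset.sum_div]
    congr 1
    refine Finset.sum_congr rfl fun i _ => ?_
    rw [div_pow, Real.sq_sqrt (by norm_num)]
    ring
  have hint : ∀ σ, Integrable (fun g => ∏ i, Real.exp (z σ i / √2 * g i)) γ := by
    intro σ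
    exact Integrable.fintype_prod fun i => integrable_exp_mul_gaussianReal _
  have hR : Integrable (fun g : I → ℝ => ∏ i, Real.exp (g i ^ 2 / 4)) γ :=
    Integrable.fintype_prod (f := fun _ x => Real.exp (x ^ 2 / 4))
      fun i => integrable_exp_sq_gaussian
  have hRval : ∫ g : I → ℝ, ∏ i, Real.exp (g i ^ 2 / 4) ∂γ = √2 ^ Fintype.card I := by
    rw [hγ, integral_fintype_prod_eq_prod (fun _ x => Real.exp (x ^ 2 / 4))]
    simp [integral_exp_sq_gaussian]
  have hpt : ∀ g : I → ℝ, ∑ σ, ∏ i, Real.exp (z σ i / √2 * g i) ≤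
      Fintype.card (T → Bool) * ∏ i, Real.exp (g i ^ 2 / 4) := by
    intro g
    have e1 : ∀ σ, ∏ i, Real.exp (z σ i / √2 * g i) =
        Real.exp (∑ t, sgn (σ t) * ((v t ⬝ᵥ g) / √2)) := by
      intro σ
      rw [← Real.exp_sum]
      congr 1
      simp only [z, dotProduct, Finset.sum_div, Finset.sum_mul, Finset.mul_sum]
      rw [Finset.sum_comm]
      refine Finset.sum_congr rfl fun t _ => Finset.sum_congr rfl fun i _ => ?_
      ring
    simp_rw [e1]
    refine (sum_prod_exp_sgn_le _).trans (le_of_eq ?_)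
    rw [← Real.exp_sum]
    congr 2
    simp_rw [div_pow, Real.sq_sqrt (show (0 : ℝ) ≤ 2 by norm_num), div_div]
    rw [← Finset.sum_div, hv, ← Finset.sum_div]
    simp only [dotProduct, ← sq]
    norm_num
  calc ∑ σ : T → Bool, Real.exp ((∑ i, z σ i ^ 2) / 4)
      = ∑ σ, ∫ g, ∏ i, Real.exp (z σ i / √2 * g i) ∂γ := by simp_rw [hlin]
    _ = ∫ g, ∑ σ, ∏ i, Real.exp (z σ i / √2 * g i) ∂γ :=
        (integral_finsetSum _ fun σ _ => hint σ).symm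
    _ ≤ ∫ g, Fintype.card (T → Bool) * ∏ i, Real.exp (g i ^ 2 / 4) ∂γ :=
        integral_mono (integrable_finsetSum _ fun σ _ => hint σ) (hR.const_mul _) hpt
    _ = _ := by rw [integral_const_mul, hRval]

end Gaussian

/-! ### Walsh-Hadamard matrices -/

theorem sum_range_two_mul (f : ℕ → ℝ) (m : ℕ) :
    ∑ j ∈ Finset.range (2 * m), f j = ∑ j ∈ Finset.range m, (f (2 * j) + f (2 * j + 1)) := by
  induction m with
  | zero => simp
  | succ m ih =>
    rw [Finset.sum_range_succ, ← ih, show 2 * (m + 1) = 2 * m + 1 + 1 by ring,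
      Finset.sum_range_succ, Finset.sum_range_succ, add_assoc]

/-- The binary digits of `j < 2 ^ m` vary independently, so this is the distributive law. The
induction splits off the lowest digit, that is, even and odd `j`. -/
theorem sum_prod_testBit (m : ℕ) (f : ℕ → Bool → ℝ) :
    ∑ j ∈ Finset.range (2 ^ m), ∏ b ∈ Finset.range m, f b (j.testBit b) =
      ∏ b ∈ Finset.range m, (f b false + f b true) := by
  induction m generalizing f with
  | zero => simp
  | succ m ih =>
    rw [pow_succ', sum_range_two_mul, Finset.prod_range_succ', ← ih (fun b => f (b + 1)),
      Finset.sum_mul]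
    refine Finset.sum_congr rfl fun j _ => ?_
    rw [Finset.prod_range_succ', Finset.prod_range_succ']
    have h1 : (2 * j + 1) / 2 = j := by omega
    have h2 : 2 * j / 2 = j := by omega
    simp only [Nat.testBit_add_one, h1, h2]
    have h3 : (2 * j).testBit 0 = false := by simp
    have h4 : (2 * j + 1).testBit 0 = true := by simp
    rw [h3, h4]
    ring

/-- The sum factors over the digits. If `i` and `i'` differ in a digit, its factor is `1 + (-1) =
0`; if they agree everywhere, all `m` factors are `2`. -/
theorem sum_hadamard_mul (m : ℕ) (i i' : Fin (2 ^ m)) :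
    ∑ j, hadamard m i j * hadamard m i' j = if i = i' then 1 else 0 := by
  have hpos : (0 : ℝ) < 2 ^ m := by positivity
  have hsq : √(2 ^ m : ℝ) * √(2 ^ m) = 2 ^ m := Real.mul_self_sqrt hpos.le
  let f : ℕ → Bool → ℝ := fun b β => (if (i : ℕ).testBit b && β then (-1 : ℝ) else 1) *
    (if (i' : ℕ).testBit b && β then (-1 : ℝ) else 1)
  have h1 : ∀ j, hadamard m i j * hadamard m i' j =
      (∏ b ∈ Finset.range m, f b ((j : ℕ).testBit b)) / 2 ^ m := by
    intro j
    simp only [hadamard, Matrix.of_apply, f, Finset.prod_mul_distrib]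
    rw [div_mul_div_comm, hsq]
  simp_rw [h1]
  rw [← Finset.sum_div, Fin.sum_univ_eq_sum_range
    (fun j => ∏ b ∈ Finset.range m, f b (j.testBit b)), sum_prod_testBit]
  split_ifs with h
  · subst h
    rw [div_eq_one_iff_eq hpos.ne']
    rw [Finset.prod_congr rfl (g := fun _ => (2 : ℝ)), Finset.prod_const, Finset.card_range]
    intro b _
    simp only [f]
    split_ifs <;> norm_num
  · have : ∃ b < m, (i : ℕ).testBit b ≠ (i' : ℕ).testBit b := by
      by_contra hc
      simp only [not_exists, not_and, ne_eq, not_not] at hc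
      apply h
      apply Fin.ext
      refine Nat.eq_of_testBit_eq fun b => ?_
      by_cases hb : b < m
      · exact hc b hb
      · have hle : 2 ^ m ≤ 2 ^ b := Nat.pow_le_pow_right (by norm_num) (not_lt.1 hb)
        rw [Nat.testBit_lt_two_pow (i.2.trans_le hle), Nat.testBit_lt_two_pow (i'.2.trans_le hle)]
    obtain ⟨b, hb, hne⟩ := this
    rw [Finset.prod_eq_zero (Finset.mem_range.2 hb), zero_div]
    simp only [f]
    cases h2 : (i : ℕ).testBit b <;> cases h3 : (i' : ℕ).testBit b <;> simp_all

theorem sq_hadamard (m : ℕ) (i j : Fin (2 ^ m)) : 2 ^ m * hadamard m i j ^ 2 = 1 := by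
  have hpos : (0 : ℝ) < 2 ^ m := by positivity
  simp only [hadamard, Matrix.of_apply, div_pow]
  rw [Real.sq_sqrt hpos.le, mul_div_cancel₀ _ hpos.ne', ← Finset.prod_pow]
  refine Finset.prod_eq_one fun b _ => ?_
  split_ifs <;> norm_num

/-! ### Flattening by the randomized Hadamard transform -/

section Flatten

variable {n : ℕ} {I : Type*}

/-- `U` with rows of zeros appended up to the order of the Hadamard matrix. -/
def padRows (U : Matrix (Fin n) I ℝ) : Matrix (Fin (padDim n)) I ℝ :=
  Matrix.of fun t i => if h : (t : ℕ) < n then U ⟨t, h⟩ i else 0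

/-- The `j`-th row of `√N H D U`. -/
noncomputable def flatRow (U : Matrix (Fin n) I ℝ) (σ : Fin (padDim n) → Bool) (j : Fin (padDim n)) (i : I) : ℝ :=
  ∑ t, sgn (σ t) * (√(padDim n) * hadamard (Nat.clog 2 n) t j * padRows U t i)

theorem sum_padDim_eq {F : Fin (padDim n) → ℝ} (hF : ∀ t : Fin (padDim n), n ≤ (t : ℕ) → F t = 0) :
    ∑ t, F t = ∑ t : Fin n, F (Fin.castLE (Nat.le_pow_clog one_lt_two n) t) := by
  refine (Fintype.sum_of_injective (Fin.castLE (Nat.le_pow_clog one_lt_two n))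
    (Fin.castLE_injective _) _ F (fun t ht => ?_) fun _ => rfl).symm
  refine hF t ?_
  by_contra hlt
  exact ht ⟨⟨t, not_le.1 hlt⟩, by ext; rfl⟩

theorem padRows_castLE (U : Matrix (Fin n) I ℝ) (t : Fin n) (i : I) :
    padRows U (Fin.castLE (Nat.le_pow_clog one_lt_two n) t) i = U t i := by
  simp [padRows]

theorem padRows_eq_zero (U : Matrix (Fin n) I ℝ) {t : Fin (padDim n)} (ht : n ≤ (t : ℕ)) (i : I) :
    padRows U t i = 0 := by
  simp [padRows, not_lt.2 ht]

variable [Fintype I]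

theorem flatRow_dotProduct (U : Matrix (Fin n) I ℝ) (σ : Fin (padDim n) → Bool)
    (j : Fin (padDim n)) (a : I → ℝ) :
    flatRow U σ j ⬝ᵥ a = √(padDim n) *
      ∑ t, sgn (σ t) * (padRows U *ᵥ a) t * hadamard (Nat.clog 2 n) t j := by
  simp only [flatRow, dotProduct, Matrix.mulVec, Finset.sum_mul, Finset.mul_sum]
  rw [Finset.sum_comm]
  refine Finset.sum_congr rfl fun t _ => Finset.sum_congr rfl fun i _ => ?_
  ring

variable [DecidableEq I]

theorem dotProduct_mulVec_self_of_orthonormal {T : Type*} [Fintype T] {U : Matrix T I ℝ}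
    (hU : Uᵀ * U = 1) (a : I → ℝ) : (U *ᵥ a) ⬝ᵥ (U *ᵥ a) = a ⬝ᵥ a := by
  rw [Matrix.dotProduct_mulVec, Matrix.vecMul_mulVec, hU, Matrix.vecMul_one]

theorem padRows_orthonormal {U : Matrix (Fin n) I ℝ} (hU : Uᵀ * U = 1) :
    (padRows U)ᵀ * padRows U = 1 := by
  rw [← hU]
  ext i j
  simp only [Matrix.mul_apply, Matrix.transpose_apply]
  rw [sum_padDim_eq fun t ht => by rw [padRows_eq_zero U ht, zero_mul]]
  simp only [padRows_castLE]

/-- The entries of `√N H` are `±1`, so a fixed row of `√N H D U` is a signed sum of the rows of the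
padded `U` up to fixed signs. Orthonormality of the columns supplies the hypothesis of the
exponential moment bound. -/
theorem sum_exp_flatRow_le {U : Matrix (Fin n) I ℝ} (hU : Uᵀ * U = 1) (j : Fin (padDim n)) :
    ∑ σ : Fin (padDim n) → Bool, Real.exp ((flatRow U σ j ⬝ᵥ flatRow U σ j) / 4) ≤
      Fintype.card (Fin (padDim n) → Bool) * √2 ^ Fintype.card I := by
  have h := sum_exp_sq_signed_sum_le (T := Fin (padDim n))
    (v := fun t i => √(padDim n) * hadamard (Nat.clog 2 n) t j * padRows U t i) (fun g => ?_)
  · simpa only [flatRow, dotProduct, ← sq] using h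
  · rw [← dotProduct_mulVec_self_of_orthonormal (padRows_orthonormal hU) g]
    conv_rhs => rw [dotProduct]
    refine Finset.sum_congr rfl fun t _ => ?_
    have e : (fun i => √(padDim n : ℝ) * hadamard (Nat.clog 2 n) t j * padRows U t i) ⬝ᵥ g =
        √(padDim n) * hadamard (Nat.clog 2 n) t j * (padRows U *ᵥ g) t := by
      simp only [dotProduct, Matrix.mulVec, Finset.mul_sum, mul_assoc]
    have e2 : (√(padDim n : ℝ) * hadamard (Nat.clog 2 n) t j) ^ 2 = 1 := by
      rw [mul_pow, Real.sq_sqrt (Nat.cast_nonneg _), ← sq_hadamard (Nat.clog 2 n) t j]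
      push_cast; rfl
    rw [e, mul_pow, e2]
    ring

/-- Since `H` and `D` are orthogonal, the `N` rows are isotropic on average for every choice of the
signs; this is the hypothesis `havg` of the Chernoff bound. -/
theorem sum_sq_flatRow_dotProduct {U : Matrix (Fin n) I ℝ} (hU : Uᵀ * U = 1)
    (σ : Fin (padDim n) → Bool) (a : I → ℝ) :
    ∑ j, (flatRow U σ j ⬝ᵥ a) ^ 2 = Fintype.card (Fin (padDim n)) * (a ⬝ᵥ a) := by
  simp_rw [flatRow_dotProduct, mul_pow, Real.sq_sqrt (Nat.cast_nonneg (padDim n))]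
  rw [← Finset.mul_sum, Fintype.card_fin]
  congr 1
  set w : Fin (padDim n) → ℝ := fun t => sgn (σ t) * (padRows U *ᵥ a) t with hw
  calc ∑ j, (∑ t, w t * hadamard (Nat.clog 2 n) t j) ^ 2
      = ∑ j, ∑ t, ∑ t', w t * w t' *
          (hadamard (Nat.clog 2 n) t j * hadamard (Nat.clog 2 n) t' j) := by
        refine Finset.sum_congr rfl fun j _ => ?_
        rw [sq, Finset.sum_mul_sum]
        refine Finset.sum_congr rfl fun t _ => Finset.sum_congr rfl fun t' _ => ?_
        ring
    _ = ∑ t, ∑ t', w t * w t' *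
          ∑ j, hadamard (Nat.clog 2 n) t j * hadamard (Nat.clog 2 n) t' j := by
        rw [Finset.sum_comm]
        refine Finset.sum_congr rfl fun t _ => ?_
        rw [Finset.sum_comm]
        simp_rw [Finset.mul_sum]
    _ = ∑ t, w t * w t := by
        simp_rw [sum_hadamard_mul]
        simp
    _ = (padRows U *ᵥ a) ⬝ᵥ (padRows U *ᵥ a) := by
        rw [dotProduct]
        refine Finset.sum_congr rfl fun t _ => ?_
        simp only [hw]
        rw [mul_mul_mul_comm, sgn_mul_self, one_mul]
    _ = _ := dotProduct_mulVec_self_of_orthonormal (padRows_orthonormal hU) a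

theorem hadamardSketch_apply {s : ℕ} (ω : HadamardChoice n s) (t : Fin n) (q : Fin s) :
    hadamardSketch ω t q = √((padDim n : ℝ) / s) *
      (sgn (ω.2 (Fin.castLE (Nat.le_pow_clog one_lt_two n) t)) *
        hadamard (Nat.clog 2 n) (Fin.castLE (Nat.le_pow_clog one_lt_two n) t) (ω.1 q)) := by
  simp only [hadamardSketch, Matrix.submatrix_apply, Matrix.smul_apply, Matrix.mul_apply, id,
    smul_eq_mul, Matrix.of_apply]
  congr 1
  rw [Finset.sum_eq_single (ω.1 q)]
  · rw [← Matrix.mul_apply, Matrix.diagonal_mul]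
    simp
  · intro b _ hb
    simp [hb]
  · simp

/-- Coordinate `q` of `Πᵀ U a` is the sampled row of `√N H D U` applied to `a`, divided by `√s`. -/
theorem IsBalancedSample.nearIsometry {U : Matrix (Fin n) I ℝ} {s : ℕ}
    {ω : HadamardChoice n s} {ε : ℝ} (h : IsBalancedSample (flatRow U ω.2) ε ω.1) :
    NearIsometry U ε (hadamardSketch ω) := by
  intro a
  have key : a ⬝ᵥ ((Uᵀ * (hadamardSketch ω * (hadamardSketch ω)ᵀ) * U) *ᵥ a) =
      (∑ q, (flatRow U ω.2 (ω.1 q) ⬝ᵥ a) ^ 2) / s := by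
    have e1 : a ⬝ᵥ ((Uᵀ * (hadamardSketch ω * (hadamardSketch ω)ᵀ) * U) *ᵥ a) =
        ((hadamardSketch ω)ᵀ *ᵥ (U *ᵥ a)) ⬝ᵥ ((hadamardSketch ω)ᵀ *ᵥ (U *ᵥ a)) := by
      rw [Matrix.mul_assoc, Matrix.mul_assoc, ← Matrix.mulVec_mulVec, ← Matrix.mulVec_mulVec,
        ← Matrix.mulVec_mulVec, Matrix.dotProduct_mulVec, Matrix.vecMul_transpose,
        Matrix.dotProduct_mulVec, ← Matrix.mulVec_transpose]
    rw [e1, dotProduct, Finset.sum_div]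
    refine Finset.sum_congr rfl fun q _ => ?_
    have e2 : ((hadamardSketch ω)ᵀ *ᵥ (U *ᵥ a)) q = (flatRow U ω.2 (ω.1 q) ⬝ᵥ a) / √s := by
      have hz : ∀ t : Fin (padDim n), n ≤ (t : ℕ) →
          sgn (ω.2 t) * (padRows U *ᵥ a) t * hadamard (Nat.clog 2 n) t (ω.1 q) = 0 := by
        intro t ht
        have : (padRows U *ᵥ a) t = 0 := by
          simp only [Matrix.mulVec, dotProduct]
          exact Finset.sum_eq_zero fun i _ => by rw [padRows_eq_zero U ht, zero_mul]
        rw [this]; ring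
      rw [flatRow_dotProduct, sum_padDim_eq hz]
      simp only [Matrix.mulVec, dotProduct, Matrix.transpose_apply, hadamardSketch_apply,
        padRows_castLE]
      rw [Real.sqrt_div (Nat.cast_nonneg _), Finset.mul_sum, Finset.sum_div]
      refine Finset.sum_congr rfl fun t _ => ?_
      ring
    rw [e2, ← sq, div_pow, Real.sq_sqrt (Nat.cast_nonneg _)]
  rw [key]
  exact h a

end Flatten

/-! ### Failure probability of the subsampled randomized Hadamard transform -/

open Classical in
-- Union bound by conditioning on the second component: all outcomes over a bad `b` are given up,
-- and over a good `b` a fraction at most `δ₂` fails.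
theorem card_filter_prod_le {A B : Type*} [Fintype A] [Fintype B] {P : A × B → Prop}
    {G : B → Prop} {δ₁ δ₂ : ℝ} (hδ₂ : 0 ≤ δ₂)
    (h₁ : ((Finset.univ.filter fun b => ¬ G b).card : ℝ) ≤ δ₁ * Fintype.card B)
    (h₂ : ∀ b, G b → ((Finset.univ.filter fun a => ¬ P (a, b)).card : ℝ) ≤ δ₂ * Fintype.card A) :
    ((Finset.univ.filter fun x => ¬ P x).card : ℝ) ≤ (δ₁ + δ₂) * Fintype.card (A × B) := by
  have e : ((Finset.univ.filter fun x => ¬ P x).card : ℝ) =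
      ∑ b, ((Finset.univ.filter fun a => ¬ P (a, b)).card : ℝ) := by
    simp only [Finset.card_filter, Nat.cast_sum]
    rw [Fintype.sum_prod_type_right]
  have e2 : ((Finset.univ.filter fun b => ¬ G b).card : ℝ) = ∑ b, if ¬ G b then (1 : ℝ) else 0 := by
    rw [Finset.card_filter]; push_cast; rfl
  rw [e]
  calc _ ≤ ∑ b, ((if ¬ G b then (1 : ℝ) else 0) * Fintype.card A + δ₂ * Fintype.card A) := by
        refine Finset.sum_le_sum fun b _ => ?_
        by_cases hb : G b
        · simpa [hb] using h₂ b hb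
        · have : ((Finset.univ.filter fun a => ¬ P (a, b)).card : ℝ) ≤ Fintype.card A := by
            exact_mod_cast Finset.card_le_univ _
          have h3 : 0 ≤ δ₂ * (Fintype.card A : ℝ) := by positivity
          simp only [hb, not_false_eq_true, if_true, one_mul]
          linarith
    _ = ((Finset.univ.filter fun b => ¬ G b).card : ℝ) * Fintype.card A +
        Fintype.card B * (δ₂ * Fintype.card A) := by
        rw [Finset.sum_add_distrib, ← Finset.sum_mul, ← e2]; simp
    _ ≤ δ₁ * Fintype.card B * Fintype.card A + Fintype.card B * (δ₂ * Fintype.card A) := by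
        gcongr
    _ = _ := by rw [Fintype.card_prod]; push_cast; ring

theorem padDim_le {n : ℕ} (hn : 0 < n) : padDim n ≤ 2 * n := by
  unfold padDim
  rcases Nat.lt_or_ge 1 n with h | h
  · have h1 := Nat.pow_pred_clog_lt_self one_lt_two h
    have h2 : 0 < Nat.clog 2 n := Nat.clog_pos one_lt_two h
    obtain ⟨m, hm⟩ := Nat.exists_eq_succ_of_ne_zero h2.ne'
    rw [hm, Nat.succ_eq_add_one, pow_succ] 
    rw [hm] at h1
    simp only [Nat.pred_succ] at h1
    omega
  · have : n = 1 := by omega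
    subst this
    simp

/-- All the rows of `√N H D U` have squared length at most `M`. -/
def IsFlat {n : ℕ} {I : Type*} [Fintype I] (U : Matrix (Fin n) I ℝ) (M : ℝ)
    (σ : Fin (padDim n) → Bool) : Prop :=
  ∀ j, flatRow U σ j ⬝ᵥ flatRow U σ j ≤ M

-- Markov's inequality for the sum of `exp (‖row‖ ^ 2 / 4)` over the at most `2 n` rows leaves `2 n
-- 2 ^ k ≤ exp (6 k + 6 log n) / 20` to check. It holds because `40 * 2 ^ k ≤ 80 ^ k` and `80 ≤ exp
-- 6`.
open Classical in
theorem card_not_isFlat_le {n k : ℕ} (hn : 0 < n) (hk : 0 < k) {I : Type*} [Fintype I]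
    [DecidableEq I] {U : Matrix (Fin n) I ℝ} (hU : Uᵀ * U = 1) (hI : Fintype.card I ≤ k) :
    ((Finset.univ.filter fun σ : Fin (padDim n) → Bool =>
      ¬ IsFlat U (24 * (k + Real.log n)) σ).card : ℝ) ≤
      1 / 20 * Fintype.card (Fin (padDim n) → Bool) := by
  set M : ℝ := 24 * (k + Real.log n) with hM
  have hn' : (0 : ℝ) < n := by exact_mod_cast hn
  have hlog : 0 ≤ Real.log n := Real.log_natCast_nonneg n
  have hB : (0 : ℝ) < Fintype.card (Fin (padDim n) → Bool) := by exact_mod_cast Fintype.card_pos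
  have hsum : ∑ σ : Fin (padDim n) → Bool,
      ∑ j, Real.exp ((flatRow U σ j ⬝ᵥ flatRow U σ j) / 4) ≤
      padDim n * (Fintype.card (Fin (padDim n) → Bool) * √2 ^ Fintype.card I) := by
    rw [Finset.sum_comm]
    refine (Finset.sum_le_sum fun j _ => sum_exp_flatRow_le hU j).trans (le_of_eq ?_)
    rw [Finset.sum_const, Finset.card_univ, Fintype.card_fin, nsmul_eq_mul]
  refine card_filter_not_le_of_sum_le
    (S := {σ | IsFlat U M σ})
    (fun σ => Finset.sum_nonneg fun j _ => (Real.exp_pos _).le) (Real.exp_pos (M / 4))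
    (fun σ hσ => ?_) (hsum.trans ?_)
  · simp only [IsFlat, Set.mem_ofPred_eq, not_forall, not_le] at hσ
    obtain ⟨j, hj⟩ := hσ
    refine le_trans (Real.exp_le_exp.2 (by linarith)) (Finset.single_le_sum
      (f := fun j => Real.exp ((flatRow U σ j ⬝ᵥ flatRow U σ j) / 4))
      (fun j _ => (Real.exp_pos _).le) (Finset.mem_univ j))
  · have h1 : (padDim n : ℝ) ≤ 2 * n := by exact_mod_cast padDim_le hn
    have hs2 : (1 : ℝ) ≤ √2 := by rw [Real.le_sqrt] <;> norm_num
    have hs2' : √2 ≤ (2 : ℝ) := by rw [Real.sqrt_le_left] <;> norm_num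
    have h2 : √2 ^ Fintype.card I ≤ (2 : ℝ) ^ k :=
      (pow_le_pow_right₀ hs2 hI).trans (pow_le_pow_left₀ (by positivity) hs2' k)
    have h3 : 40 * (2 : ℝ) ^ k ≤ Real.exp (6 * k) := by
      have e1 : (80 : ℝ) ≤ Real.exp 6 := by
        have := Real.exp_one_gt_d9
        have e6 : Real.exp 6 = Real.exp 1 ^ 6 := by rw [← Real.exp_nat_mul]; norm_num
        rw [e6]
        calc (80 : ℝ) ≤ 2.7 ^ 6 := by norm_num
          _ ≤ _ := pow_le_pow_left₀ (by norm_num) (by linarith) 6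
      have e2 : Real.exp (6 * k) = Real.exp 6 ^ k := by
        rw [← Real.exp_nat_mul]; ring_nf
      have e3 : (40 : ℝ) ≤ 40 ^ k := by
        calc (40 : ℝ) = 40 ^ 1 := by norm_num
          _ ≤ 40 ^ k := pow_le_pow_right₀ (by norm_num) hk
      rw [e2]
      calc 40 * (2 : ℝ) ^ k ≤ 40 ^ k * 2 ^ k := by gcongr
        _ = 80 ^ k := by rw [← mul_pow]; norm_num
        _ ≤ _ := pow_le_pow_left₀ (by norm_num) e1 k
    have h4 : (n : ℝ) ≤ Real.exp (6 * Real.log n) := by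
      calc (n : ℝ) = Real.exp (Real.log n) := (Real.exp_log hn').symm
        _ ≤ _ := Real.exp_le_exp.2 (by linarith)
    have h5 : Real.exp (M / 4) = Real.exp (6 * k) * Real.exp (6 * Real.log n) := by
      rw [← Real.exp_add, hM]; ring_nf
    have h6 : (padDim n : ℝ) * √2 ^ Fintype.card I ≤ 1 / 20 * Real.exp (M / 4) := by
      calc (padDim n : ℝ) * √2 ^ Fintype.card I ≤ (2 * n) * 2 ^ k := by gcongr
        _ = 1 / 20 * ((40 * 2 ^ k) * n) := by ring
        _ ≤ 1 / 20 * (Real.exp (6 * k) * Real.exp (6 * Real.log n)) := by gcongr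
        _ = _ := by rw [h5]
    calc _ = (padDim n : ℝ) * √2 ^ Fintype.card I * Fintype.card (Fin (padDim n) → Bool) := by ring
      _ ≤ 1 / 20 * Real.exp (M / 4) * Fintype.card (Fin (padDim n) → Bool) := by gcongr
      _ = _ := by ring

/-- The failure probability `1 / 10` is shared equally between signs that fail to flatten `U` and,
for flattening signs, samples that are not balanced. -/
theorem hadamard_accurate {n k : ℕ} {ε : ℝ} {R : Matrix (Fin n) (Fin n) ℝ} (hR : IsDensity R)
    (hk : AtMostNonzero hR k) (h0 : 0 < ε) (h1 : ε < 1 / 2) {s : ℕ}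
    (hs : 672 * ((k : ℝ) + Real.log n) * Real.log (k + 1) / ε ^ 2 ≤ s) :
    9 / 10 ≤ (ProbabilityTheory.uniformOn (Set.univ : Set (HadamardChoice n s))).real
      {ω | Accurate hR k ε (hadamardSketch ω)} := by
  classical
  have hkpos := pos_of_atMostNonzero hk
  have hn := hR.pos_dim
  have hk1 : (1 : ℝ) ≤ k := by exact_mod_cast hkpos
  have hlogn : 0 ≤ Real.log n := Real.log_natCast_nonneg n
  have hlogk : 0 < Real.log ((k : ℝ) + 1) := Real.log_pos (by linarith)
  set M : ℝ := 24 * (k + Real.log n) with hM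
  have hM1 : 1 ≤ M := by linarith
  have hsr : (0 : ℝ) < s := lt_of_lt_of_le (by positivity) hs
  have hs0 : 0 < s := by exact_mod_cast hsr
  obtain ⟨U, V, hU, hUV⟩ := exists_factorization hR
  have hcard := card_nonzero_eigenvalues_le hk
  have hcard' : (Fintype.card {i : Fin n // hR.isHermitian.eigenvalues i ≠ 0} : ℝ) ≤ k := by
    exact_mod_cast hcard
  have hpad : Nonempty (Fin (padDim n)) := ⟨⟨0, by unfold padDim; positivity⟩⟩
  have hexp : 2 * (Fintype.card {i : Fin n // hR.isHermitian.eigenvalues i ≠ 0} : ℝ) *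
      Real.exp (-(s * ε ^ 2 / (4 * M))) ≤ 1 / 20 := by
    -- This is the hypothesis on `s`, since `672 = 7 * 4 * 24`. The exponential is then at least `(k
    -- + 1) ^ 7 ≥ 2 ^ 6 (k + 1)`, which exceeds `40 k`.
    have e1 : 7 * Real.log ((k : ℝ) + 1) ≤ s * ε ^ 2 / (4 * M) := by
      rw [div_le_iff₀ (by positivity)] at hs
      rw [le_div_iff₀ (by positivity)]
      linarith
    have e2 : 40 * (k : ℝ) ≤ Real.exp (s * ε ^ 2 / (4 * M)) := by
      refine le_trans ?_ (Real.exp_le_exp.2 e1)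
      have : Real.exp (7 * Real.log ((k : ℝ) + 1)) = ((k : ℝ) + 1) ^ 7 := by
        rw [← Real.exp_log (show (0 : ℝ) < k + 1 by linarith), ← Real.exp_nat_mul, Real.log_exp]
        norm_num
      rw [this]
      calc 40 * (k : ℝ) ≤ 2 ^ 6 * (k + 1) := by linarith
        _ ≤ (k + 1) ^ 6 * (k + 1) := by gcongr; linarith
        _ = _ := by ring
    rw [Real.exp_neg, ← div_eq_mul_inv, div_le_iff₀ (Real.exp_pos _)]
    linarith
  have hfail : ((Finset.univ.filter fun ω : HadamardChoice n s =>
      ¬ Accurate hR k ε (hadamardSketch ω)).card : ℝ) ≤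
      (1 / 20 + 1 / 20) * Fintype.card (HadamardChoice n s) := by
    refine card_filter_prod_le (by norm_num) (card_not_isFlat_le hn hkpos hU hcard) fun σ hσ => ?_
    refine le_trans ?_ ((card_not_isBalancedSample_le (s := s) hM1 hσ
      (sum_sq_flatRow_dotProduct hU σ) h0 (by linarith) hs0).trans ?_)
    · refine Nat.cast_le.2 (Finset.card_le_card fun a ha => ?_)
      rw [Finset.mem_filter] at ha ⊢
      refine ⟨Finset.mem_univ _, fun hbal => ha.2 ?_⟩
      exact (IsBalancedSample.nearIsometry (ω := (a, σ)) hbal).accurate hk hU hUV h0 h1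
    · have e : (Fintype.card (Fin s → Fin (padDim n)) : ℝ) =
          (Fintype.card (Fin (padDim n)) : ℝ) ^ s := by
        rw [Fintype.card_fun, Fintype.card_fin s, Nat.cast_pow]
      rw [e]
      exact mul_le_mul_of_nonneg_right hexp (by positivity)
  have := one_sub_le_uniformOn_real {ω : HadamardChoice n s | Accurate hR k ε (hadamardSketch ω)}
    hfail
  linarith

/-! ### Reasoning about programs -/

@[simp] theorem Mem.ivar_putVar (σ : Mem) (x v y : ℕ) :
    (σ.putVar x v).ivar y = if y = x then v else σ.ivar y := by
  simp [Mem.putVar, Function.update_apply]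

@[simp] theorem Mem.rarr_putVar (σ : Mem) (x v : ℕ) : (σ.putVar x v).rarr = σ.rarr := rfl

theorem Mem.rarr_putReal (σ : Mem) (a i j : ℕ) (v : ℝ) (i' j' : ℕ) :
    (σ.putReal a i j v).rarr a i' j' = if i' = i ∧ j' = j then v else σ.rarr a i' j' := by
  simp [Mem.putReal]

theorem Mem.rarr_putReal_of_ne (σ : Mem) {a b : ℕ} (h : b ≠ a) (i j : ℕ) (v : ℝ) :
    (σ.putReal a i j v).rarr b = σ.rarr b := by
  funext i' j'; simp [Mem.putReal, h]

/-- Invariant rule for loops. -/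
theorem exec_loop_of_invariant {x : ℕ} {e : IExp} {P : Prog} {σ : Mem} {N : ℕ}
    (hN : e.eval σ = N) (Inv : ℕ → Mem → Prop) (c : ℕ) (h0 : Inv 0 σ)
    (hs : ∀ t < N, ∀ τ, Inv t τ →
      Inv (t + 1) (P.exec (τ.putVar x t)).1 ∧ (P.exec (τ.putVar x t)).2 ≤ c) :
    Inv N ((Prog.loop x e P).exec σ).1 ∧
      ((Prog.loop x e P).exec σ).2 ≤ e.cost + 1 + N * (c + 1) := by
  rw [Prog.exec, hN]
  clear hN
  induction N with
  | zero => exact ⟨h0, by simp⟩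
  | succ N ih =>
    obtain ⟨ih1, ih2⟩ := ih fun t ht => hs t (by omega)
    rw [List.range_succ, List.foldl_append]
    obtain ⟨h1, h2⟩ := hs N (by omega) _ ih1
    refine ⟨h1, ?_⟩
    simp only [List.foldl_cons, List.foldl_nil]
    have : (N + 1) * (c + 1) = N * (c + 1) + (c + 1) := by ring
    omega

/-! ### Frame rules: memory that a program leaves unchanged -/

/-- `P` may write the integer variable `y`. -/
def Prog.WritesVar (y : ℕ) : Prog → Prop
  | .skip => False
  | .setVar x _ => x = y
  | .setInt _ _ _ => False
  | .setReal _ _ _ _ => False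
  | .seq P Q => P.WritesVar y ∨ Q.WritesVar y
  | .cond _ P Q => P.WritesVar y ∨ Q.WritesVar y
  | .loop x _ P => x = y ∨ P.WritesVar y

/-- `P` may write the real array `a`. -/
def Prog.WritesReal (a : ℕ) : Prog → Prop
  | .skip => False
  | .setVar _ _ => False
  | .setInt _ _ _ => False
  | .setReal b _ _ _ => b = a
  | .seq P Q => P.WritesReal a ∨ Q.WritesReal a
  | .cond _ P Q => P.WritesReal a ∨ Q.WritesReal a
  | .loop _ _ P => P.WritesReal a

theorem exec_ivar {y : ℕ} (P : Prog) (h : ¬ P.WritesVar y) (σ : Mem) :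
    (P.exec σ).1.ivar y = σ.ivar y := by
  induction P generalizing σ with
  | skip => rfl
  | setVar x e => exact Function.update_of_ne (fun h' => h h'.symm) _ _
  | setInt a i e => rfl
  | setReal a i j e => rfl
  | seq P Q ihP ihQ =>
    simp only [Prog.WritesVar, not_or] at h
    exact (ihQ h.2 _).trans (ihP h.1 _)
  | cond b P Q ihP ihQ =>
    simp only [Prog.WritesVar, not_or] at h
    rw [Prog.exec]
    split_ifs
    · exact ihP h.1 _
    · exact ihQ h.2 _
  | loop x e P ih =>
    simp only [Prog.WritesVar, not_or] at h
    rw [Prog.exec]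
    refine List.foldlRecOn (motive := fun acc : Mem × ℕ => acc.1.ivar y = σ.ivar y) _ _ rfl ?_
    intro acc hacc t _
    exact (ih h.2 _).trans ((Function.update_of_ne (fun h' => h.1 h'.symm) _ _).trans hacc)

theorem exec_rarr {a : ℕ} (P : Prog) (h : ¬ P.WritesReal a) (σ : Mem) :
    (P.exec σ).1.rarr a = σ.rarr a := by
  induction P generalizing σ with
  | skip => rfl
  | setVar x e => rfl
  | setInt a i e => rfl
  | setReal b i j e =>
    funext u v
    have h' : ¬ a = b := fun h' => h h'.symm
    simp [Prog.exec, Mem.putReal, h']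
  | seq P Q ihP ihQ =>
    simp only [Prog.WritesReal, not_or] at h
    exact (ihQ h.2 _).trans (ihP h.1 _)
  | cond b P Q ihP ihQ =>
    simp only [Prog.WritesReal, not_or] at h
    rw [Prog.exec]
    split_ifs
    · exact ihP h.1 _
    · exact ihQ h.2 _
  | loop x e P ih =>
    rw [Prog.exec]
    refine List.foldlRecOn (motive := fun acc : Mem × ℕ => acc.1.rarr a = σ.rarr a) _ _ rfl ?_
    intro acc hacc t _
    exact (ih h _).trans hacc

/-! ### Programs that accumulate into an array -/

/-- In the context `Γ`, the program `P` adds `f` to the real array `a` within `c` steps, and the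
context remains valid. -/
def Adds (Γ : Mem → Prop) (P : Prog) (a : ℕ) (f : ℕ → ℕ → ℝ) (c : ℕ) : Prop :=
  ∀ σ, Γ σ → Γ (P.exec σ).1 ∧
    (∀ u v, (P.exec σ).1.rarr a u v = σ.rarr a u v + f u v) ∧ (P.exec σ).2 ≤ c

/-- `A[i, j] += e`. -/
def Prog.addTo (a : ℕ) (i j : IExp) (e : RExp) : Prog :=
  .setReal a i j (.add (.get a i j) e)

theorem adds_addTo {Γ : Mem → Prop} {a : ℕ} {i j : IExp} {e : RExp} {i₀ j₀ : ℕ} {w : ℝ} {c : ℕ}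
    (hi : ∀ σ, Γ σ → i.eval σ = i₀) (hj : ∀ σ, Γ σ → j.eval σ = j₀)
    (he : ∀ σ, Γ σ → e.eval σ = w) (hΓ : ∀ σ v, Γ σ → Γ (σ.putReal a i₀ j₀ v))
    (hc : ∀ σ, Γ σ → i.cost + j.cost + (i.cost + j.cost + 1 + e.cost σ + 1) + 1 ≤ c) :
    Adds Γ (.addTo a i j e) a (fun u v => if u = i₀ ∧ v = j₀ then w else 0) c := by
  intro σ hσ
  have e1 : (Prog.addTo a i j e).exec σ = (σ.putReal a i₀ j₀ (σ.rarr a i₀ j₀ + w),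
      i.cost + j.cost + (i.cost + j.cost + 1 + e.cost σ + 1) + 1) := by
    simp only [Prog.addTo, Prog.exec, RExp.eval, RExp.cost, hi σ hσ, hj σ hσ, he σ hσ]
  rw [e1]
  refine ⟨hΓ _ _ hσ, fun u v => ?_, hc σ hσ⟩
  by_cases h : u = i₀ ∧ v = j₀
  · simp [Mem.putReal, h]
  · simp [Mem.putReal, h]

/-- The context fixes everything the increments depend on and survives each iteration, so the
contributions of the iterations simply add up. -/
theorem Adds.loop {Γ : Mem → Prop} {x : ℕ} {e : IExp} {P : Prog} {a : ℕ} {f : ℕ → ℕ → ℕ → ℝ}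
    {c N : ℕ} (hN : ∀ σ, Γ σ → e.eval σ = N) (hx : ∀ σ t, Γ σ → Γ (σ.putVar x t))
    (h : ∀ t < N, Adds (fun σ => Γ σ ∧ σ.ivar x = t) P a (f t) c) :
    Adds Γ (.loop x e P) a (fun u v => ∑ t ∈ Finset.range N, f t u v)
      (e.cost + 1 + N * (c + 1)) := by
  intro σ hσ
  have := exec_loop_of_invariant (P := P) (x := x) (hN σ hσ)
    (fun t τ => Γ τ ∧ ∀ u v, τ.rarr a u v = σ.rarr a u v + ∑ t ∈ Finset.range t, f t u v) c
    ⟨hσ, by simp⟩ (fun t ht τ hτ => by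
      obtain ⟨⟨h1, -⟩, h2, h3⟩ := h t ht (τ.putVar x t) ⟨hx _ _ hτ.1, by simp⟩
      refine ⟨⟨h1, fun u v => ?_⟩, h3⟩
      rw [h2, Finset.sum_range_succ, ← add_assoc, ← hτ.2]
      rfl)
  exact ⟨this.1.1, this.1.2, this.2⟩

/-! ### The program -/

/-- `B = R Π`, in one pass over the nonzero entries. -/
def progSketch : Prog :=
  .loop 10 (.var 3) (.addTo 4 (.get 0 (.var 10)) (.get 2 (.get 1 (.var 10)))
    (.mul (.get 0 (.var 10) (.lit 0)) (.get 1 (.get 1 (.var 10)) (.lit 0))))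

/-- `G = Bᵀ B`. -/
def progGram : Prog :=
  .loop 10 (.var 2) (.loop 11 (.var 2) (.loop 12 (.var 0)
    (.addTo 5 (.var 10) (.var 11)
      (.mul (.get 4 (.var 12) (.var 10)) (.get 4 (.var 12) (.var 11))))))

/-- Replace `k` by `min k n`. -/
def progMin : Prog :=
  .cond (.ilt (.var 0) (.var 1)) (.setVar 1 (.var 0)) .skip

/-- The position of a largest diagonal entry of `G`. -/
def progPivot : Prog :=
  .seq (.setVar 11 (.lit 0)) (.loop 12 (.var 2)
    (.cond (.rlt (.get 5 (.var 11) (.var 11)) (.get 5 (.var 12) (.var 12)))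
      (.setVar 11 (.var 12)) .skip))

/-- The next column of the Cholesky factor. -/
def progColumn : Prog :=
  .loop 13 (.var 2) (.addTo 6 (.var 13) (.var 10)
    (.div (.get 5 (.var 13) (.var 11)) (.sqrt (.get 5 (.var 11) (.var 11)))))

/-- Subtract the outer square of the new column from `G`. -/
def progDowndate : Prog :=
  .loop 13 (.var 2) (.loop 14 (.var 2) (.addTo 5 (.var 13) (.var 14)
    (.mul (.sub (.lit 0) (.get 6 (.var 13) (.var 10))) (.get 6 (.var 14) (.var 10)))))

/-- Pivoted Cholesky factorization `G = L Lᵀ`. -/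
def progCholesky : Prog :=
  .loop 10 (.var 1) (.seq progPivot
    (.cond (.rlt (.lit 0) (.get 5 (.var 11) (.var 11))) (.seq progColumn progDowndate) .skip))

/-- `K = Lᵀ L`. -/
def progSmallGram : Prog :=
  .loop 10 (.var 1) (.loop 11 (.var 1) (.loop 12 (.var 2)
    (.addTo 7 (.var 10) (.var 11)
      (.mul (.get 6 (.var 12) (.var 10)) (.get 6 (.var 12) (.var 11))))))

/-- The identity matrix as the zeroth power of `K`. -/
def progOne : Prog :=
  .loop 10 (.var 1) (.addTo 8 (.var 10) (.var 10) (.lit 1))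

/-- The next power of `K`, stored below the present one. -/
def progNextPower : Prog :=
  .loop 11 (.var 1) (.loop 12 (.var 1) (.loop 13 (.var 1)
    (.addTo 8 (.add (.add (.var 20) (.var 1)) (.var 11)) (.var 12)
      (.mul (.get 8 (.add (.var 20) (.var 11)) (.var 13)) (.get 7 (.var 13) (.var 12))))))

/-- The trace of the present power of `K`. -/
def progTrace : Prog :=
  .loop 11 (.var 1) (.addTo 9 (.var 10) (.lit 0) (.get 8 (.add (.var 20) (.var 11)) (.var 11)))

/-- The traces of the powers of `K`. -/
def progPowers : Prog :=
  .seq (.setVar 20 (.lit 0)) (.seq progOne (.loop 10 (.var 1)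
    (.seq progNextPower (.seq (.setVar 20 (.add (.var 20) (.var 1))) progTrace))))

/-- One convolution in Newton's identities. -/
def progConv : Prog :=
  .loop 11 (.add (.var 10) (.lit 1)) (.addTo 12 (.var 10) (.lit 0)
    (.mul (.get 10 (.add (.sub (.var 1) (.var 10)) (.var 11)) (.lit 0)) (.get 9 (.var 11) (.lit 0))))

/-- The coefficients of the characteristic polynomial of `K`, by Newton's identities. -/
def progNewton : Prog :=
  .seq (.setReal 10 (.var 1) (.lit 0) (.lit 1)) (.loop 10 (.var 1)
    (.seq (.setReal 11 (.lit 0) (.lit 0) (.add (.get 11 (.lit 0) (.lit 0)) (.lit 1)))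
      (.seq progConv
        (.setReal 10 (.sub (.var 1) (.add (.var 10) (.lit 1))) (.lit 0)
          (.div (.sub (.lit 0) (.get 12 (.var 10) (.lit 0))) (.get 11 (.lit 0) (.lit 0)))))))

/-- The singular values and the entropy. -/
def progOutput : Prog :=
  .loop 10 (.var 1) (.seq (.setReal 2 (.var 10) (.lit 0) (.sqrt (.root 10 (.var 1) (.var 10))))
    (.addTo 3 (.lit 0) (.lit 0) (.mul (.get 2 (.var 10) (.lit 0))
      (.log (.div (.lit 1) (.get 2 (.var 10) (.lit 0)))))))

/-- The random-projection algorithm. -/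
def progMain : Prog :=
  .seq progSketch (.seq progGram (.seq progMin (.seq progCholesky (.seq progSmallGram
    (.seq progPowers (.seq progNewton progOutput))))))

/-! ### Matrix products -/

theorem progSketch_spec {σ : Mem} {z : ℕ} (hz : σ.ivar 3 = z) (h4 : σ.rarr 4 = 0) :
    (∀ u v, (progSketch.exec σ).1.rarr 4 u v = ∑ t ∈ Finset.range z,
      if u = σ.iarr 0 t ∧ v = σ.iarr 2 (σ.iarr 1 t) then
        σ.rarr 0 t 0 * σ.rarr 1 (σ.iarr 1 t) 0 else 0) ∧
    (progSketch.exec σ).2 ≤ 25 * z + 2 := by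
  have h : Adds (fun τ => τ.ivar 3 = z ∧ τ.iarr = σ.iarr ∧ τ.rarr 0 = σ.rarr 0 ∧
      τ.rarr 1 = σ.rarr 1) progSketch 4
      (fun u v => ∑ t ∈ Finset.range z, if u = σ.iarr 0 t ∧ v = σ.iarr 2 (σ.iarr 1 t) then
        σ.rarr 0 t 0 * σ.rarr 1 (σ.iarr 1 t) 0 else 0) (1 + 1 + z * (24 + 1)) := by
    refine Adds.loop (N := z) (c := 24) (f := fun t u v =>
      if u = σ.iarr 0 t ∧ v = σ.iarr 2 (σ.iarr 1 t) then
        σ.rarr 0 t 0 * σ.rarr 1 (σ.iarr 1 t) 0 else 0) ?_ ?_ fun t ht => ?_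
    · rintro τ ⟨h, -⟩; exact h
    · rintro τ t ⟨h1, h2⟩; exact ⟨by simpa using h1, h2⟩
    · refine adds_addTo ?_ ?_ ?_ ?_ ?_
      · rintro τ ⟨⟨-, h2, -⟩, h⟩; simp [IExp.eval, h, h2]
      · rintro τ ⟨⟨-, h2, -⟩, h⟩; simp [IExp.eval, h, h2]
      · rintro τ ⟨⟨-, h2, h3, h4⟩, h⟩; simp [IExp.eval, RExp.eval, h, h2, h3, h4]
      · rintro τ v ⟨⟨h1, h2, h3, h4⟩, h⟩
        refine ⟨⟨h1, h2, ?_, ?_⟩, h⟩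
        · rw [← h3, Mem.rarr_putReal_of_ne _ (by norm_num)]
        · rw [← h4, Mem.rarr_putReal_of_ne _ (by norm_num)]
      · intro τ _; simp [IExp.cost, RExp.cost]
  obtain ⟨-, h1, h2⟩ := h σ ⟨hz, rfl, rfl, rfl⟩
  refine ⟨fun u v => ?_, h2.trans ?_⟩
  · rw [h1, h4]; simp
  · omega

/-- Three nested loops that form a Gram matrix `out = Aᵀ A`. -/
theorem gram_spec {σ : Mem} {src out va vb N m : ℕ} (hso : src ≠ out) (hva : va < 10)
    (hvb : vb < 10) (hN : σ.ivar va = N) (hm : σ.ivar vb = m) (hout : σ.rarr out = 0) :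
    let P : Prog := .loop 10 (.var va) (.loop 11 (.var va) (.loop 12 (.var vb)
      (.addTo out (.var 10) (.var 11)
        (.mul (.get src (.var 12) (.var 10)) (.get src (.var 12) (.var 11))))))
    (∀ u < N, ∀ v < N, (P.exec σ).1.rarr out u v =
      ∑ i ∈ Finset.range m, σ.rarr src i u * σ.rarr src i v) ∧
    (P.exec σ).2 ≤ 2 + N * (3 + N * (3 + m * 15)) := by
  intro P
  have h : Adds (fun τ => τ.ivar va = N ∧ τ.ivar vb = m ∧ τ.rarr src = σ.rarr src) P out
      (fun u v => ∑ a ∈ Finset.range N, ∑ b ∈ Finset.range N, ∑ i ∈ Finset.range m,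
        if u = a ∧ v = b then σ.rarr src i a * σ.rarr src i b else 0)
      (1 + 1 + N * (1 + 1 + N * (1 + 1 + m * (14 + 1) + 1) + 1)) := by
    refine Adds.loop (N := N) (c := 1 + 1 + N * (1 + 1 + m * (14 + 1) + 1))
      (f := fun a u v => ∑ b ∈ Finset.range N, ∑ i ∈ Finset.range m,
        if u = a ∧ v = b then σ.rarr src i a * σ.rarr src i b else 0) ?_ ?_ fun a _ => ?_
    · rintro τ ⟨h, -⟩; exact h
    · rintro τ t ⟨h1, h2, h3⟩
      refine ⟨?_, ?_, h3⟩
      · rw [← h1, Mem.ivar_putVar, if_neg (by omega)]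
      · rw [← h2, Mem.ivar_putVar, if_neg (by omega)]
    refine Adds.loop (N := N) (c := 1 + 1 + m * (14 + 1)) ?_ ?_ fun b _ => ?_
    · rintro τ ⟨⟨h, -⟩, -⟩; exact h
    · rintro τ t ⟨⟨h1, h2, h3⟩, h4⟩
      refine ⟨⟨?_, ?_, h3⟩, ?_⟩
      · rw [← h1, Mem.ivar_putVar, if_neg (by omega)]
      · rw [← h2, Mem.ivar_putVar, if_neg (by omega)]
      · rw [← h4, Mem.ivar_putVar, if_neg (by omega)]
    refine Adds.loop (N := m) (c := 14) ?_ ?_ fun i _ => ?_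
    · rintro τ ⟨⟨⟨-, h, -⟩, -⟩, -⟩; exact h
    · rintro τ t ⟨⟨⟨h1, h2, h3⟩, h4⟩, h5⟩
      refine ⟨⟨⟨?_, ?_, h3⟩, ?_⟩, ?_⟩
      · rw [← h1, Mem.ivar_putVar, if_neg (by omega)]
      · rw [← h2, Mem.ivar_putVar, if_neg (by omega)]
      · rw [← h4, Mem.ivar_putVar, if_neg (by omega)]
      · rw [← h5, Mem.ivar_putVar, if_neg (by omega)]
    refine adds_addTo ?_ ?_ ?_ ?_ ?_
    · rintro τ ⟨⟨⟨-, h4⟩, h5⟩, h6⟩; exact h4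
    · rintro τ ⟨⟨⟨-, h4⟩, h5⟩, h6⟩; exact h5
    · rintro τ ⟨⟨⟨⟨-, -, h3⟩, h4⟩, h5⟩, h6⟩
      simp [IExp.eval, RExp.eval, h3, h4, h5, h6]
    · rintro τ v ⟨⟨⟨⟨h1, h2, h3⟩, h4⟩, h5⟩, h6⟩
      refine ⟨⟨⟨⟨h1, h2, ?_⟩, h4⟩, h5⟩, h6⟩
      rw [← h3, Mem.rarr_putReal_of_ne _ hso]
    · intro τ _; simp [IExp.cost, RExp.cost]
  obtain ⟨-, h1, h2⟩ := h σ ⟨hN, hm, rfl⟩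
  refine ⟨fun u hu v hv => ?_, h2.trans ?_⟩
  · rw [h1, hout, Pi.zero_apply, Pi.zero_apply, zero_add]
    show ∑ a ∈ Finset.range N, _ = _
    rw [Finset.sum_eq_single_of_mem u (Finset.mem_range.2 hu),
      Finset.sum_eq_single_of_mem v (Finset.mem_range.2 hv)]
    · simp
    · intro b _ hb; simp [hb.symm]
    · intro b _ hb; simp [hb.symm]
  · apply le_of_eq; ring

/-! ### Pivoted Cholesky factorization -/

theorem dotProduct_mulVec_comm_of_isSymm {I : Type*} [Fintype I] {G : Matrix I I ℝ} (hG : Gᵀ = G)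
    (x y : I → ℝ) : x ⬝ᵥ (G *ᵥ y) = y ⬝ᵥ (G *ᵥ x) := by
  rw [Matrix.dotProduct_mulVec, ← Matrix.mulVec_transpose, hG, dotProduct_comm]

/-- With `e` the basis vector at the pivot, `l ⬝ᵥ x = (e ⬝ᵥ G x) / √(G p p)`. Hence the new form at
`x` is the old one at `x` minus its `G`-projection onto `e`, which is nonnegative. The kernel of `G`
is preserved and `e` is a new kernel vector, so the rank drops. -/
theorem cholesky_step {I : Type*} [Fintype I] [DecidableEq I] {G : Matrix I I ℝ}
    (hG : G.PosSemidef) {p : I} (hp : 0 < G p p) {l : I → ℝ} (hl : ∀ u, l u = G u p / √(G p p)) :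
    (G - Matrix.vecMulVec l l).PosSemidef ∧ (G - Matrix.vecMulVec l l).rank + 1 ≤ G.rank := by
  have hsym : Gᵀ = G := by simpa [Matrix.IsHermitian] using hG.isHermitian
  set e : I → ℝ := Pi.single p 1 with he
  have hcol : ∀ u, (G *ᵥ e) u = G u p := by intro u; simp [he]
  have hepp : e ⬝ᵥ (G *ᵥ e) = G p p := by
    rw [he, single_dotProduct, one_mul]; exact hcol p
  have hsq : √(G p p) * √(G p p) = G p p := Real.mul_self_sqrt hp.le
  have hlx : ∀ x, l ⬝ᵥ x = (e ⬝ᵥ (G *ᵥ x)) / √(G p p) := by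
    intro x
    rw [dotProduct_mulVec_comm_of_isSymm hsym, dotProduct_comm]
    simp only [dotProduct, hl, hcol, Finset.sum_div]
    refine Finset.sum_congr rfl fun u _ => ?_
    ring
  have hmul : ∀ x, (G - Matrix.vecMulVec l l) *ᵥ x = G *ᵥ x - (l ⬝ᵥ x) • l := by
    intro x
    rw [Matrix.sub_mulVec, Matrix.vecMulVec_mulVec]
    simp
  have hmul_e : (G - Matrix.vecMulVec l l) *ᵥ e = 0 := by
    rw [hmul, hlx, hepp]
    funext u
    simp only [Pi.sub_apply, Pi.smul_apply, Pi.zero_apply, smul_eq_mul, hcol, hl]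
    field_simp
    rw [sq, hsq]
    ring
  constructor
  · refine Matrix.PosSemidef.of_dotProduct_mulVec_nonneg ?_ fun x => ?_
    · simp [Matrix.IsHermitian, Matrix.transpose_sub, hsym, Matrix.transpose_vecMulVec]
    · have h1 := hG.dotProduct_mulVec_nonneg (x - (e ⬝ᵥ (G *ᵥ x) / G p p) • e)
      simp only [star_trivial] at h1 ⊢
      rw [hmul, dotProduct_sub, dotProduct_smul, dotProduct_comm x l, hlx, smul_eq_mul,
        div_mul_div_comm, hsq]
      have h2 : (x - (e ⬝ᵥ (G *ᵥ x) / G p p) • e) ⬝ᵥ (G *ᵥ (x - (e ⬝ᵥ (G *ᵥ x) / G p p) • e)) =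
          x ⬝ᵥ (G *ᵥ x) - e ⬝ᵥ (G *ᵥ x) * e ⬝ᵥ (G *ᵥ x) / G p p := by
        rw [Matrix.mulVec_sub, Matrix.mulVec_smul]
        simp only [dotProduct_sub, sub_dotProduct, dotProduct_smul, smul_dotProduct, smul_eq_mul,
          hepp, dotProduct_mulVec_comm_of_isSymm hsym x e]
        field_simp
        ring
      rw [h2] at h1
      exact h1
  · have hker : LinearMap.ker G.mulVecLin < LinearMap.ker (G - Matrix.vecMulVec l l).mulVecLin := by
      refine lt_of_le_of_ne (fun x hx => ?_) fun heq => ?_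
      · rw [LinearMap.mem_ker, Matrix.mulVecLin_apply] at hx ⊢
        rw [hmul, hlx, hx]
        simp
      · have : e ∈ LinearMap.ker G.mulVecLin := by
          rw [heq, LinearMap.mem_ker, Matrix.mulVecLin_apply, hmul_e]
        rw [LinearMap.mem_ker, Matrix.mulVecLin_apply] at this
        have h3 := hcol p
        rw [this] at h3
        exact hp.ne h3
    have h1 := Submodule.finrank_lt_finrank_of_lt hker
    have h2 := G.mulVecLin.finrank_range_add_finrank_ker
    have h3 := (G - Matrix.vecMulVec l l).mulVecLin.finrank_range_add_finrank_ker
    unfold Matrix.rank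
    omega

theorem eq_zero_of_diag_nonpos {I : Type*} [Fintype I] [DecidableEq I] {G : Matrix I I ℝ}
    (hG : G.PosSemidef) (h : ∀ j, G j j ≤ 0) : G = 0 := by
  rw [← hG.trace_eq_zero_iff, Matrix.trace]
  exact Finset.sum_eq_zero fun j _ => le_antisymm (h j) hG.diag_nonneg

theorem progPivot_spec {σ : Mem} {s : ℕ} (hs : σ.ivar 2 = s) (hs0 : 0 < s) :
    (progPivot.exec σ).1.ivar 11 < s ∧
    (∀ j < s, σ.rarr 5 j j ≤
      σ.rarr 5 ((progPivot.exec σ).1.ivar 11) ((progPivot.exec σ).1.ivar 11)) ∧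
    (progPivot.exec σ).2 ≤ 10 * s + 4 := by
  set σ₁ := σ.putVar 11 0 with hσ₁
  have h := exec_loop_of_invariant (σ := σ₁) (x := 12) (e := .var 2) (N := s)
    (P := .cond (.rlt (.get 5 (.var 11) (.var 11)) (.get 5 (.var 12) (.var 12)))
      (.setVar 11 (.var 12)) .skip)
    (by simp [IExp.eval, hσ₁, hs])
    (fun t τ => τ.ivar 11 < s ∧ τ.rarr = σ.rarr ∧
      ∀ j < t, σ.rarr 5 j j ≤ σ.rarr 5 (τ.ivar 11) (τ.ivar 11)) 9
    ⟨by simpa [hσ₁] using hs0, rfl, by simp⟩ (by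
      rintro t ht τ ⟨h1, h2, h3⟩
      rw [Prog.exec]
      have hb : BExp.Holds (τ.putVar 12 t)
          (.rlt (.get 5 (.var 11) (.var 11)) (.get 5 (.var 12) (.var 12))) ↔
          σ.rarr 5 (τ.ivar 11) (τ.ivar 11) < σ.rarr 5 t t := by
        simp [BExp.Holds, RExp.eval, IExp.eval, h2]
      split_ifs with hlt
      · rw [hb] at hlt
        refine ⟨⟨by simpa [Prog.exec, IExp.eval] using ht, h2, fun j hj => ?_⟩, ?_⟩
        · simp only [Prog.exec, IExp.eval, Mem.ivar_putVar, if_true]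
          rcases Nat.lt_succ_iff_lt_or_eq.1 hj with hj | rfl
          · exact (h3 j hj).trans hlt.le
          · exact le_rfl
        · simp [Prog.exec, BExp.cost, RExp.cost, IExp.cost]
      · rw [hb, not_lt] at hlt
        refine ⟨⟨by simpa [Prog.exec] using h1, h2, fun j hj => ?_⟩, ?_⟩
        · simp only [Prog.exec, Mem.ivar_putVar]
          rcases Nat.lt_succ_iff_lt_or_eq.1 hj with hj | rfl
          · exact h3 j hj
          · exact hlt
        · simp [Prog.exec, BExp.cost, RExp.cost, IExp.cost])
  obtain ⟨⟨h1, h2, h3⟩, h4⟩ := h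
  refine ⟨h1, h3, ?_⟩
  have e : (progPivot.exec σ).2 = 2 + ((Prog.loop 12 (.var 2)
    (.cond (.rlt (.get 5 (.var 11) (.var 11)) (.get 5 (.var 12) (.var 12)))
      (.setVar 11 (.var 12)) .skip)).exec σ₁).2 := rfl
  rw [e]
  simp only [IExp.cost] at h4
  omega

theorem progColumn_spec {σ : Mem} {s : ℕ} (hs : σ.ivar 2 = s) :
    (∀ u v, (progColumn.exec σ).1.rarr 6 u v = σ.rarr 6 u v + if u < s ∧ v = σ.ivar 10 then
      σ.rarr 5 u (σ.ivar 11) / √(σ.rarr 5 (σ.ivar 11) (σ.ivar 11)) else 0) ∧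
    (progColumn.exec σ).2 ≤ 20 * s + 2 := by
  have h : Adds (fun τ => τ.ivar 2 = s ∧ τ.ivar 10 = σ.ivar 10 ∧ τ.ivar 11 = σ.ivar 11 ∧
      τ.rarr 5 = σ.rarr 5) progColumn 6
      (fun u v => ∑ t ∈ Finset.range s, if u = t ∧ v = σ.ivar 10 then
        σ.rarr 5 t (σ.ivar 11) / √(σ.rarr 5 (σ.ivar 11) (σ.ivar 11)) else 0)
      (1 + 1 + s * (19 + 1)) := by
    refine Adds.loop (N := s) (c := 19) ?_ ?_ fun t ht => ?_
    · rintro τ ⟨h, -⟩; exact h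
    · rintro τ t ⟨h1, h2, h3, h4⟩
      exact ⟨by simpa using h1, by simpa using h2, by simpa using h3, h4⟩
    · refine adds_addTo ?_ ?_ ?_ ?_ ?_
      · rintro τ ⟨⟨-, h2, h3, h4⟩, h⟩; exact h
      · rintro τ ⟨⟨-, h2, h3, h4⟩, h⟩; exact h2
      · rintro τ ⟨⟨-, h2, h3, h4⟩, h⟩; simp [IExp.eval, RExp.eval, h, h3, h4]
      · rintro τ v ⟨⟨h1, h2, h3, h4⟩, h⟩
        refine ⟨⟨h1, h2, h3, ?_⟩, h⟩
        rw [← h4, Mem.rarr_putReal_of_ne _ (by norm_num)]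
      · intro τ _; simp [IExp.cost, RExp.cost]
  obtain ⟨-, h1, h2⟩ := h σ ⟨hs, rfl, rfl, rfl⟩
  refine ⟨fun u v => ?_, by omega⟩
  rw [h1]
  congr 1
  by_cases hv : v = σ.ivar 10
  · by_cases hu : u < s
    · show ∑ t ∈ Finset.range s, _ = _
      rw [Finset.sum_eq_single_of_mem u (Finset.mem_range.2 hu)]
      · simp [hv, hu]
      · intro b _ hb; simp [hb.symm]
    · rw [if_neg (by tauto)]
      refine Finset.sum_eq_zero fun t ht => if_neg ?_
      rintro ⟨rfl, -⟩
      exact hu (Finset.mem_range.1 ht)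
  · simp [hv]

theorem progDowndate_spec {σ : Mem} {s : ℕ} (hs : σ.ivar 2 = s) :
    (∀ u < s, ∀ v < s, (progDowndate.exec σ).1.rarr 5 u v =
      σ.rarr 5 u v - σ.rarr 6 u (σ.ivar 10) * σ.rarr 6 v (σ.ivar 10)) ∧
    (progDowndate.exec σ).2 ≤ 2 + s * (3 + s * 17) := by
  have h : Adds (fun τ => τ.ivar 2 = s ∧ τ.ivar 10 = σ.ivar 10 ∧ τ.rarr 6 = σ.rarr 6)
      progDowndate 5
      (fun u v => ∑ a ∈ Finset.range s, ∑ b ∈ Finset.range s, if u = a ∧ v = b then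
        (0 - σ.rarr 6 a (σ.ivar 10)) * σ.rarr 6 b (σ.ivar 10) else 0)
      (1 + 1 + s * (1 + 1 + s * (16 + 1) + 1)) := by
    refine Adds.loop (N := s) (c := 1 + 1 + s * (16 + 1))
      (f := fun a u v => ∑ b ∈ Finset.range s, if u = a ∧ v = b then
        (0 - σ.rarr 6 a (σ.ivar 10)) * σ.rarr 6 b (σ.ivar 10) else 0) ?_ ?_ fun a _ => ?_
    · rintro τ ⟨h, -⟩; exact h
    · rintro τ t ⟨h1, h2, h4⟩
      exact ⟨by simpa using h1, by simpa using h2, h4⟩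
    refine Adds.loop (N := s) (c := 16) ?_ ?_ fun b _ => ?_
    · rintro τ ⟨⟨h, -⟩, -⟩; exact h
    · rintro τ t ⟨⟨h1, h2, h4⟩, h5⟩
      exact ⟨⟨by simpa using h1, by simpa using h2, h4⟩, by simpa using h5⟩
    refine adds_addTo ?_ ?_ ?_ ?_ ?_
    · rintro τ ⟨⟨⟨-, h2, h3⟩, h4⟩, h⟩; exact h4
    · rintro τ ⟨⟨⟨-, h2, h3⟩, h4⟩, h⟩; exact h
    · rintro τ ⟨⟨⟨-, h2, h3⟩, h4⟩, h⟩; simp [IExp.eval, RExp.eval, h, h2, h3, h4]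
    · rintro τ v ⟨⟨⟨h1, h2, h3⟩, h4⟩, h⟩
      refine ⟨⟨⟨h1, h2, ?_⟩, h4⟩, h⟩
      rw [← h3, Mem.rarr_putReal_of_ne _ (by norm_num)]
    · intro τ _; simp [IExp.cost, RExp.cost]
  obtain ⟨-, h1, h2⟩ := h σ ⟨hs, rfl, rfl⟩
  refine ⟨fun u hu v hv => ?_, h2.trans (le_of_eq (by ring))⟩
  rw [h1, sub_eq_add_neg]
  congr 1
  show ∑ a ∈ Finset.range s, _ = _
  rw [Finset.sum_eq_single_of_mem u (Finset.mem_range.2 hu),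
    Finset.sum_eq_single_of_mem v (Finset.mem_range.2 hv)]
  · simp
  · intro b _ hb; simp [hb.symm]
  · intro b _ hb; simp [hb.symm]

/-- The state of the factorization after `t` columns: a positive semidefinite remainder whose rank
has dropped by `t`. -/
structure CholeskyState (s k : ℕ) (G : Matrix (Fin s) (Fin s) ℝ) (t : ℕ) (τ : Mem) : Prop where
  var_k : τ.ivar 1 = k
  var_s : τ.ivar 2 = s
  remainder : ∃ G' : Matrix (Fin s) (Fin s) ℝ, G'.PosSemidef ∧ G'.rank ≤ k - t ∧
    (∀ u v : Fin s, τ.rarr 5 u v = G' u v) ∧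
    ∀ u v : Fin s, G u v = G' u v + ∑ q ∈ Finset.range t, τ.rarr 6 u q * τ.rarr 6 v q
  unused : ∀ u q, t ≤ q → τ.rarr 6 u q = 0

theorem cholesky_body_spec {s k t : ℕ} (hs0 : 0 < s) {G : Matrix (Fin s) (Fin s) ℝ} {τ : Mem}
    (h : CholeskyState s k G t τ) (h10 : τ.ivar 10 = t) :
    let P := Prog.seq progPivot
      (.cond (.rlt (.lit 0) (.get 5 (.var 11) (.var 11))) (.seq progColumn progDowndate) .skip)
    CholeskyState s k G (t + 1) (P.exec τ).1 ∧ (P.exec τ).2 ≤ 70 * s ^ 2 := by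
  intro P
  obtain ⟨hk, hs, ⟨G', hps, hrank, hent, hG⟩, hun⟩ := h
  obtain ⟨hp1, hp2, hp3⟩ := progPivot_spec hs hs0
  set τ₁ := (progPivot.exec τ).1 with hτ₁
  have e1 : τ₁.rarr = τ.rarr := by
    funext a
    exact exec_rarr _ (by simp [progPivot, Prog.WritesReal]) _
  have v1 : τ₁.ivar 1 = k := by
    rw [← hk]; exact exec_ivar _ (by simp [progPivot, Prog.WritesVar]) _
  have v2 : τ₁.ivar 2 = s := by
    rw [← hs]; exact exec_ivar _ (by simp [progPivot, Prog.WritesVar]) _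
  have v10 : τ₁.ivar 10 = t := by
    rw [← h10]; exact exec_ivar _ (by simp [progPivot, Prog.WritesVar]) _
  set p : Fin s := ⟨τ₁.ivar 11, hp1⟩ with hp
  have hpv : τ₁.ivar 11 = p := rfl
  have hgp : τ₁.rarr 5 (τ₁.ivar 11) (τ₁.ivar 11) = G' p p := by
    rw [e1, ← hent p p]
  have hexec : P.exec τ = (((Prog.cond (.rlt (.lit 0) (.get 5 (.var 11) (.var 11)))
      (.seq progColumn progDowndate) .skip).exec τ₁).1, (progPivot.exec τ).2 +
      ((Prog.cond (.rlt (.lit 0) (.get 5 (.var 11) (.var 11)))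
      (.seq progColumn progDowndate) .skip).exec τ₁).2) := rfl
  have hb : BExp.Holds τ₁ (.rlt (.lit 0) (.get 5 (.var 11) (.var 11))) ↔ 0 < G' p p := by
    rw [← hgp]; simp [BExp.Holds, RExp.eval, IExp.eval]
  have hbc : BExp.cost τ₁ (.rlt (.lit 0) (.get 5 (.var 11) (.var 11))) = 5 := rfl
  have hss : s ≤ s ^ 2 := by nlinarith
  rw [hexec, Prog.exec]
  split_ifs with hpos
  · rw [hb] at hpos
    obtain ⟨c1, c2⟩ := progColumn_spec v2
    set τ₂ := (progColumn.exec τ₁).1 with hτ₂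
    have w1 : τ₂.ivar 1 = k := by
      rw [← v1]; exact exec_ivar _ (by simp [progColumn, Prog.addTo, Prog.WritesVar]) _
    have w2 : τ₂.ivar 2 = s := by
      rw [← v2]; exact exec_ivar _ (by simp [progColumn, Prog.addTo, Prog.WritesVar]) _
    have w10 : τ₂.ivar 10 = t := by
      rw [← v10]; exact exec_ivar _ (by simp [progColumn, Prog.addTo, Prog.WritesVar]) _
    have f5 : τ₂.rarr 5 = τ.rarr 5 := by
      rw [← e1]; exact exec_rarr _ (by simp [progColumn, Prog.addTo, Prog.WritesReal]) _
    obtain ⟨d1, d2⟩ := progDowndate_spec w2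
    set τ₃ := (progDowndate.exec τ₂).1 with hτ₃
    have x1 : τ₃.ivar 1 = k := by
      rw [← w1]; exact exec_ivar _ (by simp [progDowndate, Prog.addTo, Prog.WritesVar]) _
    have x2 : τ₃.ivar 2 = s := by
      rw [← w2]; exact exec_ivar _ (by simp [progDowndate, Prog.addTo, Prog.WritesVar]) _
    have f6 : τ₃.rarr 6 = τ₂.rarr 6 :=
      exec_rarr _ (by simp [progDowndate, Prog.addTo, Prog.WritesReal]) _
    set l : Fin s → ℝ := fun u => τ₂.rarr 6 u t with hl
    have hl' : ∀ u, l u = G' u p / √(G' p p) := by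
      intro u
      simp only [hl]
      rw [c1, hgp, e1, v10, hun u t le_rfl, hpv, hent u p]
      simp
    have hold : ∀ u : Fin s, ∀ q < t, τ₂.rarr 6 u q = τ.rarr 6 u q := by
      intro u q hq
      rw [c1, e1, v10, if_neg (by omega), add_zero]
    obtain ⟨g1, g2⟩ := cholesky_step hps hpos hl'
    refine ⟨⟨x1, x2, ⟨G' - Matrix.vecMulVec l l, g1, by omega, fun u v => ?_, fun u v => ?_⟩,
      fun u q hq => ?_⟩, ?_⟩
    · show τ₃.rarr 5 u v = _
      rw [d1 u u.2 v v.2, f5, hent, w10]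
      simp [Matrix.vecMulVec_apply, hl]
    · show G u v = _ + ∑ q ∈ Finset.range (t + 1), τ₃.rarr 6 u q * τ₃.rarr 6 v q
      have hsum : ∑ q ∈ Finset.range t, τ₂.rarr 6 u q * τ₂.rarr 6 v q =
          ∑ q ∈ Finset.range t, τ.rarr 6 u q * τ.rarr 6 v q :=
        Finset.sum_congr rfl fun q hq => by
          rw [hold u q (Finset.mem_range.1 hq), hold v q (Finset.mem_range.1 hq)]
      rw [Finset.sum_range_succ, hG, f6, hsum]
      simp only [Matrix.sub_apply, Matrix.vecMulVec_apply, hl]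
      ring
    · show τ₃.rarr 6 u q = 0
      rw [f6, c1, e1, v10, if_neg (by omega), hun u q (by omega), add_zero]
    · simp only [Prog.exec]
      rw [hbc, ← hτ₂]
      have hmul : s * (3 + s * 17) = 3 * s + 17 * s ^ 2 := by ring
      omega
  · rw [hb, not_lt] at hpos
    -- The pivot is a largest diagonal entry, so no diagonal entry is positive. The factorization is
    -- already complete, and column `t` stays zero.
    have hz : G' = 0 := by
      refine eq_zero_of_diag_nonpos hps fun j => ?_
      have := hp2 j j.2
      rw [hpv, hent, hent] at this
      exact this.trans hpos
    refine ⟨⟨v1, v2, ⟨0, Matrix.PosSemidef.zero, by simp, fun u v => ?_, fun u v => ?_⟩,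
      fun u q hq => ?_⟩, ?_⟩
    · show τ₁.rarr 5 u v = _
      rw [e1, hent, hz]
    · show G u v = _ + ∑ q ∈ Finset.range (t + 1), τ₁.rarr 6 u q * τ₁.rarr 6 v q
      rw [Finset.sum_range_succ, hG, e1, hz, hun u t le_rfl]
      simp
    · show τ₁.rarr 6 u q = 0
      rw [e1, hun u q (by omega)]
    · simp only [Prog.exec]
      rw [hbc]
      omega

theorem progCholesky_spec {s k : ℕ} (hs0 : 0 < s) {G : Matrix (Fin s) (Fin s) ℝ}
    (hG : G.PosSemidef) (hr : G.rank ≤ k) {σ : Mem} (hk : σ.ivar 1 = k) (hs : σ.ivar 2 = s)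
    (h5 : ∀ u v : Fin s, σ.rarr 5 u v = G u v) (h6 : σ.rarr 6 = 0) :
    (∀ u v : Fin s, G u v = ∑ q ∈ Finset.range k,
      (progCholesky.exec σ).1.rarr 6 u q * (progCholesky.exec σ).1.rarr 6 v q) ∧
    (progCholesky.exec σ).2 ≤ 2 + k * (70 * s ^ 2 + 1) := by
  have h := exec_loop_of_invariant (σ := σ) (x := 10) (e := .var 1) (N := k)
    (P := .seq progPivot
      (.cond (.rlt (.lit 0) (.get 5 (.var 11) (.var 11))) (.seq progColumn progDowndate) .skip))
    hk (CholeskyState s k G) (70 * s ^ 2)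
    ⟨hk, hs, ⟨G, hG, by simpa using hr, h5, by simp⟩, by simp [h6]⟩ (by
      rintro t ht τ ⟨h1, h2, h3, h4⟩
      exact cholesky_body_spec hs0 ⟨by simpa using h1, by simpa using h2, h3, h4⟩ (by simp))
  obtain ⟨⟨-, -, ⟨G', -, hrank, -, hfin⟩, -⟩, hcost⟩ := h
  refine ⟨fun u v => ?_, hcost⟩
  -- Each round lowers the bound on the rank by one, so after `k` rounds it is `0`.
  have : G' = 0 := by
    rw [Nat.sub_self, Nat.le_zero, Matrix.rank, Submodule.finrank_eq_zero,
      LinearMap.range_eq_bot] at hrank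
    ext i j
    have := congrFun (LinearMap.congr_fun hrank (Pi.single j 1)) i
    simpa using this
  rw [hfin, this, Matrix.zero_apply, zero_add]
  rfl

/-! ### Traces of powers -/

theorem progOne_spec {σ : Mem} {k : ℕ} (hk : σ.ivar 1 = k) :
    (∀ u v, (progOne.exec σ).1.rarr 8 u v =
      σ.rarr 8 u v + if u < k ∧ v = u then 1 else 0) ∧ (progOne.exec σ).2 ≤ 2 + k * 9 := by
  have h : Adds (fun τ => τ.ivar 1 = k) progOne 8
      (fun u v => ∑ t ∈ Finset.range k, if u = t ∧ v = t then 1 else 0) (1 + 1 + k * (8 + 1)) := by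
    refine Adds.loop (N := k) (c := 8) ?_ ?_ fun t ht => ?_
    · intro τ h; exact h
    · intro τ t h; simpa using h
    · refine adds_addTo ?_ ?_ ?_ ?_ ?_
      · rintro τ ⟨-, h⟩; exact h
      · rintro τ ⟨-, h⟩; exact h
      · rintro τ ⟨-, h⟩; simp [RExp.eval]
      · rintro τ v ⟨h, h'⟩; exact ⟨h, h'⟩
      · intro τ _; simp [IExp.cost, RExp.cost]
  obtain ⟨-, h1, h2⟩ := h σ hk
  refine ⟨fun u v => ?_, by omega⟩
  rw [h1]
  congr 1
  by_cases hu : u < k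
  · show ∑ t ∈ Finset.range k, _ = _
    rw [Finset.sum_eq_single_of_mem u (Finset.mem_range.2 hu)]
    · simp [hu]
    · intro b _ hb; simp [hb.symm]
  · rw [if_neg (by tauto)]
    refine Finset.sum_eq_zero fun t ht => if_neg ?_
    rintro ⟨rfl, -⟩
    exact hu (Finset.mem_range.1 ht)

/-- Successive powers occupy consecutive blocks of `k` rows. The block being read is disjoint from
the one being written, so accumulation in place does not disturb the factors. -/
theorem progNextPower_spec {σ : Mem} {k o : ℕ} (hk : σ.ivar 1 = k) (ho : σ.ivar 20 = o) :
    (∀ u < k, ∀ v < k, (progNextPower.exec σ).1.rarr 8 (o + k + u) v =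
      σ.rarr 8 (o + k + u) v + ∑ l ∈ Finset.range k, σ.rarr 8 (o + u) l * σ.rarr 7 l v) ∧
    (∀ w v, o + k + k ≤ w → (progNextPower.exec σ).1.rarr 8 w v = σ.rarr 8 w v) ∧
    (progNextPower.exec σ).2 ≤ 2 + k * (3 + k * (3 + k * 25)) := by
  have h : Adds (fun τ => τ.ivar 1 = k ∧ τ.ivar 20 = o ∧ τ.rarr 7 = σ.rarr 7 ∧
      ∀ u < k, ∀ v, τ.rarr 8 (o + u) v = σ.rarr 8 (o + u) v) progNextPower 8
      (fun u v => ∑ i ∈ Finset.range k, ∑ j ∈ Finset.range k, ∑ l ∈ Finset.range k,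
        if u = o + k + i ∧ v = j then σ.rarr 8 (o + i) l * σ.rarr 7 l j else 0)
      (1 + 1 + k * (1 + 1 + k * (1 + 1 + k * (24 + 1) + 1) + 1)) := by
    refine Adds.loop (N := k) (c := 1 + 1 + k * (1 + 1 + k * (24 + 1) + 1))
      (f := fun i u v => ∑ j ∈ Finset.range k, ∑ l ∈ Finset.range k,
        if u = o + k + i ∧ v = j then σ.rarr 8 (o + i) l * σ.rarr 7 l j else 0)
      ?_ ?_ fun i hi => ?_
    · rintro τ ⟨h, -⟩; exact h
    · rintro τ t ⟨h1, h2, h3⟩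
      exact ⟨by simpa using h1, by simpa using h2, h3⟩
    refine Adds.loop (N := k) (c := 1 + 1 + k * (24 + 1))
      (f := fun j u v => ∑ l ∈ Finset.range k,
        if u = o + k + i ∧ v = j then σ.rarr 8 (o + i) l * σ.rarr 7 l j else 0)
      ?_ ?_ fun j hj => ?_
    · rintro τ ⟨⟨h, -⟩, -⟩; exact h
    · rintro τ t ⟨⟨h1, h2, h3⟩, h4⟩
      exact ⟨⟨by simpa using h1, by simpa using h2, h3⟩, by simpa using h4⟩
    refine Adds.loop (N := k) (c := 24) ?_ ?_ fun l hl => ?_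
    · rintro τ ⟨⟨⟨h, -⟩, -⟩, -⟩; exact h
    · rintro τ t ⟨⟨⟨h1, h2, h3⟩, h4⟩, h5⟩
      exact ⟨⟨⟨by simpa using h1, by simpa using h2, h3⟩, by simpa using h4⟩, by simpa using h5⟩
    refine adds_addTo ?_ ?_ ?_ ?_ ?_
    · rintro τ ⟨⟨⟨⟨h1, h2, h3⟩, h4⟩, h5⟩, h6⟩
      simp [IExp.eval, h1, h2, h4]
    · rintro τ ⟨⟨-, h5⟩, -⟩; exact h5
    · rintro τ ⟨⟨⟨⟨h1, h2, h3, h3'⟩, h4⟩, h5⟩, h6⟩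
      simp [IExp.eval, RExp.eval, h2, h3, h4, h5, h6, h3' i hi]
    · rintro τ v ⟨⟨⟨⟨h1, h2, h3, h3'⟩, h4⟩, h5⟩, h6⟩
      refine ⟨⟨⟨⟨h1, h2, ?_, fun u hu v' => ?_⟩, h4⟩, h5⟩, h6⟩
      · rw [← h3, Mem.rarr_putReal_of_ne _ (by norm_num)]
      · rw [Mem.rarr_putReal, if_neg (by omega), h3' u hu]
    · intro τ _; simp [IExp.cost, RExp.cost]
  obtain ⟨-, h1, h2⟩ := h σ ⟨hk, ho, rfl, fun _ _ _ => rfl⟩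
  refine ⟨fun u hu v hv => ?_, fun w v hw => ?_, h2.trans (le_of_eq (by ring))⟩
  · rw [h1]
    congr 1
    show ∑ i ∈ Finset.range k, _ = _
    rw [Finset.sum_eq_single_of_mem u (Finset.mem_range.2 hu),
      Finset.sum_eq_single_of_mem v (Finset.mem_range.2 hv)]
    · simp
    · intro b _ hb; simp [hb.symm]
    · intro b _ hb
      have : ¬ u = b := fun h => hb h.symm
      simp [this]
  · rw [h1]
    simp only [add_eq_left]
    refine Finset.sum_eq_zero fun i hi => Finset.sum_eq_zero fun j _ =>
      Finset.sum_eq_zero fun l _ => if_neg ?_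
    have := Finset.mem_range.1 hi
    omega

theorem progTrace_spec {σ : Mem} {k o m : ℕ} (hk : σ.ivar 1 = k) (ho : σ.ivar 20 = o)
    (hm : σ.ivar 10 = m) :
    (∀ q, (progTrace.exec σ).1.rarr 9 q 0 = σ.rarr 9 q 0 +
      if q = m then ∑ i ∈ Finset.range k, σ.rarr 8 (o + i) i else 0) ∧
    (progTrace.exec σ).2 ≤ 2 + k * 13 := by
  have h : Adds (fun τ => τ.ivar 1 = k ∧ τ.ivar 20 = o ∧ τ.ivar 10 = m ∧ τ.rarr 8 = σ.rarr 8)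
      progTrace 9
      (fun u v => ∑ i ∈ Finset.range k, if u = m ∧ v = 0 then σ.rarr 8 (o + i) i else 0)
      (1 + 1 + k * (12 + 1)) := by
    refine Adds.loop (N := k) (c := 12) ?_ ?_ fun t ht => ?_
    · rintro τ ⟨h, -⟩; exact h
    · rintro τ t ⟨h1, h2, h3, h4⟩
      exact ⟨by simpa using h1, by simpa using h2, by simpa using h3, h4⟩
    · refine adds_addTo ?_ ?_ ?_ ?_ ?_
      · rintro τ ⟨⟨h1, h2, h3, h4⟩, h⟩; exact h3
      · rintro τ -; rfl
      · rintro τ ⟨⟨h1, h2, h3, h4⟩, h⟩; simp [IExp.eval, RExp.eval, h, h2, h4]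
      · rintro τ v ⟨⟨h1, h2, h3, h4⟩, h⟩
        refine ⟨⟨h1, h2, h3, ?_⟩, h⟩
        rw [← h4, Mem.rarr_putReal_of_ne _ (by norm_num)]
      · intro τ _; simp [IExp.cost, RExp.cost]
  obtain ⟨-, h1, h2⟩ := h σ ⟨hk, ho, hm, rfl⟩
  refine ⟨fun q => ?_, by omega⟩
  rw [h1]
  congr 1
  by_cases hq : q = m <;> simp [hq]

/-- The state after `m` rounds: the `m`-th power of `K` and the traces of the first `m` positive
powers. -/
structure PowerState (k : ℕ) (K : Matrix (Fin k) (Fin k) ℝ) (m : ℕ) (τ : Mem) : Prop where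
  var_k : τ.ivar 1 = k
  var_offset : τ.ivar 20 = m * k
  base : ∀ u v : Fin k, τ.rarr 7 u v = K u v
  power : ∀ u v : Fin k, τ.rarr 8 (m * k + u) v = (K ^ m) u v
  unused : ∀ w v, (m + 1) * k ≤ w → τ.rarr 8 w v = 0
  traces : ∀ q < m, τ.rarr 9 q 0 = (K ^ (q + 1)).trace
  unusedTraces : ∀ q, m ≤ q → τ.rarr 9 q 0 = 0

theorem power_body_spec {k m : ℕ} {K : Matrix (Fin k) (Fin k) ℝ} {τ : Mem}
    (h : PowerState k K m τ) (h10 : τ.ivar 10 = m) :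
    let P := Prog.seq progNextPower (.seq (.setVar 20 (.add (.var 20) (.var 1))) progTrace)
    PowerState k K (m + 1) (P.exec τ).1 ∧
      (P.exec τ).2 ≤ 8 + k * 13 + k * (3 + k * (3 + k * 25)) := by
  intro P
  obtain ⟨hk, ho, hb, hp, hu, ht, hut⟩ := h
  obtain ⟨a1, a2, a3⟩ := progNextPower_spec hk ho
  set τ₁ := (progNextPower.exec τ).1 with hτ₁
  have v1 : τ₁.ivar 1 = k := by
    rw [← hk]; exact exec_ivar _ (by simp [progNextPower, Prog.addTo, Prog.WritesVar]) _
  have v20 : τ₁.ivar 20 = m * k := by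
    rw [← ho]; exact exec_ivar _ (by simp [progNextPower, Prog.addTo, Prog.WritesVar]) _
  have v10 : τ₁.ivar 10 = m := by
    rw [← h10]; exact exec_ivar _ (by simp [progNextPower, Prog.addTo, Prog.WritesVar]) _
  have f7 : τ₁.rarr 7 = τ.rarr 7 :=
    exec_rarr _ (by simp [progNextPower, Prog.addTo, Prog.WritesReal]) _
  have f9 : τ₁.rarr 9 = τ.rarr 9 :=
    exec_rarr _ (by simp [progNextPower, Prog.addTo, Prog.WritesReal]) _
  have hmk : m * k + k = (m + 1) * k := by ring
  set τ₂ := τ₁.putVar 20 ((m + 1) * k) with hτ₂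
  have hexec : P.exec τ = ((progTrace.exec τ₂).1,
      (progNextPower.exec τ).2 + (4 + (progTrace.exec τ₂).2)) := by
    have e : τ₁.putVar 20 ((IExp.add (.var 20) (.var 1)).eval τ₁) = τ₂ := by
      simp only [IExp.eval, v20, v1, hmk, hτ₂]
    simp only [P, Prog.exec, ← hτ₁, e]
    rfl
  obtain ⟨b1, b2⟩ := progTrace_spec (σ := τ₂) (k := k) (o := (m + 1) * k) (m := m)
    (by simpa [hτ₂] using v1) (by simp [hτ₂]) (by simpa [hτ₂] using v10)
  have hnew : ∀ u v : Fin k, τ₁.rarr 8 ((m + 1) * k + u) v = (K ^ (m + 1)) u v := by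
    intro u v
    rw [← hmk, a1 u u.2 v v.2, hu _ _ (by rw [← hmk]; omega), zero_add, pow_succ, Matrix.mul_apply,
      ← Fin.sum_univ_eq_sum_range (fun l => τ.rarr 8 (m * k + u) l * τ.rarr 7 l v)]
    exact Finset.sum_congr rfl fun l _ => by rw [hp, hb]
  set τ₃ := (progTrace.exec τ₂).1 with hτ₃
  have g7 : τ₃.rarr 7 = τ.rarr 7 :=
    (exec_rarr _ (by simp [progTrace, Prog.addTo, Prog.WritesReal]) _).trans f7
  have g8 : τ₃.rarr 8 = τ₁.rarr 8 :=
    exec_rarr _ (by simp [progTrace, Prog.addTo, Prog.WritesReal]) _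
  have htr : ∑ i ∈ Finset.range k, τ₂.rarr 8 ((m + 1) * k + i) i = (K ^ (m + 1)).trace := by
    rw [← Fin.sum_univ_eq_sum_range (fun i => τ₂.rarr 8 ((m + 1) * k + i) i)]
    exact Finset.sum_congr rfl fun i _ => hnew i i
  have g9 : ∀ q, τ₃.rarr 9 q 0 =
      τ.rarr 9 q 0 + if q = m then (K ^ (m + 1)).trace else 0 := by
    intro q
    rw [b1, htr, ← f9]
    rfl
  rw [hexec]
  refine ⟨⟨?_, ?_, fun u v => ?_, fun u v => ?_, fun w v hw => ?_, fun q hq => ?_,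
    fun q hq => ?_⟩, ?_⟩
  · rw [← v1]
    exact (exec_ivar _ (by simp [progTrace, Prog.addTo, Prog.WritesVar]) _).trans (by simp [hτ₂])
  · exact (exec_ivar _ (by simp [progTrace, Prog.addTo, Prog.WritesVar]) _).trans (by simp [hτ₂])
  · show τ₃.rarr 7 u v = _
    rw [g7, hb]
  · show τ₃.rarr 8 _ v = _
    rw [g8, hnew]
  · show τ₃.rarr 8 w v = _
    have e1 : (m + 1 + 1) * k = (m + 1) * k + k := by ring
    rw [g8, a2 w v (by omega), hu w v (by omega)]
  · show τ₃.rarr 9 q 0 = _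
    rw [g9]
    rcases Nat.lt_succ_iff_lt_or_eq.1 hq with hq | rfl
    · rw [ht q hq, if_neg (by omega), add_zero]
    · rw [hut q le_rfl, if_pos rfl, zero_add]
  · show τ₃.rarr 9 q 0 = _
    rw [g9, hut q (by omega), if_neg (by omega), add_zero]
  · simp only
    omega

theorem progPowers_spec {σ : Mem} {k : ℕ} (hk : σ.ivar 1 = k) {K : Matrix (Fin k) (Fin k) ℝ}
    (h7 : ∀ u v : Fin k, σ.rarr 7 u v = K u v) (h8 : σ.rarr 8 = 0) (h9 : σ.rarr 9 = 0) :
    (∀ q < k, (progPowers.exec σ).1.rarr 9 q 0 = (K ^ (q + 1)).trace) ∧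
    (progPowers.exec σ).2 ≤ 6 + k * 9 + k * (9 + k * 13 + k * (3 + k * (3 + k * 25))) := by
  set σ₁ := σ.putVar 20 0 with hσ₁
  obtain ⟨a1, a2⟩ := progOne_spec (σ := σ₁) (k := k) (by simpa [hσ₁] using hk)
  set σ₂ := (progOne.exec σ₁).1 with hσ₂
  have v1 : σ₂.ivar 1 = k := by
    rw [← hk]
    exact (exec_ivar _ (by simp [progOne, Prog.addTo, Prog.WritesVar]) _).trans (by simp [hσ₁])
  have v20 : σ₂.ivar 20 = 0 :=
    (exec_ivar _ (by simp [progOne, Prog.addTo, Prog.WritesVar]) _).trans (by simp [hσ₁])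
  have f7 : σ₂.rarr 7 = σ.rarr 7 :=
    exec_rarr _ (by simp [progOne, Prog.addTo, Prog.WritesReal]) _
  have f9 : σ₂.rarr 9 = σ.rarr 9 :=
    exec_rarr _ (by simp [progOne, Prog.addTo, Prog.WritesReal]) _
  have f8 : ∀ u v, σ₂.rarr 8 u v = if u < k ∧ v = u then 1 else 0 := by
    intro u v
    rw [a1]
    show σ.rarr 8 u v + _ = _
    rw [h8]; simp
  have h := exec_loop_of_invariant (σ := σ₂) (x := 10) (e := .var 1) (N := k)
    (P := .seq progNextPower (.seq (.setVar 20 (.add (.var 20) (.var 1))) progTrace))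
    v1 (PowerState k K) (8 + k * 13 + k * (3 + k * (3 + k * 25)))
    ⟨v1, by simpa using v20, fun u v => by rw [f7, h7], fun u v => by
        rw [f8, pow_zero, Matrix.one_apply]
        simp [Fin.ext_iff, eq_comm],
      fun w v hw => by rw [f8, if_neg (by omega)], by simp, by simp [f9, h9]⟩ (by
      rintro t ht τ ⟨h1, h2, h3, h4, h5, h6, h7⟩
      exact power_body_spec ⟨by simpa using h1, by simpa using h2, h3, h4, h5, h6, h7⟩ (by simp))
  obtain ⟨⟨-, -, -, -, -, hfin, -⟩, hcost⟩ := h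
  refine ⟨hfin, ?_⟩
  have hexec : (progPowers.exec σ).2 = 2 + ((progOne.exec σ₁).2 + ((Prog.loop 10 (.var 1)
    (.seq progNextPower (.seq (.setVar 20 (.add (.var 20) (.var 1))) progTrace))).exec σ₂).2) := rfl
  rw [hexec]
  simp only [IExp.cost] at hcost
  have e : k * (8 + k * 13 + k * (3 + k * (3 + k * 25)) + 1) =
    k * (9 + k * 13 + k * (3 + k * (3 + k * 25))) := by ring
  omega

/-! ### Newton's identities -/

theorem progConv_spec {σ : Mem} {k m : ℕ} (hk : σ.ivar 1 = k) (hm : σ.ivar 10 = m) :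
    (∀ q, (progConv.exec σ).1.rarr 12 q 0 = σ.rarr 12 q 0 + if q = m then
      ∑ i ∈ Finset.range (m + 1), σ.rarr 10 (k - m + i) 0 * σ.rarr 9 i 0 else 0) ∧
    (progConv.exec σ).2 ≤ 4 + (m + 1) * 19 := by
  have h : Adds (fun τ => τ.ivar 1 = k ∧ τ.ivar 10 = m ∧ τ.rarr 10 = σ.rarr 10 ∧
      τ.rarr 9 = σ.rarr 9) progConv 12
      (fun u v => ∑ i ∈ Finset.range (m + 1), if u = m ∧ v = 0 then
        σ.rarr 10 (k - m + i) 0 * σ.rarr 9 i 0 else 0)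
      (3 + 1 + (m + 1) * (18 + 1)) := by
    refine Adds.loop (N := m + 1) (c := 18) ?_ ?_ fun t ht => ?_
    · rintro τ ⟨-, h, -⟩; simp [IExp.eval, h]
    · rintro τ t ⟨h1, h2, h3, h4⟩
      exact ⟨by simpa using h1, by simpa using h2, h3, h4⟩
    · refine adds_addTo ?_ ?_ ?_ ?_ ?_
      · rintro τ ⟨⟨h1, h2, h3, h4⟩, h⟩; exact h2
      · rintro τ -; rfl
      · rintro τ ⟨⟨h1, h2, h3, h4⟩, h⟩; simp [IExp.eval, RExp.eval, h, h1, h2, h3, h4]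
      · rintro τ v ⟨⟨h1, h2, h3, h4⟩, h⟩
        refine ⟨⟨h1, h2, ?_, ?_⟩, h⟩
        · rw [← h3, Mem.rarr_putReal_of_ne _ (by norm_num)]
        · rw [← h4, Mem.rarr_putReal_of_ne _ (by norm_num)]
      · intro τ _; simp [IExp.cost, RExp.cost]
  obtain ⟨-, h1, h2⟩ := h σ ⟨hk, hm, rfl, rfl⟩
  refine ⟨fun q => ?_, by omega⟩
  rw [h1]
  congr 1
  by_cases hq : q = m <;> simp [hq]

/-- The state after `m` rounds of Newton's identities: the first `m + 1` coefficients. -/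
structure NewtonState (k : ℕ) (c p : ℕ → ℝ) (m : ℕ) (τ : Mem) : Prop where
  var_k : τ.ivar 1 = k
  powerSums : ∀ i < k, τ.rarr 9 i 0 = p i
  coeff : ∀ q ≤ m, τ.rarr 10 (k - q) 0 = c q
  counter : τ.rarr 11 0 0 = m
  unused : ∀ q, m ≤ q → τ.rarr 12 q 0 = 0

/-- Row `m` of array `12` is a fresh zero accumulator for the convolution. Array `11` carries `m +
1` as a real number, because real expressions cannot read integer variables as values. The
coefficient `c q` sits at position `k - q`, ready for root extraction. -/
theorem newton_body_spec {k m : ℕ} {c p : ℕ → ℝ} {τ : Mem} (hmk : m < k)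
    (hc : (m + 1 : ℝ) * c (m + 1) = -∑ i ∈ Finset.range (m + 1), c (m - i) * p i)
    (h : NewtonState k c p m τ) (h10 : τ.ivar 10 = m) :
    let P := Prog.seq (.setReal 11 (.lit 0) (.lit 0) (.add (.get 11 (.lit 0) (.lit 0)) (.lit 1)))
      (.seq progConv
        (.setReal 10 (.sub (.var 1) (.add (.var 10) (.lit 1))) (.lit 0)
          (.div (.sub (.lit 0) (.get 12 (.var 10) (.lit 0))) (.get 11 (.lit 0) (.lit 0)))))
    NewtonState k c p (m + 1) (P.exec τ).1 ∧ (P.exec τ).2 ≤ 28 + k * 19 := by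
  intro P
  obtain ⟨hk, hp, hcf, hct, hun⟩ := h
  set τ₁ := τ.putReal 11 0 0 (m + 1 : ℝ) with hτ₁
  have e9 : τ₁.rarr 9 = τ.rarr 9 := Mem.rarr_putReal_of_ne _ (by norm_num) _ _ _
  have e10 : τ₁.rarr 10 = τ.rarr 10 := Mem.rarr_putReal_of_ne _ (by norm_num) _ _ _
  have e12 : τ₁.rarr 12 = τ.rarr 12 := Mem.rarr_putReal_of_ne _ (by norm_num) _ _ _
  obtain ⟨a1, a2⟩ := progConv_spec (σ := τ₁) (k := k) (m := m) hk h10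
  set τ₂ := (progConv.exec τ₁).1 with hτ₂
  have v1 : τ₂.ivar 1 = k :=
    (exec_ivar _ (by simp [progConv, Prog.addTo, Prog.WritesVar]) _).trans hk
  have v10 : τ₂.ivar 10 = m :=
    (exec_ivar _ (by simp [progConv, Prog.addTo, Prog.WritesVar]) _).trans h10
  have f9 : τ₂.rarr 9 = τ.rarr 9 :=
    (exec_rarr _ (by simp [progConv, Prog.addTo, Prog.WritesReal]) _).trans e9
  have f10 : τ₂.rarr 10 = τ.rarr 10 :=
    (exec_rarr _ (by simp [progConv, Prog.addTo, Prog.WritesReal]) _).trans e10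
  have f11 : τ₂.rarr 11 0 0 = (m + 1 : ℝ) := by
    have : τ₂.rarr 11 = τ₁.rarr 11 :=
      exec_rarr _ (by simp [progConv, Prog.addTo, Prog.WritesReal]) _
    rw [this, hτ₁, Mem.rarr_putReal, if_pos ⟨rfl, rfl⟩]
  have f12 : τ₂.rarr 12 m 0 = -((m + 1 : ℝ) * c (m + 1)) := by
    rw [a1, if_pos rfl, e12, hun m le_rfl, zero_add, hc, neg_neg]
    refine Finset.sum_congr rfl fun i hi => ?_
    have hi' := Finset.mem_range.1 hi
    rw [e10, e9, hp i (by omega), show k - m + i = k - (m - i) by omega, hcf _ (by omega)]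
  have hval : (0 - τ₂.rarr 12 m 0) / τ₂.rarr 11 0 0 = c (m + 1) := by
    rw [f12, f11]
    have : (m + 1 : ℝ) ≠ 0 := by positivity
    field_simp
    ring
  set τ₃ := τ₂.putReal 10 (k - (m + 1)) 0 (c (m + 1)) with hτ₃
  have hexec : P.exec τ = (τ₃, 8 + ((progConv.exec τ₁).2 + 16)) := by
    have e1 : τ.putReal 11 0 0 (τ.rarr 11 0 0 + ((1 : ℚ) : ℝ)) = τ₁ := by rw [hct]; simp [hτ₁]
    have e2 : τ₂.putReal 10 (k - (m + 1)) 0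
        ((((0 : ℚ) : ℝ) - τ₂.rarr 12 m 0) / τ₂.rarr 11 0 0) = τ₃ := by
      rw [Rat.cast_zero, hval]
    simp only [P, Prog.exec, IExp.eval, RExp.eval, e1, ← hτ₂, v1, v10, e2]
    rfl
  rw [hexec]
  refine ⟨⟨v1, fun i hi => ?_, fun q hq => ?_, ?_, fun q hq => ?_⟩, ?_⟩
  · rw [hτ₃, Mem.rarr_putReal_of_ne _ (by norm_num), f9, hp i hi]
  · rw [hτ₃, Mem.rarr_putReal]
    rcases Nat.le_succ_iff.1 hq with hq | rfl
    · rw [if_neg (by omega), f10, hcf q hq]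
    · rw [if_pos ⟨rfl, rfl⟩]
  · rw [hτ₃, Mem.rarr_putReal_of_ne _ (by norm_num), f11]; push_cast; rfl
  · rw [hτ₃, Mem.rarr_putReal_of_ne _ (by norm_num), a1, e12, hun q (by omega),
      if_neg (by omega), add_zero]
  · simp only
    omega

theorem progNewton_spec {σ : Mem} {k : ℕ} {c p : ℕ → ℝ} (hk : σ.ivar 1 = k)
    (h9 : ∀ i < k, σ.rarr 9 i 0 = p i) (h11 : σ.rarr 11 = 0) (h12 : σ.rarr 12 = 0)
    (hc0 : c 0 = 1)
    (hc : ∀ m < k, (m + 1 : ℝ) * c (m + 1) = -∑ i ∈ Finset.range (m + 1), c (m - i) * p i) :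
    (∀ q ≤ k, (progNewton.exec σ).1.rarr 10 (k - q) 0 = c q) ∧
    (progNewton.exec σ).2 ≤ 6 + k * (29 + k * 19) := by
  set σ₁ := σ.putReal 10 k 0 1 with hσ₁
  have h := exec_loop_of_invariant (σ := σ₁) (x := 10) (e := .var 1) (N := k)
    (P := .seq (.setReal 11 (.lit 0) (.lit 0) (.add (.get 11 (.lit 0) (.lit 0)) (.lit 1)))
      (.seq progConv
        (.setReal 10 (.sub (.var 1) (.add (.var 10) (.lit 1))) (.lit 0)
          (.div (.sub (.lit 0) (.get 12 (.var 10) (.lit 0))) (.get 11 (.lit 0) (.lit 0))))))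
    hk (NewtonState k c p) (28 + k * 19)
    ⟨hk, fun i hi => by rw [hσ₁, Mem.rarr_putReal_of_ne _ (by norm_num), h9 i hi], fun q hq => by
        obtain rfl : q = 0 := by omega
        rw [hσ₁, Mem.rarr_putReal, if_pos ⟨by omega, rfl⟩, hc0],
      by rw [hσ₁, Mem.rarr_putReal_of_ne _ (by norm_num), h11]; simp,
      fun q _ => by rw [hσ₁, Mem.rarr_putReal_of_ne _ (by norm_num), h12]; rfl⟩ (by
      rintro t ht τ ⟨h1, h2, h3, h4, h5⟩
      exact newton_body_spec ht (hc t ht) ⟨by simpa using h1, h2, h3, h4, h5⟩ (by simp))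
  obtain ⟨⟨-, -, hfin, -, -⟩, hcost⟩ := h
  have hexec : progNewton.exec σ = (((Prog.loop 10 (.var 1)
    (.seq (.setReal 11 (.lit 0) (.lit 0) (.add (.get 11 (.lit 0) (.lit 0)) (.lit 1)))
      (.seq progConv
        (.setReal 10 (.sub (.var 1) (.add (.var 10) (.lit 1))) (.lit 0)
          (.div (.sub (.lit 0) (.get 12 (.var 10) (.lit 0))) (.get 11 (.lit 0) (.lit 0))))))).exec
            σ₁).1, 4 + ((Prog.loop 10 (.var 1)
    (.seq (.setReal 11 (.lit 0) (.lit 0) (.add (.get 11 (.lit 0) (.lit 0)) (.lit 1)))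
      (.seq progConv
        (.setReal 10 (.sub (.var 1) (.add (.var 10) (.lit 1))) (.lit 0)
          (.div (.sub (.lit 0) (.get 12 (.var 10) (.lit 0))) (.get 11 (.lit 0) (.lit 0))))))).exec
            σ₁).2) := by
    have e : σ.putReal 10 ((IExp.var 1).eval σ) ((IExp.lit 0).eval σ) ((RExp.lit 1).eval σ) =
        σ₁ := by
      simp only [IExp.eval, RExp.eval, hk, hσ₁, Rat.cast_one]
    rw [progNewton, Prog.exec, Prog.exec, e]
    rfl
  rw [hexec]
  refine ⟨hfin, ?_⟩
  simp only [IExp.cost] at hcost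
  have e : k * (28 + k * 19 + 1) = k * (29 + k * 19) := by ring
  simp only
  omega

/-! ### The output -/

theorem progOutput_spec {σ : Mem} {k : ℕ} (hk : σ.ivar 1 = k) (h2 : σ.rarr 2 = 0)
    (h3 : σ.rarr 3 = 0) {r : ℕ → ℝ}
    (hr : ∀ j < k, r j = √(sortedAt (monicPoly (fun i => σ.rarr 10 i 0) k).roots j)) :
    (∀ j, (progOutput.exec σ).1.rarr 2 j 0 = if j < k then r j else 0) ∧
    (progOutput.exec σ).1.rarr 3 0 0 = ∑ j ∈ Finset.range k, r j * Real.log (1 / r j) ∧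
    (progOutput.exec σ).2 ≤ 2 + k * (27 + k) := by
  have h := exec_loop_of_invariant (σ := σ) (x := 10) (e := .var 1) (N := k)
    (P := .seq (.setReal 2 (.var 10) (.lit 0) (.sqrt (.root 10 (.var 1) (.var 10))))
      (.addTo 3 (.lit 0) (.lit 0) (.mul (.get 2 (.var 10) (.lit 0))
        (.log (.div (.lit 1) (.get 2 (.var 10) (.lit 0)))))))
    hk (fun t τ => τ.ivar 1 = k ∧ τ.rarr 10 = σ.rarr 10 ∧
      (∀ j, τ.rarr 2 j 0 = if j < t then r j else 0) ∧
      τ.rarr 3 0 0 = ∑ j ∈ Finset.range t, r j * Real.log (1 / r j)) (26 + k)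
    ⟨hk, rfl, by simp [h2], by simp [h3]⟩ (by
      rintro t ht τ ⟨a1, a2, a3, a4⟩
      set τ₀ := τ.putVar 10 t with hτ₀
      have b1 : τ₀.ivar 1 = k := by simpa [hτ₀] using a1
      have b10 : τ₀.ivar 10 = t := by simp [hτ₀]
      set τ₁ := τ₀.putReal 2 t 0 (r t) with hτ₁
      have c2 : τ₁.rarr 2 t 0 = r t := by rw [hτ₁, Mem.rarr_putReal, if_pos ⟨rfl, rfl⟩]
      have hroot : √(((monicPoly (fun i => τ₀.rarr 10 i 0) k).roots.sort (· ≥ ·)).getD t 0) =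
          r t := by
        rw [hr t ht, hτ₀, Mem.rarr_putVar, a2]; rfl
      set τ₂ := τ₁.putReal 3 0 0 (τ₁.rarr 3 0 0 + r t * Real.log (1 / r t)) with hτ₂
      have hexec : (Prog.seq (.setReal 2 (.var 10) (.lit 0) (.sqrt (.root 10 (.var 1) (.var 10))))
          (.addTo 3 (.lit 0) (.lit 0) (.mul (.get 2 (.var 10) (.lit 0))
          (.log (.div (.lit 1) (.get 2 (.var 10) (.lit 0))))))).exec τ₀ =
          (τ₂, (7 + k) + 17) := by
        have e : τ₀.putReal 2 ((IExp.var 10).eval τ₀) ((IExp.lit 0).eval τ₀)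
            ((RExp.sqrt (.root 10 (.var 1) (.var 10))).eval τ₀) = τ₁ := by
          simp only [IExp.eval, RExp.eval, b10, b1, hroot, hτ₁]
        have e2 : τ₁.ivar 10 = t := b10
        rw [Prog.exec, Prog.exec, e]
        simp only [Prog.addTo, Prog.exec, IExp.eval, RExp.eval, IExp.cost, RExp.cost, e2, c2,
          Rat.cast_one, b1]
        rw [hτ₂]
        congr 1
        ring
      rw [hexec]
      refine ⟨⟨b1, ?_, fun j => ?_, ?_⟩, by simp only; omega⟩
      · rw [hτ₂, Mem.rarr_putReal_of_ne _ (by norm_num), hτ₁,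
          Mem.rarr_putReal_of_ne _ (by norm_num)]
        exact a2
      · rw [hτ₂, Mem.rarr_putReal_of_ne _ (by norm_num), hτ₁, Mem.rarr_putReal]
        by_cases hj : j = t
        · subst hj; simp
        · rw [if_neg (by tauto), hτ₀, Mem.rarr_putVar, a3]
          have : j < t ↔ j < t + 1 := by omega
          simp only [this]
      · rw [hτ₂, Mem.rarr_putReal, if_pos ⟨rfl, rfl⟩, hτ₁,
          Mem.rarr_putReal_of_ne _ (by norm_num), Finset.sum_range_succ, ← a4]
        rfl)
  obtain ⟨⟨-, -, g2, g3⟩, hcost⟩ := h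
  refine ⟨g2, g3, ?_⟩
  have e : k * (26 + k + 1) = k * (27 + k) := by ring
  simp only [IExp.cost] at hcost
  rw [e] at hcost
  exact hcost

/-! ### Coefficients of the characteristic polynomial -/

theorem trace_pow_eq_sum_eigenvalues_pow {k : ℕ} {K : Matrix (Fin k) (Fin k) ℝ}
    (hK : K.IsHermitian) (m : ℕ) : (K ^ m).trace = ∑ i, hK.eigenvalues i ^ m := by
  conv_lhs => rw [hK.spectral_theorem]
  rw [← map_pow, Unitary.conjStarAlgAut_apply, Matrix.trace_mul_cycle, Unitary.coe_star_mul_self,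
    one_mul, Matrix.diagonal_pow, Matrix.trace_diagonal]
  rfl

/-- Vieta's formula for a polynomial that splits with the eigenvalues as roots. -/
theorem coeff_charpoly_eq {k : ℕ} {K : Matrix (Fin k) (Fin k) ℝ} (hK : K.IsHermitian) {q : ℕ}
    (hq : q ≤ k) : K.charpoly.coeff (k - q) =
      (-1) ^ q * MvPolynomial.aeval hK.eigenvalues (MvPolynomial.esymm (Fin k) ℝ q) := by
  have h : K.charpoly =
      ((Finset.univ.val.map hK.eigenvalues).map fun t => Polynomial.X - Polynomial.C t).prod := by
    rw [hK.charpoly_eq, Multiset.map_map]; rfl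
  have hc : Multiset.card (Finset.univ.val.map hK.eigenvalues) = k := by simp
  rw [h, Multiset.prod_X_sub_C_coeff _ (by rw [hc]; omega), hc,
    MvPolynomial.aeval_esymm_eq_multiset_esymm, Nat.sub_sub_self hq]

/-- Newton's identities for the coefficients of the characteristic polynomial. -/
theorem mul_coeff_charpoly_eq {k : ℕ} {K : Matrix (Fin k) (Fin k) ℝ} (hK : K.IsHermitian) {m : ℕ}
    (hm : m < k) : (m + 1 : ℝ) * K.charpoly.coeff (k - (m + 1)) =
      -∑ i ∈ Finset.range (m + 1), K.charpoly.coeff (k - (m - i)) * (K ^ (i + 1)).trace := by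
  have h := congrArg (MvPolynomial.aeval hK.eigenvalues)
    (MvPolynomial.mul_esymm_eq_sum (Fin k) ℝ (m + 1))
  -- The excluded last pair of the antidiagonal is dropped, and the order is reversed so that index
  -- `i` belongs to the power sum of degree `i + 1`.
  rw [Finset.sum_filter, Finset.Nat.sum_antidiagonal_eq_sum_range_succ_mk,
    Finset.sum_range_succ, if_neg (by simp), add_zero, ← Finset.sum_range_reflect] at h
  simp only [map_mul, map_natCast, map_pow, map_neg, map_one, map_sum] at h
  -- The sign of the coefficient and that of Newton's identity combine to `(-1) ^ (2 (m + 1) + 1) =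
  -- -1`.
  rw [coeff_charpoly_eq hK (by omega), mul_left_comm, ← Nat.cast_succ, h, ← mul_assoc, ← pow_add,
    show m + 1 + (m + 1 + 1) = 2 * (m + 1) + 1 by ring, pow_succ, pow_mul]
  simp only [even_two, Even.neg_pow, one_pow, one_mul, neg_mul, neg_inj]
  refine Finset.sum_congr rfl fun i hi => ?_
  have hi' := Finset.mem_range.1 hi
  rw [if_pos (by omega), coeff_charpoly_eq hK (by omega), trace_pow_eq_sum_eigenvalues_pow hK,
    show m + 1 - 1 - i = m - i by omega, show m + 1 - (m - i) = i + 1 by omega]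
  simp [MvPolynomial.psum]

/-- Only the values below position `k` enter `monicPoly`; its leading coefficient is built in. -/
theorem monicPoly_eq_charpoly {k : ℕ} {K : Matrix (Fin k) (Fin k) ℝ} {v : ℕ → ℝ}
    (h : ∀ q ≤ k, v (k - q) = K.charpoly.coeff (k - q)) : monicPoly v k = K.charpoly := by
  have hd : K.charpoly.natDegree = k := by simp
  rw [K.charpoly_monic.as_sum, hd, monicPoly]
  congr 1
  refine Finset.sum_congr rfl fun i hi => ?_
  have := Finset.mem_range.1 hi
  have := h (k - i) (by omega)
  rw [Nat.sub_sub_self (by omega)] at this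
  rw [this]

/-! ### The input -/

theorem ListsSupport.length_eq {n : ℕ} {R : Matrix (Fin n) (Fin n) ℝ} {L : List (Fin n × Fin n)}
    (h : ListsSupport R L) : L.length = nnz R := by
  classical
  rw [nnz, ← List.toFinset_card_of_nodup h.1, ← Set.ncard_coe_finset]
  congr 1
  ext e
  simp [h.2]

theorem mul_sparseSketch_apply {n s : ℕ} {R : Matrix (Fin n) (Fin n) ℝ}
    {L : List (Fin n × Fin n)} (h : ListsSupport R L) (ω : SparseChoice n s) (u : Fin n)
    (v : Fin s) : (R * sparseSketch ω) u v =
      (L.map fun e => if u = e.1 ∧ v = ω.1 e.2 then R e.1 e.2 * sgn (ω.2 e.2) else 0).sum := by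
  classical
  rw [← List.sum_toFinset _ h.1, Finset.sum_subset (Finset.subset_univ _), Fintype.sum_prod_type,
    Finset.sum_eq_single u]
  · rw [Matrix.mul_apply]
    refine Finset.sum_congr rfl fun j _ => ?_
    rw [sparseSketch_apply]
    by_cases hj : ω.1 j = v
    · simp [hj]
    · simp [hj, Ne.symm hj]
  · intro b _ hb
    simp [hb.symm]
  · simp
  · intro e _ he
    have : R e.1 e.2 = 0 := by
      by_contra hne
      exact he (List.mem_toFinset.2 ((h.2 e).2 hne))
    simp [this]

theorem progSketch_initMem {n s k : ℕ} {R : Matrix (Fin n) (Fin n) ℝ}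
    {L : List (Fin n × Fin n)} (h : ListsSupport R L) (ω : SparseChoice n s) :
    (∀ (u : Fin n) (v : Fin s), (progSketch.exec (initMem k R L ω)).1.rarr 4 u v =
      (R * sparseSketch ω) u v) ∧
    (progSketch.exec (initMem k R L ω)).2 ≤ 25 * nnz R + 2 := by
  obtain ⟨h1, h2⟩ := progSketch_spec (σ := initMem k R L ω) (z := L.length) (by simp [initMem])
    (by funext u v; simp [initMem])
  refine ⟨fun u v => ?_, h.length_eq ▸ h2⟩
  rw [h1, mul_sparseSketch_apply h, ← Fin.sum_univ_fun_getElem, ← Fin.sum_univ_eq_sum_range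
    (fun t => if (u : ℕ) = (initMem k R L ω).iarr 0 t ∧
        (v : ℕ) = (initMem k R L ω).iarr 2 ((initMem k R L ω).iarr 1 t) then
      (initMem k R L ω).rarr 0 t 0 * (initMem k R L ω).rarr 1 ((initMem k R L ω).iarr 1 t) 0
      else 0)]
  refine Finset.sum_congr rfl fun t _ => ?_
  simp [initMem, Fin.ext_iff]

theorem progMin_spec {σ : Mem} {k n : ℕ} (hn : σ.ivar 0 = n) (hk : σ.ivar 1 = k) :
    (progMin.exec σ).1.ivar 1 = min k n ∧ (progMin.exec σ).2 ≤ 5 := by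
  rw [progMin, Prog.exec]
  split_ifs with h <;> simp only [BExp.Holds, IExp.eval, hn, hk] at h <;>
    simp [Prog.exec, BExp.cost, IExp.cost, IExp.eval, hn, hk] <;> omega

/-! ### The singular values from a factorization of the Gram matrix -/

theorem sq_approxProbs_of_factorization {n s r : ℕ} {R : Matrix (Fin n) (Fin n) ℝ}
    {Pi : Matrix (Fin n) (Fin s) ℝ} {M : Matrix (Fin s) (Fin r) ℝ}
    (h : (R * Pi)ᵀ * (R * Pi) = M * Mᵀ) (j : ℕ) :
    approxProbs R Pi j ^ 2 = sortedAt (Mᵀ * M).charpoly.roots j := by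
  rw [sq_approxProbs, h, sortedAt_charpoly_mul_comm]
  intro x hx
  refine nonneg_of_mem_roots_charpoly ?_ hx
  rw [← h]
  exact Matrix.posSemidef_conjTranspose_mul_self (R * Pi)

theorem approxProbs_eq_zero_of_factorization {n s r : ℕ} {R : Matrix (Fin n) (Fin n) ℝ}
    {Pi : Matrix (Fin n) (Fin s) ℝ} {M : Matrix (Fin s) (Fin r) ℝ}
    (h : (R * Pi)ᵀ * (R * Pi) = M * Mᵀ) {j : ℕ} (hj : r ≤ j) : approxProbs R Pi j = 0 := by
  have h1 := sq_approxProbs_of_factorization h j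
  have hH : (Mᵀ * M).IsHermitian := Matrix.isHermitian_conjTranspose_mul_self M
  rw [sortedAt_charpoly_roots hH, dif_neg (by simpa using hj)] at h1
  exact pow_eq_zero_iff two_ne_zero |>.1 h1

theorem rank_gram_le {n s k : ℕ} {R : Matrix (Fin n) (Fin n) ℝ} {hR : IsDensity R}
    (hk : AtMostNonzero hR k) (Pi : Matrix (Fin n) (Fin s) ℝ) :
    ((R * Pi)ᵀ * (R * Pi)).rank ≤ min k n := by
  have h1 : ((R * Pi)ᵀ * (R * Pi)).rank ≤ R.rank :=
    (Matrix.rank_mul_le_right _ _).trans (Matrix.rank_mul_le_left _ _)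
  refine h1.trans (le_min ?_ R.rank_le_width)
  rw [hR.isHermitian.rank_eq_card_non_zero_eigs]
  exact card_nonzero_eigenvalues_le hk

/-! ### Correctness and running time of the whole program -/

/-- Every monomial in the costs other than `z` is at most `n s ^ 2`: `r ≤ n` handles `r s ^ 2`, and
`r ^ 2 ≤ s` handles `r ^ 4` and `r ^ 2 s`. The constant `278` is the sum of all the remaining
coefficients. -/
theorem phases_cost_le {n s r : ℕ} (hn0 : 0 < n) (hs0 : 0 < s) (hrn : r ≤ n) (hrs : r ^ 2 ≤ s)
    {z a₁ a₂ a₃ a₄ a₅ a₆ a₇ a₈ : ℕ} (a2 : a₁ ≤ 25 * z + 2)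
    (b2 : a₂ ≤ 2 + s * (3 + s * (3 + n * 15))) (c2 : a₃ ≤ 5) (d2 : a₄ ≤ 2 + r * (70 * s ^ 2 + 1))
    (e2 : a₅ ≤ 2 + r * (3 + r * (3 + s * 15)))
    (f2 : a₆ ≤ 6 + r * 9 + r * (9 + r * 13 + r * (3 + r * (3 + r * 25))))
    (g2 : a₇ ≤ 6 + r * (29 + r * 19)) (o3 : a₈ ≤ 2 + r * (27 + r)) :
    a₁ + (a₂ + (a₃ + (a₄ + (a₅ + (a₆ + (a₇ + a₈)))))) ≤ 25 * z + 278 * (n * s ^ 2) := by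
  set W := n * s ^ 2 with hW
  have w1 : 1 ≤ W := Nat.one_le_iff_ne_zero.2 (by positivity)
  have ws : s ≤ s ^ 2 := Nat.le_self_pow two_ne_zero s
  have wss : s ^ 2 ≤ W := Nat.le_mul_of_pos_left _ hn0
  have wr1 : r * s ^ 2 ≤ W := Nat.mul_le_mul_right _ hrn
  have wr : r ≤ W := (Nat.le_mul_of_pos_right r (by positivity)).trans wr1
  have wr2 : r ^ 2 ≤ W := hrs.trans (ws.trans wss)
  have wr4 : r ^ 4 ≤ W := by
    calc r ^ 4 = (r ^ 2) ^ 2 := by ring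
      _ ≤ s ^ 2 := Nat.pow_le_pow_left hrs 2
      _ ≤ W := wss
  have wr3 : r ^ 3 ≤ W := by
    rcases Nat.eq_zero_or_pos r with h | h
    · simp [h]
    · exact (Nat.pow_le_pow_right h (by norm_num)).trans wr4
  have wrs : r ^ 2 * s ≤ W := by
    calc r ^ 2 * s ≤ s * s := Nat.mul_le_mul_right _ hrs
      _ = s ^ 2 := by ring
      _ ≤ W := wss
  have t2 : 2 + s * (3 + s * (3 + n * 15)) = 2 + 3 * s + 3 * s ^ 2 + 15 * W := by
    rw [hW]; ring
  have t4 : 2 + r * (70 * s ^ 2 + 1) = 2 + 70 * (r * s ^ 2) + r := by ring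
  have t5 : 2 + r * (3 + r * (3 + s * 15)) = 2 + 3 * r + 3 * r ^ 2 + 15 * (r ^ 2 * s) := by ring
  have t6 : 6 + r * 9 + r * (9 + r * 13 + r * (3 + r * (3 + r * 25))) =
      6 + 18 * r + 16 * r ^ 2 + 3 * r ^ 3 + 25 * r ^ 4 := by ring
  have t7 : 6 + r * (29 + r * 19) = 6 + 29 * r + 19 * r ^ 2 := by ring
  have t8 : 2 + r * (27 + r) = 2 + 27 * r + r ^ 2 := by ring
  rw [t2] at b2
  rw [t4] at d2
  rw [t5] at e2
  rw [t6] at f2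
  rw [t7] at g2
  rw [t8] at o3
  omega

theorem exec_seq (P Q : Prog) (σ : Mem) : (Prog.seq P Q).exec σ =
    ((Q.exec (P.exec σ).1).1, (P.exec σ).2 + (Q.exec (P.exec σ).1).2) := rfl

theorem progMain_spec {n k s : ℕ} {R : Matrix (Fin n) (Fin n) ℝ} {hR : IsDensity R}
    (hk : AtMostNonzero hR k) (hks : k ^ 2 ≤ s) {L : List (Fin n × Fin n)}
    (hL : ListsSupport R L) (ω : SparseChoice n s) :
    HoldsOutput k R (sparseSketch ω) (progMain.exec (initMem k R L ω)).1 ∧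
      (progMain.exec (initMem k R L ω)).2 ≤ 25 * nnz R + 278 * (n * s ^ 2) := by
  have hn0 : 0 < n := hR.pos_dim
  have hk0 : 0 < k := pos_of_atMostNonzero hk
  have hs0 : 0 < s := (pow_pos hk0 2).trans_le hks
  obtain ⟨a1, a2⟩ := progSketch_initMem (k := k) hL ω
  have n0 : (initMem k R L ω).ivar 0 = n := rfl
  have k0 : (initMem k R L ω).ivar 1 = k := rfl
  have s0 : (initMem k R L ω).ivar 2 = s := rfl
  have z0 : ∀ a, 2 ≤ a → a < 4 ∨ 4 ≤ a → (initMem k R L ω).rarr a = 0 := by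
    intro a ha _
    funext u v
    simp only [initMem]
    rw [if_neg (by omega), if_neg (by omega)]; rfl
  -- From here on each memory state is opaque and known only through recorded facts: the sizes still
  -- needed, the zero arrays not yet written, and the result of the last phase.
  generalize initMem k R L ω = σ₀ at *
  generalize sparseSketch ω = Pi at *
  set r := min k n with hr
  obtain ⟨σ₁, h₁⟩ : ∃ τ, (progSketch.exec σ₀).1 = τ := ⟨_, rfl⟩
  rw [h₁] at a1
  have n1 : σ₁.ivar 0 = n := by
    rw [← h₁, exec_ivar _ (by simp [progSketch, Prog.addTo, Prog.WritesVar]), n0]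
  have k1 : σ₁.ivar 1 = k := by
    rw [← h₁, exec_ivar _ (by simp [progSketch, Prog.addTo, Prog.WritesVar]), k0]
  have s1 : σ₁.ivar 2 = s := by
    rw [← h₁, exec_ivar _ (by simp [progSketch, Prog.addTo, Prog.WritesVar]), s0]
  have z1 : ∀ a, 2 ≤ a → a < 4 ∨ 5 ≤ a → σ₁.rarr a = 0 := fun a ha ha' => by
    rw [← h₁, exec_rarr _ (by
      simp [progSketch, Prog.addTo, Prog.WritesReal]
      try omega), z0 a ha (by omega)]
  obtain ⟨b1, b2⟩ := gram_spec (src := 4) (out := 5) (va := 2) (vb := 0) (by norm_num)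
    (by norm_num) (by norm_num) s1 n1 (z1 5 (by norm_num) (by norm_num))
  rw [← progGram] at b1 b2
  obtain ⟨σ₂, h₂⟩ : ∃ τ, (progGram.exec σ₁).1 = τ := ⟨_, rfl⟩
  rw [h₂] at b1
  have n2 : σ₂.ivar 0 = n := by
    rw [← h₂, exec_ivar _ (by simp [progGram, Prog.addTo, Prog.WritesVar]), n1]
  have k2 : σ₂.ivar 1 = k := by
    rw [← h₂, exec_ivar _ (by simp [progGram, Prog.addTo, Prog.WritesVar]), k1]
  have s2 : σ₂.ivar 2 = s := by
    rw [← h₂, exec_ivar _ (by simp [progGram, Prog.addTo, Prog.WritesVar]), s1]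
  have z2 : ∀ a, 2 ≤ a → a < 4 ∨ 6 ≤ a → σ₂.rarr a = 0 := fun a ha ha' => by
    rw [← h₂, exec_rarr _ (by
      simp [progGram, Prog.addTo, Prog.WritesReal]
      try omega), z1 a ha (by omega)]
  obtain ⟨c1, c2⟩ := progMin_spec n2 k2
  obtain ⟨σ₃, h₃⟩ : ∃ τ, (progMin.exec σ₂).1 = τ := ⟨_, rfl⟩
  rw [h₃, ← hr] at c1
  have s3 : σ₃.ivar 2 = s := by
    rw [← h₃, exec_ivar _ (by simp [progMin, Prog.WritesVar]), s2]
  have z3 : ∀ a, 2 ≤ a → a < 4 ∨ 6 ≤ a → σ₃.rarr a = 0 := fun a ha ha' => by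
    rw [← h₃, exec_rarr _ (by
      simp [progMin, Prog.WritesReal]
      try omega), z2 a ha (by omega)]
  have hG : ∀ u v : Fin s, σ₃.rarr 5 u v = ((R * Pi)ᵀ * (R * Pi)) u v := by
    intro u v
    rw [← h₃, exec_rarr _ (by simp [progMin, Prog.WritesReal]), b1 u u.2 v v.2, Matrix.mul_apply,
      ← Fin.sum_univ_eq_sum_range (fun i => σ₁.rarr 4 i u * σ₁.rarr 4 i v)]
    exact Finset.sum_congr rfl fun i _ => by rw [a1, a1, Matrix.transpose_apply]
  obtain ⟨d1, d2⟩ := progCholesky_spec hs0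
    (Matrix.posSemidef_conjTranspose_mul_self (R * Pi)) (rank_gram_le hk Pi) c1 s3 hG
    (z3 6 (by norm_num) (by norm_num))
  rw [← hr] at d1 d2
  obtain ⟨σ₄, h₄⟩ : ∃ τ, (progCholesky.exec σ₃).1 = τ := ⟨_, rfl⟩
  rw [h₄] at d1
  have k4 : σ₄.ivar 1 = r := by
    rw [← h₄, exec_ivar _ (by simp [progCholesky, progPivot, progColumn, progDowndate, Prog.addTo, Prog.WritesVar]), c1]
  have s4 : σ₄.ivar 2 = s := by
    rw [← h₄, exec_ivar _ (by simp [progCholesky, progPivot, progColumn, progDowndate, Prog.addTo, Prog.WritesVar]), s3]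
  have z4 : ∀ a, 2 ≤ a → a < 4 ∨ 7 ≤ a → σ₄.rarr a = 0 := fun a ha ha' => by
    rw [← h₄, exec_rarr _ (by
      simp [progCholesky, progPivot, progColumn, progDowndate, Prog.addTo, Prog.WritesReal]
      try omega), z3 a ha (by omega)]
  set M : Matrix (Fin s) (Fin r) ℝ := Matrix.of fun u q => σ₄.rarr 6 u q with hM
  have hfac : (R * Pi)ᵀ * (R * Pi) = M * Mᵀ := by
    ext u v
    refine (d1 u v).trans ?_
    rw [Matrix.mul_apply, ← Fin.sum_univ_eq_sum_range (fun q => σ₄.rarr 6 u q * σ₄.rarr 6 v q)]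
    rfl
  obtain ⟨e1, e2⟩ := gram_spec (src := 6) (out := 7) (va := 1) (vb := 2) (by norm_num)
    (by norm_num) (by norm_num) k4 s4 (z4 7 (by norm_num) (by norm_num))
  rw [← progSmallGram] at e1 e2
  obtain ⟨σ₅, h₅⟩ : ∃ τ, (progSmallGram.exec σ₄).1 = τ := ⟨_, rfl⟩
  rw [h₅] at e1
  have k5 : σ₅.ivar 1 = r := by
    rw [← h₅, exec_ivar _ (by simp [progSmallGram, Prog.addTo, Prog.WritesVar]), k4]
  have z5 : ∀ a, 2 ≤ a → a < 4 ∨ 8 ≤ a → σ₅.rarr a = 0 := fun a ha ha' => by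
    rw [← h₅, exec_rarr _ (by
      simp [progSmallGram, Prog.addTo, Prog.WritesReal]
      try omega), z4 a ha (by omega)]
  have hK : ∀ u v : Fin r, σ₅.rarr 7 u v = (Mᵀ * M) u v := by
    intro u v
    rw [e1 u u.2 v v.2, Matrix.mul_apply,
      ← Fin.sum_univ_eq_sum_range (fun i => σ₄.rarr 6 i u * σ₄.rarr 6 i v)]
    rfl
  have hKH : (Mᵀ * M).IsHermitian := Matrix.isHermitian_conjTranspose_mul_self M
  obtain ⟨f1, f2⟩ := progPowers_spec k5 hK (z5 8 (by norm_num) (by norm_num))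
    (z5 9 (by norm_num) (by norm_num))
  obtain ⟨σ₆, h₆⟩ : ∃ τ, (progPowers.exec σ₅).1 = τ := ⟨_, rfl⟩
  rw [h₆] at f1
  have k6 : σ₆.ivar 1 = r := by
    rw [← h₆, exec_ivar _ (by simp [progPowers, progOne, progNextPower, progTrace, Prog.addTo, Prog.WritesVar]), k5]
  have z6 : ∀ a, 2 ≤ a → a < 4 ∨ 10 ≤ a → σ₆.rarr a = 0 := fun a ha ha' => by
    rw [← h₆, exec_rarr _ (by
      simp [progPowers, progOne, progNextPower, progTrace, Prog.addTo, Prog.WritesReal]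
      try omega), z5 a ha (by omega)]
  obtain ⟨g1, g2⟩ := progNewton_spec (c := fun q => (Mᵀ * M).charpoly.coeff (r - q))
    (p := fun i => ((Mᵀ * M) ^ (i + 1)).trace) k6 f1 (z6 11 (by norm_num) (by norm_num))
    (z6 12 (by norm_num) (by norm_num))
    (by simpa using (Mᵀ * M).charpoly_monic.coeff_natDegree)
    (fun m hm => mul_coeff_charpoly_eq hKH hm)
  obtain ⟨σ₇, h₇⟩ : ∃ τ, (progNewton.exec σ₆).1 = τ := ⟨_, rfl⟩
  rw [h₇] at g1
  have k7 : σ₇.ivar 1 = r := by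
    rw [← h₇, exec_ivar _ (by simp [progNewton, progConv, Prog.addTo, Prog.WritesVar]), k6]
  have z7 : ∀ a, 2 ≤ a → a < 4 ∨ 13 ≤ a → σ₇.rarr a = 0 := fun a ha ha' => by
    rw [← h₇, exec_rarr _ (by
      simp [progNewton, progConv, Prog.addTo, Prog.WritesReal]
      try omega), z6 a ha (by omega)]
  obtain ⟨o1, o2, o3⟩ := progOutput_spec (r := approxProbs R Pi) k7
    (z7 2 le_rfl (by norm_num)) (z7 3 (by norm_num) (by norm_num)) (by
      intro j _
      rw [monicPoly_eq_charpoly g1, ← sq_approxProbs_of_factorization hfac,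
        Real.sqrt_sq (approxProbs_nonneg _ _ _)])
  simp only [progMain, exec_seq, h₁, h₂, h₃, h₄, h₅, h₆, h₇]
  refine ⟨⟨fun i _ => ?_, ?_⟩, phases_cost_le hn0 hs0 (min_le_right _ _)
    ((Nat.pow_le_pow_left (min_le_left _ _) 2).trans hks) a2 b2 c2 d2 e2 f2 g2 o3⟩
  · rw [o1]
    split_ifs with hi
    · rfl
    · exact (approxProbs_eq_zero_of_factorization hfac (not_lt.1 hi)).symm
  · rw [o2, approxEntropy]
    -- The program sums over `min k n` terms; the singular values beyond that vanish.
    refine Finset.sum_subset (Finset.range_mono (min_le_left _ _)) fun i _ hi => ?_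
    rw [Finset.mem_range, not_lt] at hi
    rw [approxProbs_eq_zero_of_factorization hfac hi, zero_mul]

/-- With `x = k² / ε² ≥ 1`, rounding up gives `s < 20 x + 1 ≤ 21 x`, and `441 = 21 ^ 2`. -/
theorem size_bounds {n k s : ℕ} {ε : ℝ} (hk : 0 < k) (h0 : 0 < ε) (h1 : ε < 1 / 2)
    (hs : s = ⌈20 * (k : ℝ) ^ 2 / ε ^ 2⌉₊) :
    k ^ 2 ≤ s ∧ (n : ℝ) * (s : ℝ) ^ 2 ≤ 441 * ((n : ℝ) * (k : ℝ) ^ 4 / ε ^ 4) := by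
  have hk1 : (1 : ℝ) ≤ (k : ℝ) ^ 2 := one_le_pow₀ (by exact_mod_cast hk)
  have hε : ε ^ 2 ≤ 1 := pow_le_one₀ h0.le (by linarith)
  set x : ℝ := (k : ℝ) ^ 2 / ε ^ 2 with hx
  have hkx : (k : ℝ) ^ 2 ≤ x := le_div_self (by positivity) (by positivity) hε
  have hs' : s = ⌈20 * x⌉₊ := by rw [hs, hx, mul_div_assoc]
  have hle : 20 * x ≤ s := hs' ▸ Nat.le_ceil _
  have hlt : (s : ℝ) < 20 * x + 1 := hs' ▸ Nat.ceil_lt_add_one (by positivity)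
  refine ⟨by exact_mod_cast (by linarith : (k : ℝ) ^ 2 ≤ s), ?_⟩
  have h2 : (s : ℝ) ^ 2 ≤ (21 * x) ^ 2 := pow_le_pow_left₀ (by positivity) (by linarith) 2
  have e : 441 * ((n : ℝ) * (k : ℝ) ^ 4 / ε ^ 4) = n * (21 * x) ^ 2 := by
    rw [hx]; field_simp; ring
  rw [e]
  exact mul_le_mul_of_nonneg_left h2 (by positivity)

theorem progMain_correct {n k s : ℕ} {ε : ℝ} {R : Matrix (Fin n) (Fin n) ℝ} {hR : IsDensity R}
    (hk : AtMostNonzero hR k) (h0 : 0 < ε) (h1 : ε < 1 / 2)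
    (hs : s = ⌈20 * (k : ℝ) ^ 2 / ε ^ 2⌉₊) {L : List (Fin n × Fin n)} (hL : ListsSupport R L)
    (ω : SparseChoice n s) :
    HoldsOutput k R (sparseSketch ω) (progMain.exec (initMem k R L ω)).1 ∧
      ((progMain.exec (initMem k R L ω)).2 : ℝ) ≤
        125000 * ((nnz R : ℝ) + (n : ℝ) * (k : ℝ) ^ 4 / ε ^ 4) := by
  obtain ⟨hks, hns⟩ := size_bounds (n := n) (pos_of_atMostNonzero hk) h0 h1 hs
  obtain ⟨hout, hcost⟩ := progMain_spec hk hks hL ω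
  refine ⟨hout, ?_⟩
  generalize (progMain.exec (initMem k R L ω)).2 = t at hcost ⊢
  -- The constant `125000` covers `278 * 441 = 122598`.
  have hc : (t : ℝ) ≤ 25 * (nnz R : ℝ) + 278 * ((n : ℝ) * (s : ℝ) ^ 2) := by exact_mod_cast hcost
  have hz : (0 : ℝ) ≤ (nnz R : ℝ) := Nat.cast_nonneg _
  have hw : 0 ≤ (n : ℝ) * (k : ℝ) ^ 4 / ε ^ 4 := by positivity
  linarith

end RandProj
theorem mainTheorem3 :
    -- the input-sparsity transform: accuracy and running time
    (∃ c : ℝ, 0 < c ∧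
      (∀ (n k : ℕ) (ε : ℝ) (R : Matrix (Fin n) (Fin n) ℝ) (hR : RandProj.IsDensity R),
        RandProj.AtMostNonzero hR k → 0 < ε → ε < 1 / 2 →
        ∀ s : ℕ, c * (k : ℝ) ^ 2 / ε ^ 2 ≤ s →
          9 / 10 ≤ (ProbabilityTheory.uniformOn
              (Set.univ : Set (RandProj.SparseChoice n s))).real
            {ω | RandProj.Accurate hR k ε (RandProj.sparseSketch ω)}) ∧
      (∃ (P : RandProj.Prog) (C : ℝ), 0 < C ∧
        ∀ (n k : ℕ) (ε : ℝ) (R : Matrix (Fin n) (Fin n) ℝ) (hR : RandProj.IsDensity R),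
          RandProj.AtMostNonzero hR k → 0 < ε → ε < 1 / 2 →
          ∀ (s : ℕ), s = ⌈c * (k : ℝ) ^ 2 / ε ^ 2⌉₊ →
          ∀ (L : List (Fin n × Fin n)), RandProj.ListsSupport R L →
          ∀ ω : RandProj.SparseChoice n s,
            RandProj.HoldsOutput k R (RandProj.sparseSketch ω)
              (P.exec (RandProj.initMem k R L ω)).1 ∧
            ((P.exec (RandProj.initMem k R L ω)).2 : ℝ) ≤
              C * ((RandProj.nnz R : ℝ) + (n : ℝ) * (k : ℝ) ^ 4 / ε ^ 4))) ∧
    -- the (rescaled) subsampled randomized Hadamard transform: accuracy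
    (∃ c : ℝ, 0 < c ∧
      ∀ (n k : ℕ) (ε : ℝ) (R : Matrix (Fin n) (Fin n) ℝ) (hR : RandProj.IsDensity R),
        RandProj.AtMostNonzero hR k → 0 < ε → ε < 1 / 2 →
        ∀ s : ℕ, c * ((k : ℝ) + Real.log n) * Real.log (k + 1) / ε ^ 2 ≤ s →
          9 / 10 ≤ (ProbabilityTheory.uniformOn
              (Set.univ : Set (RandProj.HadamardChoice n s))).real
            {ω | RandProj.Accurate hR k ε (RandProj.hadamardSketch ω)}) := by
  exact ⟨⟨20, by norm_num, fun n k ε R hR hk h0 h1 s hs =>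
    RandProj.sparse_accurate hR hk h0 h1 hs, RandProj.progMain, 125000, by norm_num,
    fun n k ε R hR hk h0 h1 s hs L hL ω => RandProj.progMain_correct hk h0 h1 hs hL ω⟩, 672,
    by norm_num, fun n k ε R hR hk h0 h1 s hs => RandProj.hadamard_accurate hR hk h0 h1 hs⟩
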